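/- Theorem. There is an algorithm for the following task, whose running time is $O\bigl(6^{2h}\,(2|V|-1)\bigr)$, where the constant is absolute (it depends neither on the input nor on $h$). Input: a finite simple graph $G=(V,E)$ with $V\neq\emptyset$, and a branch decomposition $(T,\phi)$ of $G$ of width $h$. Output: a maximum 2-edge-colorable subgraph of $G$, that is, a subgraph $H$ of $G$ which is 2-edge-colorable (its edges can be colored with two colors so that adjacent edges receive different colors) and which has the largest number of edges among all 2-edge-colorable subgraphs of $G$, together with a 2-edge-coloring of $H$. Here a branch decomposition of $G$ is a pair $(T,\phi)$ where $T$ is a finite tree in which every node that is not a leaf has degree three, and $\phi$ is a bijection from $E$ to the leaves of $T$ (if $|E|=1$ then $T$ is a single node, which counts as a leaf; if $E=\emptyset$ then $T$ is empty). Removing an edge of $T$ splits $T$ into two components and hence splits $E$ into two parts $X$ and $E\setminus X$; the border $\delta(X)$ is the set of vertices of $G$ that are incident both to an edge in $X$ and to an edge in $E\setminus X$. The width of $(T,\phi)$ is the maximum of $|\delta(X)|$ over all edges of $T$ ($0$ if $T$ has no edge). The graph and the tree are given by lists of their edges (in any order), with the leaf $\phi(e)$ listed for every $e\in E$. Running time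 is the number of steps of a random access machine with unit-cost addition, truncated subtraction, test for zero and memory access on natural numbers. -/

import Mathlib

/-! ### Branch decompositions -/

/-- A branch decomposition of the graph `G` with set of nodes `W`: a tree all of whose nodes are
leaves or have degree three, and a bijection from the edges of `G` to the leaves.
A leaf is a node of degree at most one, so the tree with a single node has one leaf and decomposes
the graphs with one edge.  The tree without nodes is admitted (`Preconnected`); it is the
decomposition of the graphs without edges, and only of these. -/
structure BranchDecomposition {V : Type} (G : SimpleGraph V) (W : Type) [Finite W] where
  /-- the tree -/
  tree : SimpleGraph W
  preconnected : tree.Preconnected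
  acyclic : tree.IsAcyclic
  leaf_or_degree_three : ∀ t : W,
    (tree.neighborSet t).ncard ≤ 1 ∨ (tree.neighborSet t).ncard = 3
  /-- the bijection from the edges of `G` to the leaves of the tree -/
  leaf : G.edgeSet ≃ {t : W // (tree.neighborSet t).ncard ≤ 1}

/-- The border `δ(X)` of a set `X` of edges of `G`: the vertices that are incident both to an edge
in `X` and to an edge outside `X`. -/
def edgeBorder {V : Type} {G : SimpleGraph V} (X : Set G.edgeSet) : Set V :=
  {v | (∃ e : G.edgeSet, e ∈ X ∧ v ∈ (e : Sym2 V)) ∧ ∃ e : G.edgeSet, e ∉ X ∧ v ∈ (e : Sym2 V)}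

namespace BranchDecomposition

variable {V : Type} {G : SimpleGraph V} {W : Type} [Finite W]

/-- The edges of `G` whose leaves lie on the side of `s` when the edge `s t` of the tree is
removed. -/
def side (D : BranchDecomposition G W) (s t : W) : Set G.edgeSet :=
  {e | (D.tree.deleteEdges {s(s, t)}).Reachable s (D.leaf e : W)}

/-- The width: the maximum, over the edges `s t` of the tree, of the number of border vertices of
the bipartition of the edges of `G` that `s t` induces (and `0` if the tree has no edge). -/
noncomputable def width (D : BranchDecomposition G W) : ℕ :=
  sSup {k | ∃ s t : W, D.tree.Adj s t ∧ k = (edgeBorder (D.side s t)).ncard}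

end BranchDecomposition

/-! ### Maximum edge-colourable subgraphs -/

/-- `H` is a maximum `k`-edge-colourable subgraph of `G`: a subgraph (vertices outside its edges
are immaterial, so it is given on all vertices) that is `k`-edge-colourable and has the largest
number of edges among these.  Edge colourings are vertex colourings of the line graph. -/
def IsMaxEdgeColorableSubgraph {V : Type} (G : SimpleGraph V) (k : ℕ) (H : SimpleGraph V) : Prop :=
  H ≤ G ∧ H.lineGraph.Colorable k ∧
    ∀ H' : SimpleGraph V, H' ≤ G → H'.lineGraph.Colorable k →
      H'.edgeSet.ncard ≤ H.edgeSet.ncard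

/-! ### Random access machine programs with a step count -/

namespace RAM

/-- The memory: integer variables, and arrays with random access.  A program mentions only finitely
many variables and finitely many arrays. -/
structure Store where
  var : ℕ → ℕ
  arr : ℕ → ℕ → ℕ

/-- The memory after the variable `x` has received the value `v`. -/
def Store.setVar (σ : Store) (x v : ℕ) : Store where
  var := Function.update σ.var x v
  arr := σ.arr

/-- The memory after the entry `i` of the array `a` has received the value `v`. -/
def Store.setEntry (σ : Store) (a i v : ℕ) : Store where
  var := σ.var
  arr := Function.update σ.arr a (Function.update (σ.arr a) i v)

/-- Expressions: constants, variables, array entries, sums and truncated differences. -/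
inductive Expr where
  | const (c : ℕ)
  | var (x : ℕ)
  | get (a : ℕ) (i : Expr)
  | add (e f : Expr)
  | sub (e f : Expr)

/-- The value of an expression. -/
def Expr.eval (σ : Store) : Expr → ℕ
  | .const c => c
  | .var x => σ.var x
  | .get a i => σ.arr a (i.eval σ)
  | .add e f => e.eval σ + f.eval σ
  | .sub e f => e.eval σ - f.eval σ

/-- The number of steps that the evaluation of an expression takes: one for each operation and for
each access to the memory. -/
def Expr.cost : Expr → ℕ
  | .const _ => 1
  | .var _ => 1
  | .get _ i => i.cost + 1
  | .add e f => e.cost + f.cost + 1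
  | .sub e f => e.cost + f.cost + 1

/-- Programs.  The conditions of `ite` and `loop` (a while loop) hold if the expression is not
zero. -/
inductive Prog where
  | skip
  | assign (x : ℕ) (e : Expr)
  | store (a : ℕ) (i e : Expr)
  | seq (p q : Prog)
  | ite (e : Expr) (p q : Prog)
  | loop (e : Expr) (p : Prog)

/-- `Exec p σ t τ`: started with the memory `σ`, the program `p` halts after exactly `t` steps with
the memory `τ`. -/
inductive Exec : Prog → Store → ℕ → Store → Prop where
  | skip (σ : Store) : Exec .skip σ 1 σ
  | assign (x : ℕ) (e : Expr) (σ : Store) :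
      Exec (.assign x e) σ (e.cost + 1) (σ.setVar x (e.eval σ))
  | store (a : ℕ) (i e : Expr) (σ : Store) :
      Exec (.store a i e) σ (i.cost + e.cost + 1) (σ.setEntry a (i.eval σ) (e.eval σ))
  | seq {p q : Prog} {σ τ ρ : Store} {t u : ℕ} :
      Exec p σ t τ → Exec q τ u ρ → Exec (.seq p q) σ (t + u) ρ
  | ite_true {e : Expr} {p : Prog} (q : Prog) {σ τ : Store} {t : ℕ} :
      e.eval σ ≠ 0 → Exec p σ t τ → Exec (.ite e p q) σ (e.cost + 1 + t) τ
  | ite_false {e : Expr} (p : Prog) {q : Prog} {σ τ : Store} {t : ℕ} :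
      e.eval σ = 0 → Exec q σ t τ → Exec (.ite e p q) σ (e.cost + 1 + t) τ
  | loop_true {e : Expr} {p : Prog} {σ τ ρ : Store} {t u : ℕ} :
      e.eval σ ≠ 0 → Exec p σ t τ → Exec (.loop e p) τ u ρ →
      Exec (.loop e p) σ (e.cost + 1 + t + u) ρ
  | loop_false {e : Expr} (p : Prog) {σ : Store} :
      e.eval σ = 0 → Exec (.loop e p) σ (e.cost + 1) σ

/-- The contents of an array that holds a given tuple, followed by zeros. -/
def arrayOf {k : ℕ} (f : Fin k → ℕ) : ℕ → ℕ := fun i => if h : i < k then f ⟨i, h⟩ else 0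

end RAM

/-! ### The input of the algorithm -/

/-- A description of a graph on `{0, …, n - 1}` and of a branch decomposition of it with nodes
`{0, …, N - 1}` by two lists of edges, in any order, each edge occurring once, with its endpoints
in any order. -/
structure Listing {n N : ℕ} (G : SimpleGraph (Fin n)) (D : BranchDecomposition G (Fin N)) where
  /-- the number of edges of the graph -/
  m : ℕ
  edge : Fin m ≃ G.edgeSet
  src : Fin m → Fin n
  dst : Fin m → Fin n
  edge_eq : ∀ i, (edge i : Sym2 (Fin n)) = s(src i, dst i)
  /-- the number of edges of the tree -/
  k : ℕ
  treeEdge : Fin k ≃ D.tree.edgeSet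
  treeSrc : Fin k → Fin N
  treeDst : Fin k → Fin N
  treeEdge_eq : ∀ i, (treeEdge i : Sym2 (Fin N)) = s(treeSrc i, treeDst i)

namespace Listing

variable {n N : ℕ} {G : SimpleGraph (Fin n)} {D : BranchDecomposition G (Fin N)}

/-- The initial memory: variables 0 to 3 hold the numbers of vertices, edges, nodes and tree edges,
arrays 0 and 1 the endpoints of the edges of the graph, array 2 the leaves to which these edges
are mapped, arrays 3 and 4 the endpoints of the edges of the tree; everything else is zero. -/
noncomputable def input (L : Listing G D) : RAM.Store where
  var
    | 0 => n
    | 1 => L.m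
    | 2 => N
    | 3 => L.k
    | _ => 0
  arr
    | 0 => RAM.arrayOf fun i => (L.src i : ℕ)
    | 1 => RAM.arrayOf fun i => (L.dst i : ℕ)
    | 2 => RAM.arrayOf fun i => ((D.leaf (L.edge i) : Fin N) : ℕ)
    | 3 => RAM.arrayOf fun i => (L.treeSrc i : ℕ)
    | 4 => RAM.arrayOf fun i => (L.treeDst i : ℕ)
    | _ => fun _ => 0

/-- Array 5 of the memory `τ` describes a subgraph `H` together with an edge colouring of `H`: its
`i`-th entry is `0` if the `i`-th edge of `G` is not in `H`, and the colour, as one of the numbers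
`1, …, k`, of that edge otherwise. -/
def Outputs (L : Listing G D) (τ : RAM.Store) {k : ℕ} (H : SimpleGraph (Fin n))
    (c : H.lineGraph.Coloring (Fin k)) : Prop :=
  ∀ i : Fin L.m,
    ((L.edge i : Sym2 (Fin n)) ∉ H.edgeSet → τ.arr 5 i = 0) ∧
    ∀ h : (L.edge i : Sym2 (Fin n)) ∈ H.edgeSet, τ.arr 5 i = (c ⟨L.edge i, h⟩ : ℕ) + 1

end Listing

/-! ### Reasoning about programs -/

namespace RAM

/-- Started with the memory `σ`, the program `p` halts after at most `T` steps with a memory that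
satisfies `Q`. -/
def Runs (p : Prog) (σ : Store) (T : ℕ) (Q : Store → Prop) : Prop :=
  ∃ t τ, Exec p σ t τ ∧ t ≤ T ∧ Q τ

/-- Whether a program may change a variable. -/
def Prog.setsVar (x : ℕ) : Prog → Bool
  | .skip => false
  | .assign y _ => x == y
  | .store _ _ _ => false
  | .seq p q => p.setsVar x || q.setsVar x
  | .ite _ p q => p.setsVar x || q.setsVar x
  | .loop _ p => p.setsVar x

/-- Whether a program may change an array. -/
def Prog.setsArr (a : ℕ) : Prog → Bool
  | .skip => false
  | .assign _ _ => false
  | .store b _ _ => a == b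
  | .seq p q => p.setsArr a || q.setsArr a
  | .ite _ p q => p.setsArr a || q.setsArr a
  | .loop _ p => p.setsArr a

/-- The memories agree on everything that `p` does not mention on a left-hand side. -/
structure Frame (p : Prog) (σ τ : Store) : Prop where
  var : ∀ x, p.setsVar x = false → τ.var x = σ.var x
  arr : ∀ a, p.setsArr a = false → τ.arr a = σ.arr a

theorem Frame.refl (p : Prog) (σ : Store) : Frame p σ σ := ⟨fun _ _ => rfl, fun _ _ => rfl⟩

theorem Frame.trans {p : Prog} {σ τ ρ : Store} (h : Frame p σ τ) (h' : Frame p τ ρ) :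
    Frame p σ ρ :=
  ⟨fun x hx => (h'.var x hx).trans (h.var x hx), fun a ha => (h'.arr a ha).trans (h.arr a ha)⟩

theorem Frame.mono {p q : Prog} {σ τ : Store} (h : Frame p σ τ)
    (hv : ∀ x, q.setsVar x = false → p.setsVar x = false)
    (ha : ∀ a, q.setsArr a = false → p.setsArr a = false) : Frame q σ τ :=
  ⟨fun x hx => h.var x (hv x hx), fun a hx => h.arr a (ha a hx)⟩

theorem Exec.frame {p : Prog} {σ τ : Store} {t : ℕ} (h : Exec p σ t τ) : Frame p σ τ := by
  induction h with
  | skip σ => exact Frame.refl _ _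
  | assign x e σ =>
    refine ⟨fun y hy => ?_, fun _ _ => rfl⟩
    have : y ≠ x := by simpa [Prog.setsVar] using hy
    simp [Store.setVar, this]
  | store a i e σ =>
    refine ⟨fun _ _ => rfl, fun b hb => ?_⟩
    have : b ≠ a := by simpa [Prog.setsArr] using hb
    simp [Store.setEntry, this]
  | seq _ _ h₁ h₂ =>
    exact (h₁.mono (fun x hx => by simp_all [Prog.setsVar])
      (fun x hx => by simp_all [Prog.setsArr])).trans
      (h₂.mono (fun x hx => by simp_all [Prog.setsVar]) (fun x hx => by simp_all [Prog.setsArr]))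
  | ite_true q _ _ h =>
    exact h.mono (fun x hx => by simp_all [Prog.setsVar]) (fun x hx => by simp_all [Prog.setsArr])
  | ite_false p _ _ h =>
    exact h.mono (fun x hx => by simp_all [Prog.setsVar]) (fun x hx => by simp_all [Prog.setsArr])
  | loop_true _ _ _ h₁ h₂ =>
    exact (h₁.mono (fun x hx => by simp_all [Prog.setsVar])
      (fun x hx => by simp_all [Prog.setsArr])).trans h₂
  | loop_false p _ => exact Frame.refl _ _

namespace Runs

variable {p q : Prog} {σ τ : Store} {T T' U : ℕ} {Q R : Store → Prop}

theorem mono (h : Runs p σ T Q) (hT : T ≤ T') (hQ : ∀ τ, Q τ → R τ) : Runs p σ T' R :=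
  let ⟨t, τ, h₁, h₂, h₃⟩ := h
  ⟨t, τ, h₁, h₂.trans hT, hQ τ h₃⟩

theorem frame (h : Runs p σ T Q) : Runs p σ T fun τ => Q τ ∧ Frame p σ τ :=
  let ⟨t, τ, h₁, h₂, h₃⟩ := h
  ⟨t, τ, h₁, h₂, h₃, h₁.frame⟩

theorem seq (hp : Runs p σ T R) (hq : ∀ τ, R τ → Runs q τ U Q) :
    Runs (.seq p q) σ (T + U) Q := by
  obtain ⟨t, τ, h₁, h₂, h₃⟩ := hp
  obtain ⟨u, ρ, h₄, h₅, h₆⟩ := hq τ h₃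
  exact ⟨t + u, ρ, h₁.seq h₄, by omega, h₆⟩

/-- Sequential composition where the second program may use what the first leaves unchanged. -/
theorem seq_frame (hp : Runs p σ T R) (hq : ∀ τ, R τ → Frame p σ τ → Runs q τ U Q) :
    Runs (.seq p q) σ (T + U) Q :=
  hp.frame.seq fun τ h => hq τ h.1 h.2

theorem ite {e : Expr} (hp : e.eval σ ≠ 0 → Runs p σ T Q) (hq : e.eval σ = 0 → Runs q σ T Q) :
    Runs (.ite e p q) σ (e.cost + 1 + T) Q := by
  by_cases h : e.eval σ = 0
  · obtain ⟨t, τ, h₁, h₂, h₃⟩ := hq h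
    exact ⟨_, τ, .ite_false p h h₁, by omega, h₃⟩
  · obtain ⟨t, τ, h₁, h₂, h₃⟩ := hp h
    exact ⟨_, τ, .ite_true q h h₁, by omega, h₃⟩

/-- The rule for loops, where the invariant `I` carries the number of iterations that may still
follow. -/
theorem loop {e : Expr} {I : ℕ → Store → Prop}
    (step : ∀ k τ, I k τ → Frame p σ τ → e.eval τ ≠ 0 →
      ∃ k' < k, Runs p τ T (I k')) (k : ℕ) (h : I k σ) :
    Runs (.loop e p) σ (k * (e.cost + 1 + T) + (e.cost + 1)) fun τ =>
      (∃ k', I k' τ) ∧ e.eval τ = 0 := by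
  suffices H : ∀ k τ, I k τ → Frame p σ τ →
      Runs (.loop e p) τ (k * (e.cost + 1 + T) + (e.cost + 1)) fun τ =>
        (∃ k', I k' τ) ∧ e.eval τ = 0 from H k σ h (Frame.refl _ _)
  intro k
  induction k using Nat.strong_induction_on with
  | _ k ih =>
    intro τ hI hF
    by_cases he : e.eval τ = 0
    · exact ⟨_, τ, .loop_false p he, by omega, ⟨k, hI⟩, he⟩
    · obtain ⟨k', hk, t, ρ, h₁, h₂, h₃⟩ := step k τ hI hF he
      obtain ⟨u, ρ', h₄, h₅, h₆⟩ := ih k' hk ρ h₃ (hF.trans h₁.frame)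
      refine ⟨_, ρ', .loop_true he h₁ h₄, ?_, h₆⟩
      have : (k' + 1) * (e.cost + 1 + T) ≤ k * (e.cost + 1 + T) := Nat.mul_le_mul_right _ hk
      rw [Nat.add_mul] at this
      omega

/-- The rule for counting loops. -/
theorem for_loop {e : Expr} {n : ℕ} {I : ℕ → Store → Prop}
    (guard : ∀ j τ, j ≤ n → I j τ → Frame p σ τ → (e.eval τ ≠ 0 ↔ j < n))
    (step : ∀ j τ, j < n → I j τ → Frame p σ τ → Runs p τ T (I (j + 1))) (h : I 0 σ) :
    Runs (.loop e p) σ (n * (e.cost + 1 + T) + (e.cost + 1)) (I n) := by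
  have := loop (p := p) (σ := σ) (T := T) (e := e)
    (I := fun k τ => ∃ j, j + k = n ∧ I j τ ∧ Frame p σ τ) (fun k τ hI hF he => by
      obtain ⟨j, hj, hI, -⟩ := hI
      have hlt := (guard j τ (by omega) hI hF).1 he
      refine ⟨k - 1, by omega, ((step j τ hlt hI hF).frame).mono le_rfl fun ρ hρ => ?_⟩
      exact ⟨j + 1, by omega, hρ.1, hF.trans hρ.2⟩) n ⟨0, by omega, h, Frame.refl _ _⟩
  refine this.mono le_rfl ?_
  rintro τ ⟨⟨k, j, hj, hI, hF⟩, he⟩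
  have : ¬ j < n := fun hlt => (guard j τ (by omega) hI hF).2 hlt he
  obtain rfl : j = n := by omega
  exact hI

end Runs

/-- Whether a program has no loops. -/
def Prog.loopFree : Prog → Bool
  | .seq p q => p.loopFree && q.loopFree
  | .ite _ p q => p.loopFree && q.loopFree
  | .loop _ _ => false
  | _ => true

/-- A bound for the number of steps of a program without loops. -/
def Prog.maxCost : Prog → ℕ
  | .skip => 1
  | .assign _ e => e.cost + 1
  | .store _ i e => i.cost + e.cost + 1
  | .seq p q => p.maxCost + q.maxCost
  | .ite e p q => e.cost + 1 + max p.maxCost q.maxCost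
  | .loop _ _ => 0

/-- The memory with which a program without loops halts. -/
def Prog.result : Prog → Store → Store
  | .skip, σ => σ
  | .assign x e, σ => σ.setVar x (e.eval σ)
  | .store a i e, σ => σ.setEntry a (i.eval σ) (e.eval σ)
  | .seq p q, σ => q.result (p.result σ)
  | .ite e p q, σ => if e.eval σ = 0 then q.result σ else p.result σ
  | .loop _ _, σ => σ

theorem Runs.of_result {p : Prog} {σ : Store} {Q : Store → Prop} (hp : p.loopFree = true)
    (h : Q (p.result σ)) : Runs p σ p.maxCost Q := by
  suffices H : ∀ σ, ∃ t ≤ p.maxCost, Exec p σ t (p.result σ) by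
    obtain ⟨t, ht, he⟩ := H σ
    exact ⟨t, _, he, ht, h⟩
  clear h
  induction p with
  | skip => exact fun σ => ⟨_, le_rfl, .skip σ⟩
  | assign x e => exact fun σ => ⟨_, le_rfl, .assign x e σ⟩
  | store a i e => exact fun σ => ⟨_, le_rfl, .store a i e σ⟩
  | seq p q ihp ihq =>
    intro σ
    simp only [Prog.loopFree, Bool.and_eq_true] at hp
    obtain ⟨t, ht, h₁⟩ := ihp hp.1 σ
    obtain ⟨u, hu, h₂⟩ := ihq hp.2 (p.result σ)
    exact ⟨_, add_le_add ht hu, h₁.seq h₂⟩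
  | ite e p q ihp ihq =>
    intro σ
    simp only [Prog.loopFree, Bool.and_eq_true] at hp
    by_cases he : e.eval σ = 0
    · obtain ⟨t, ht, h₁⟩ := ihq hp.2 σ
      refine ⟨e.cost + 1 + t, ?_, ?_⟩
      · simp only [Prog.maxCost]; omega
      · simpa [Prog.result, he] using Exec.ite_false p he h₁
    · obtain ⟨t, ht, h₁⟩ := ihp hp.1 σ
      refine ⟨e.cost + 1 + t, ?_, ?_⟩
      · simp only [Prog.maxCost]; omega
      · simpa [Prog.result, he] using Exec.ite_true q he h₁
  | loop e p => simp [Prog.loopFree] at hp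

end RAM

/-! ### Codes of subsets of a list -/

namespace SlotCode

open Finset

/-- The weight of an element of a list: two to the power of its position. -/
def wt (l : List ℕ) (s : ℕ) : ℕ := if s ∈ l then 2 ^ l.idxOf s else 0

/-- The code of a set of elements of a list; other elements do not count. -/
def code (l : List ℕ) (S : Finset ℕ) : ℕ := ∑ s ∈ S, wt l s

theorem wt_ne_zero {l : List ℕ} {s : ℕ} : wt l s ≠ 0 ↔ s ∈ l := by
  unfold wt; split_ifs <;> simp_all

theorem wt_append_of_ne {l : List ℕ} {a s : ℕ} (h : s ≠ a) : wt (l ++ [a]) s = wt l s := by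
  unfold wt
  by_cases hs : s ∈ l
  · simp [hs, List.idxOf_append_of_mem]
  · simp [hs, h]

theorem wt_append_self {l : List ℕ} {a : ℕ} (h : a ∉ l) : wt (l ++ [a]) a = 2 ^ l.length := by
  unfold wt
  simp [List.idxOf_append_of_notMem h]

theorem code_congr {l l' : List ℕ} {S : Finset ℕ} (h : ∀ s ∈ S, wt l s = wt l' s) :
    code l S = code l' S := sum_congr rfl h

theorem code_insert {l : List ℕ} {S : Finset ℕ} {a : ℕ} (h : a ∉ S) :
    code l (insert a S) = code l S + wt l a := by
  rw [code, sum_insert h, add_comm]; rfl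

theorem code_eq_sum (l : List ℕ) (S : Finset ℕ) :
    code l S = ∑ j ∈ (S.filter (· ∈ l)).image l.idxOf, 2 ^ j := by
  rw [sum_image, code, sum_filter]
  · rfl
  · intro s hs t ht hst
    simp only [coe_filter, Set.mem_ofPred_eq] at hs ht
    exact (List.idxOf_inj hs.2).1 hst

theorem code_lt (l : List ℕ) (S : Finset ℕ) : code l S < 2 ^ l.length := by
  rw [code_eq_sum]
  refine Nat.geomSum_lt le_rfl fun k hk => ?_
  simp only [mem_image, mem_filter] at hk
  obtain ⟨s, hs, rfl⟩ := hk
  exact List.idxOf_lt_length_of_mem hs.2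

theorem code_inj {l : List ℕ} {S S' : Finset ℕ} (h : code l S = code l S') :
    ∀ s ∈ l, s ∈ S ↔ s ∈ S' := by
  rw [code_eq_sum, code_eq_sum] at h
  have key := Finset.geomSum_injective le_rfl h
  suffices H : ∀ S S' : Finset ℕ, (S.filter (· ∈ l)).image l.idxOf =
      (S'.filter (· ∈ l)).image l.idxOf → ∀ s ∈ l, s ∈ S → s ∈ S' from
    fun s hs => ⟨H S S' key s hs, H S' S key.symm s hs⟩
  intro S S' key s hs h
  have : l.idxOf s ∈ (S'.filter (· ∈ l)).image l.idxOf := by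
    rw [← key]; exact mem_image_of_mem _ (by simp [h, hs])
  simp only [mem_image, mem_filter] at this
  obtain ⟨t, ⟨ht, htl⟩, hts⟩ := this
  exact ((List.idxOf_inj htl).1 hts) ▸ ht

theorem code_eq_of_forall {l : List ℕ} {S S' : Finset ℕ} (h : ∀ s ∈ l, s ∈ S ↔ s ∈ S') :
    code l S = code l S' := by
  rw [code_eq_sum, code_eq_sum]
  congr 2
  ext s
  simp only [mem_filter]
  exact ⟨fun hs => ⟨(h s hs.2).1 hs.1, hs.2⟩, fun hs => ⟨(h s hs.2).2 hs.1, hs.2⟩⟩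

end SlotCode

/-! ### Partial edge colourings and the slots they use

The slot `2 v + c - 1` stands for the colour `c` at the vertex `v`. -/

namespace Slots

open Finset SlotCode

variable (src dst : ℕ → ℕ)

/-- The slots at the ends of an edge. -/
def touch (i : ℕ) : Finset ℕ := {2 * src i, 2 * dst i, 2 * src i + 1, 2 * dst i + 1}

/-- The slots that the edge `i` uses if it receives the colour `c`, where `0` means no colour. -/
def slots (i c : ℕ) : Finset ℕ := if c = 0 then ∅ else {2 * src i + (c - 1), 2 * dst i + (c - 1)}

/-- The slots that the edges in `X` use. -/
def used (X : Finset ℕ) (f : ℕ → ℕ) : Finset ℕ := X.biUnion fun i => slots src dst i (f i)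

/-- Proper partial colourings of the edges in `X` with the colours `1` and `2`. -/
def Valid (X : Finset ℕ) (f : ℕ → ℕ) : Prop :=
  (∀ i ∈ X, f i ≤ 2) ∧
    ∀ i ∈ X, ∀ j ∈ X, i ≠ j → Disjoint (slots src dst i (f i)) (slots src dst j (f j))

/-- The number of coloured edges. -/
def size (X : Finset ℕ) (f : ℕ → ℕ) : ℕ := #{i ∈ X | f i ≠ 0}

/-- The number of edges in `X` at a slot. -/
def cnt (X : Finset ℕ) (s : ℕ) : ℕ := #{i ∈ X | s ∈ touch src dst i}

/-- The slots at the vertices on the border of `X`. -/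
def border (m : ℕ) (X : Finset ℕ) : Finset ℕ :=
  {s ∈ X.biUnion (touch src dst) | cnt src dst X s < cnt src dst (range m) s}

variable {src dst} {m : ℕ} {X Y : Finset ℕ} {f : ℕ → ℕ}

theorem slots_subset_touch {i c : ℕ} (hc : c ≤ 2) : slots src dst i c ⊆ touch src dst i := by
  intro s
  unfold slots touch
  interval_cases c <;> simp <;> tauto

theorem cnt_pos {s : ℕ} : 0 < cnt src dst X s ↔ s ∈ X.biUnion (touch src dst) := by
  simp [cnt, card_pos, Finset.Nonempty, mem_biUnion]

theorem mem_border {s : ℕ} : s ∈ border src dst m X ↔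
    0 < cnt src dst X s ∧ cnt src dst X s < cnt src dst (range m) s := by
  simp only [border, mem_filter, cnt_pos]

theorem cnt_union (h : Disjoint X Y) (s : ℕ) :
    cnt src dst (X ∪ Y) s = cnt src dst X s + cnt src dst Y s := by
  unfold cnt
  rw [filter_union, card_union_of_disjoint (disjoint_filter_filter h)]

theorem cnt_mono (h : X ⊆ Y) (s : ℕ) : cnt src dst X s ≤ cnt src dst Y s :=
  card_le_card (filter_subset_filter _ h)

theorem size_union (h : Disjoint X Y) (f : ℕ → ℕ) : size (X ∪ Y) f = size X f + size Y f := by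
  unfold size
  rw [filter_union, card_union_of_disjoint (disjoint_filter_filter h)]

theorem used_union : used src dst (X ∪ Y) f = used src dst X f ∪ used src dst Y f :=
  union_biUnion ..

theorem Valid.cnt_pos (hf : Valid src dst X f) {s : ℕ} (hs : s ∈ used src dst X f) :
    0 < cnt src dst X s := by
  simp only [used, mem_biUnion] at hs
  obtain ⟨i, hi, hs⟩ := hs
  exact Slots.cnt_pos.2 (mem_biUnion.2 ⟨i, hi, slots_subset_touch (hf.1 i hi) hs⟩)

theorem valid_union (h : Disjoint X Y) : Valid src dst (X ∪ Y) f ↔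
    Valid src dst X f ∧ Valid src dst Y f ∧ Disjoint (used src dst X f) (used src dst Y f) := by
  constructor
  · intro hf
    refine ⟨⟨fun i hi => hf.1 i (mem_union_left _ hi), fun i hi j hj => hf.2 i
      (mem_union_left _ hi) j (mem_union_left _ hj)⟩, ⟨fun i hi => hf.1 i (mem_union_right _ hi),
      fun i hi j hj => hf.2 i (mem_union_right _ hi) j (mem_union_right _ hj)⟩, ?_⟩
    simp only [used, disjoint_biUnion_left, disjoint_biUnion_right]
    intro i hi j hj
    exact hf.2 _ (mem_union_left _ hj) _ (mem_union_right _ hi)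
      fun hij => disjoint_left.1 h hj (hij ▸ hi)
  · rintro ⟨hX, hY, hd⟩
    simp only [used, disjoint_biUnion_left, disjoint_biUnion_right] at hd
    refine ⟨fun i hi => ?_, fun i hi j hj hij => ?_⟩
    · rcases mem_union.1 hi with hi | hi
      exacts [hX.1 i hi, hY.1 i hi]
    · rcases mem_union.1 hi with hi | hi <;> rcases mem_union.1 hj with hj | hj
      exacts [hX.2 i hi j hj hij, hd _ hj _ hi, (hd _ hi _ hj).symm, hY.2 i hi j hj hij]

/-- The lists of slots that serve to code the states at `X`. -/
structure BorderList (src dst : ℕ → ℕ) (m : ℕ) (X : Finset ℕ) (l : List ℕ) : Prop where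
  nodup : l.Nodup
  border : ∀ s, 0 < cnt src dst X s → cnt src dst X s < cnt src dst (range m) s → s ∈ l
  touch : ∀ s ∈ l, 0 < cnt src dst X s

/-- The list for the union of two sets of edges. -/
structure MergedList (src dst : ℕ → ℕ) (m : ℕ) (X Y : Finset ℕ) (l₁ l₂ l : List ℕ) : Prop where
  disj : Disjoint X Y
  sub : X ∪ Y ⊆ range m
  left : BorderList src dst m X l₁
  right : BorderList src dst m Y l₂
  nodup : l.Nodup
  mem : ∀ s, s ∈ l ↔ (s ∈ l₁ ∨ s ∈ l₂) ∧
    cnt src dst X s + cnt src dst Y s < cnt src dst (range m) s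

namespace MergedList

variable {l₁ l₂ l : List ℕ} (h : MergedList src dst m X Y l₁ l₂ l)
include h

theorem cnt_le (s : ℕ) :
    cnt src dst X s + cnt src dst Y s ≤ cnt src dst (range m) s := by
  rw [← cnt_union h.disj]; exact cnt_mono h.sub s

theorem mem_iff (s : ℕ) : s ∈ l ↔ s ∈ Slots.border src dst m (X ∪ Y) := by
  rw [h.mem, mem_border, cnt_union h.disj]
  constructor
  · rintro ⟨hs | hs, hlt⟩
    · have := h.left.touch s hs; omega
    · have := h.right.touch s hs; omega
  · rintro ⟨hpos, hlt⟩
    refine ⟨?_, hlt⟩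
    by_cases hX : 0 < cnt src dst X s
    · exact .inl (h.left.border s hX (by omega))
    · exact .inr (h.right.border s (by omega) (by omega))

theorem borderList : BorderList src dst m (X ∪ Y) l where
  nodup := h.nodup
  border s h₁ h₂ := (h.mem_iff s).2 (mem_border.2 ⟨h₁, h₂⟩)
  touch s hs := (mem_border.1 ((h.mem_iff s).1 hs)).1

theorem length_eq : l.length = #(Slots.border src dst m (X ∪ Y)) := by
  rw [← List.toFinset_card_of_nodup h.nodup]
  congr 1
  ext s
  rw [List.mem_toFinset, h.mem_iff]

theorem code_used (hX : Valid src dst X f) (hY : Valid src dst Y f) {S₁ S₂ : Finset ℕ}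
    (h₁ : ∀ s ∈ l₁, s ∈ used src dst X f ↔ s ∈ S₁) (h₂ : ∀ s ∈ l₂, s ∈ used src dst Y f ↔ s ∈ S₂)
    (hS₁ : ∀ s ∈ S₁, s ∈ l₁) (hS₂ : ∀ s ∈ S₂, s ∈ l₂) :
    code l (used src dst (X ∪ Y) f) = code l (S₁ ∪ S₂) := by
  refine code_eq_of_forall fun s hs => ?_
  have hs' := ((h.mem s).1 hs).2
  rw [used_union, mem_union, mem_union]
  constructor
  · rintro (hu | hu)
    · exact .inl ((h₁ s (h.left.border s (hX.cnt_pos hu) (by omega))).1 hu)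
    · exact .inr ((h₂ s (h.right.border s (hY.cnt_pos hu) (by omega))).1 hu)
  · rintro (hu | hu)
    · exact .inl ((h₁ s (hS₁ s hu)).2 hu)
    · exact .inr ((h₂ s (hS₂ s hu)).2 hu)

theorem valid (hX : Valid src dst X f) (hY : Valid src dst Y f) {S₁ S₂ : Finset ℕ}
    (h₁ : ∀ s ∈ l₁, s ∈ used src dst X f ↔ s ∈ S₁) (h₂ : ∀ s ∈ l₂, s ∈ used src dst Y f ↔ s ∈ S₂)
    (hd : Disjoint S₁ S₂) : Valid src dst (X ∪ Y) f := by
  refine (valid_union h.disj).2 ⟨hX, hY, disjoint_left.2 fun s hsX hsY => ?_⟩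
  have hcX := hX.cnt_pos hsX
  have hcY := hY.cnt_pos hsY
  have := h.cnt_le s
  exact disjoint_left.1 hd ((h₁ s (h.left.border s hcX (by omega))).1 hsX)
    ((h₂ s (h.right.border s hcY (by omega))).1 hsY)

end MergedList

/-! ### The number of edges -/

/-- The edges in `X` with an end that has no edge outside `X`. -/
def captured (src dst : ℕ → ℕ) (m : ℕ) (X : Finset ℕ) : Finset ℕ :=
  {i ∈ X | ∃ s ∈ touch src dst i, s ∉ border src dst m X}

/-- The slots at vertices all of whose edges are in `X`. -/
def finished (src dst : ℕ → ℕ) (m : ℕ) (X : Finset ℕ) : Finset ℕ :=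
  X.biUnion (touch src dst) \ border src dst m X

/-- The edges in `X` with one end finished and the other one in `B`. -/
theorem card_filter_ends_le (hinj : ∀ i < m, ∀ j < m,
      s(src i, dst i) = s(src j, dst j) → i = j) (hX : X ⊆ range m) (A B : Finset ℕ)
    (h : ∀ i ∈ X, (2 * src i ∈ A ∧ 2 * dst i ∈ B) ∨ (2 * dst i ∈ A ∧ 2 * src i ∈ B)) :
    #X ≤ #A * #B := by
  classical
  rw [← card_product]
  let g : ℕ → ℕ × ℕ := fun i =>
    if 2 * src i ∈ A ∧ 2 * dst i ∈ B then (2 * src i, 2 * dst i) else (2 * dst i, 2 * src i)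
  refine card_le_card_of_injOn g (fun i hi => ?_) fun i hi j hj hij => ?_
  · rcases h i hi with h' | h'
    · simp only [g, h', and_self, if_true, coe_product, Set.mem_prod]; exact h'
    · simp only [g]
      split_ifs with h''
      · simp only [coe_product, Set.mem_prod]; exact h''
      · simp only [coe_product, Set.mem_prod]; exact h'
  · refine hinj i (mem_range.1 (hX hi)) j (mem_range.1 (hX hj)) ?_
    simp only [g] at hij
    rw [Sym2.eq_iff]
    split_ifs at hij <;> simp only [Prod.mk.injEq] at hij <;> omega

theorem even_slot_mem_border {v : ℕ} :
    2 * v + 1 ∈ border src dst m X ↔ 2 * v ∈ border src dst m X := by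
  have : ∀ X : Finset ℕ, cnt src dst X (2 * v + 1) = cnt src dst X (2 * v) := by
    intro X
    unfold cnt
    congr 1
    ext i
    simp only [touch, mem_filter, mem_insert, mem_singleton]
    refine and_congr_right fun _ => ?_
    omega
  rw [mem_border, mem_border, this, this]

theorem mem_captured {i : ℕ} : i ∈ captured src dst m X ↔ i ∈ X ∧
    (2 * src i ∉ border src dst m X ∨ 2 * dst i ∉ border src dst m X) := by
  have h₁ := even_slot_mem_border (src := src) (dst := dst) (m := m) (X := X) (v := src i)
  have h₂ := even_slot_mem_border (src := src) (dst := dst) (m := m) (X := X) (v := dst i)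
  rw [captured, mem_filter]
  simp only [touch, mem_insert, mem_singleton]
  refine and_congr_right fun _ => ?_
  constructor
  · rintro ⟨s, rfl | rfl | rfl | rfl, hs⟩ <;> tauto
  · rintro (hs | hs)
    · exact ⟨_, .inl rfl, hs⟩
    · exact ⟨_, .inr (.inl rfl), hs⟩

theorem mem_finished {s : ℕ} : s ∈ finished src dst m X ↔
    0 < cnt src dst X s ∧ ¬ cnt src dst X s < cnt src dst (range m) s := by
  rw [finished, mem_sdiff, ← cnt_pos, mem_border]
  tauto

theorem card_captured_union {L : ℕ} (hinj : ∀ i < m, ∀ j < m,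
      s(src i, dst i) = s(src j, dst j) → i = j) (hd : Disjoint X Y) (hsub : X ∪ Y ⊆ range m)
    (hX : #(border src dst m X) ≤ L) (hY : #(border src dst m Y) ≤ L)
    (cX : #(captured src dst m X) ≤ (2 * L + 1) * #(finished src dst m X))
    (cY : #(captured src dst m Y) ≤ (2 * L + 1) * #(finished src dst m Y)) :
    #(captured src dst m (X ∪ Y)) ≤ (2 * L + 1) * #(finished src dst m (X ∪ Y)) := by
  classical
  have hcu := cnt_union (src := src) (dst := dst) hd
  have hle : ∀ s, cnt src dst X s + cnt src dst Y s ≤ cnt src dst (range m) s := fun s => by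
    rw [← hcu]; exact cnt_mono hsub s
  set F := finished src dst m (X ∪ Y) \ (finished src dst m X ∪ finished src dst m Y) with hF
  have hdF : Disjoint (finished src dst m X) (finished src dst m Y) := by
    refine disjoint_left.2 fun s h₁ h₂ => ?_
    rw [mem_finished] at h₁ h₂
    have := hle s
    omega
  have hsF : finished src dst m X ∪ finished src dst m Y ⊆ finished src dst m (X ∪ Y) := by
    intro s hs
    rw [mem_union, mem_finished, mem_finished] at hs
    rw [mem_finished, hcu]
    omega
  have hcard : #F + (#(finished src dst m X) + #(finished src dst m Y)) =
      #(finished src dst m (X ∪ Y)) := by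
    rw [← card_union_of_disjoint hdF, hF, card_sdiff_add_card_eq_card hsF]
  have key : ∀ Z ⊆ X ∪ Y, #(border src dst m Z) ≤ L →
      (∀ s, cnt src dst Z s < cnt src dst (range m) s → 0 < cnt src dst Z s →
        s ∉ finished src dst m X ∪ finished src dst m Y) →
      #{i ∈ Z | i ∉ captured src dst m Z ∧ i ∈ captured src dst m (X ∪ Y)} ≤ #F * L := by
    intro Z hZ hb hfin
    refine (card_filter_ends_le hinj ((filter_subset _ _).trans (hZ.trans hsub)) F
      (border src dst m Z) ?_).trans (Nat.mul_le_mul_left _ hb)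
    intro i hi
    rw [mem_filter, mem_captured, mem_captured] at hi
    obtain ⟨hi, h₁, h₂⟩ := hi
    have h₃ : 2 * src i ∈ border src dst m Z := by tauto
    have h₄ : 2 * dst i ∈ border src dst m Z := by tauto
    have h₅ := mem_border.1 h₃
    have h₆ := mem_border.1 h₄
    have aux : ∀ s, s ∈ border src dst m Z → s ∉ border src dst m (X ∪ Y) → s ∈ F := by
      intro s hs hs'
      have hs₁ := mem_border.1 hs
      refine mem_sdiff.2 ⟨?_, hfin s hs₁.2 hs₁.1⟩
      rw [mem_border] at hs'
      rw [mem_finished]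
      have := cnt_mono (src := src) (dst := dst) hZ s
      omega
    rcases h₂.2 with h | h
    · exact .inl ⟨aux _ h₃ h, h₄⟩
    · exact .inr ⟨aux _ h₄ h, h₃⟩
  have kX := key X subset_union_left hX fun s h₁ h₂ h => by
    have := hle s
    rw [mem_union, mem_finished, mem_finished] at h
    omega
  have kY := key Y subset_union_right hY fun s h₁ h₂ h => by
    have := hle s
    rw [mem_union, mem_finished, mem_finished] at h
    omega
  have hcov : captured src dst m (X ∪ Y) ⊆
      (captured src dst m X ∪ {i ∈ X | i ∉ captured src dst m X ∧ i ∈ captured src dst m (X ∪ Y)}) ∪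
      (captured src dst m Y ∪
        {i ∈ Y | i ∉ captured src dst m Y ∧ i ∈ captured src dst m (X ∪ Y)}) := by
    intro i hi
    have : i ∈ X ∪ Y := (mem_filter.1 hi).1
    simp only [mem_union, mem_filter] at this ⊢
    tauto
  have h₁ := card_le_card hcov
  have h₂ := card_union_le (captured src dst m X ∪
    {i ∈ X | i ∉ captured src dst m X ∧ i ∈ captured src dst m (X ∪ Y)}) (captured src dst m Y ∪
        {i ∈ Y | i ∉ captured src dst m Y ∧ i ∈ captured src dst m (X ∪ Y)})
  have h₃ := card_union_le (captured src dst m X)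
    {i ∈ X | i ∉ captured src dst m X ∧ i ∈ captured src dst m (X ∪ Y)}
  have h₄ := card_union_le (captured src dst m Y)
    {i ∈ Y | i ∉ captured src dst m Y ∧ i ∈ captured src dst m (X ∪ Y)}
  rw [← hcard]
  nlinarith

theorem card_captured_of_card_le_one {L : ℕ} (hX : #X ≤ 1) :
    #(captured src dst m X) ≤ (2 * L + 1) * #(finished src dst m X) := by
  rcases (captured src dst m X).eq_empty_or_nonempty with h | ⟨i, hi⟩
  · simp [h]
  · have h₁ : #(captured src dst m X) ≤ 1 := (card_le_card (filter_subset _ _)).trans hX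
    have h₂ : 0 < #(finished src dst m X) := by
      rw [card_pos]
      obtain ⟨hi, s, hs, hs'⟩ := mem_filter.1 hi
      exact ⟨s, mem_sdiff.2 ⟨mem_biUnion.2 ⟨i, hi, hs⟩, hs'⟩⟩
    nlinarith

end Slots

/-! ### Contracting a tree by peeling off its leaves -/

namespace Peeling

open Finset

set_option linter.unusedSectionVars false

variable {W : Type} [Fintype W] [DecidableEq W]

/-- The graph of the edges whose ends have the same representative. -/
def classGraph (T : SimpleGraph W) (rep : W → W) : SimpleGraph W where
  Adj a b := T.Adj a b ∧ rep a = rep b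
  symm := ⟨fun _ _ h => ⟨h.1.symm, h.2.symm⟩⟩
  loopless := ⟨fun _ h => T.loopless.irrefl _ h.1⟩

/-- A partition of the nodes of a tree into connected classes with representatives, such that the
edges between different classes join their representatives. -/
structure IsPeeling (T : SimpleGraph W) (rep : W → W) : Prop where
  idem : ∀ x, rep (rep x) = rep x
  adj : ∀ a b, T.Adj a b → rep a = rep b ∨ rep a = a ∧ rep b = b
  conn : ∀ x, (classGraph T rep).Reachable (rep x) x

open Classical in
/-- The neighbours that are representatives. -/
noncomputable def nbrs (T : SimpleGraph W) (rep : W → W) (x : W) : Finset W :=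
  {y | T.Adj x y ∧ rep y = y}

/-- The class of `t` is united with that of `p`. -/
def mergeRep (rep : W → W) (t p : W) (x : W) : W := if rep x = t then p else rep x

theorem mem_nbrs {T : SimpleGraph W} {rep : W → W} {x y : W} :
    y ∈ nbrs T rep x ↔ T.Adj x y ∧ rep y = y := by
  simp [nbrs]

theorem reachable_closed {V : Type} {G : SimpleGraph V} {P : V → Prop}
    (hP : ∀ u v, G.Adj u v → P u → P v) {a b : V} (h : G.Reachable a b) (ha : P a) : P b := by
  obtain ⟨w⟩ := h
  induction w with
  | nil => exact ha
  | cons hadj _ ih => exact ih (hP _ _ hadj ha)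

variable {T : SimpleGraph W} {rep : W → W}

theorem isPeeling_id (T : SimpleGraph W) : IsPeeling T id where
  idem _ := rfl
  adj _ _ _ := .inr ⟨rfl, rfl⟩
  conn _ := .refl _

namespace IsPeeling

variable (h : IsPeeling T rep) {t p : W}
include h

theorem eq_of_nbrs_eq_empty (hT : T.Preconnected) {x : W} (hx : rep x = x) (hn : nbrs T rep x = ∅)
    (y : W) : rep y = x := by
  refine reachable_closed (P := fun y => rep y = x) (fun u v huv hu => ?_) (hT x y) hx
  rcases h.adj u v huv with h' | ⟨h₁, h₂⟩
  · exact h' ▸ hu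
  · have : v ∈ nbrs T rep x := mem_nbrs.2 ⟨(h₁.symm.trans hu) ▸ huv, h₂⟩
    simp [hn] at this

theorem rep_eq_iff_reachable (ht : rep t = t) (hn : nbrs T rep t = {p}) (x : W) :
    rep x = t ↔ (T.deleteEdges {s(t, p)}).Reachable t x := by
  have hp : T.Adj t p ∧ rep p = p := mem_nbrs.1 (by simp [hn])
  have hne : t ≠ p := hp.1.ne
  constructor
  · rintro rfl
    refine (h.conn x).mono fun a b hab => ?_
    rw [SimpleGraph.deleteEdges_adj]
    refine ⟨hab.1, fun hs => ?_⟩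
    rw [Set.mem_singleton_iff, Sym2.eq_iff] at hs
    rcases hs with ⟨rfl, rfl⟩ | ⟨rfl, rfl⟩
    · exact hne (by rw [← ht, hab.2, hp.2])
    · exact hne (by rw [← ht, ← hab.2, hp.2])
  · intro hr
    refine reachable_closed (P := fun y => rep y = t) (fun u v huv hu => ?_) hr ht
    rw [SimpleGraph.deleteEdges_adj] at huv
    rcases h.adj u v huv.1 with h' | ⟨h₁, h₂⟩
    · exact h' ▸ hu
    · obtain rfl : u = t := h₁.symm.trans hu
      have : v ∈ nbrs T rep u := mem_nbrs.2 ⟨huv.1, h₂⟩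
      rw [hn, mem_singleton] at this
      exact absurd (by rw [this]; rfl) huv.2

theorem eq_of_rep_eq (hp : rep p = p) (hn : ∀ y, T.Adj p y → rep y = y) {x : W}
    (hx : rep x = p) : x = p := by
  have := h.conn x
  rw [hx] at this
  refine reachable_closed (P := fun y => y = p) (fun u v huv hu => ?_) this rfl
  subst hu
  exact ((hn v huv.1).symm.trans (huv.2.symm.trans hp))

variable (ht : rep t = t) (hn : nbrs T rep t = {p})
include ht hn

theorem mergeRep_eq_self_iff (x : W) : mergeRep rep t p x = x ↔ rep x = x ∧ x ≠ t := by
  have hp : T.Adj t p ∧ rep p = p := mem_nbrs.1 (by simp [hn])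
  unfold mergeRep
  split_ifs with hx
  · constructor
    · rintro rfl; exact absurd (hx.symm.trans hp.2) hp.1.ne
    · rintro ⟨h₁, h₂⟩; exact absurd (h₁.symm.trans hx) h₂
  · constructor
    · intro h₁; exact ⟨h₁, fun h₂ => hx (h₁.trans h₂)⟩
    · exact fun h₁ => h₁.1

theorem isPeeling_mergeRep : IsPeeling T (mergeRep rep t p) := by
  have hp : T.Adj t p ∧ rep p = p := mem_nbrs.1 (by simp [hn])
  have hne : t ≠ p := hp.1.ne
  have hmp : mergeRep rep t p p = p :=
    (h.mergeRep_eq_self_iff ht hn p).2 ⟨hp.2, hne.symm⟩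
  have hmt : mergeRep rep t p t = p := by simp [mergeRep, ht]
  refine ⟨fun x => ?_, fun a b hab => ?_, fun x => ?_⟩
  · by_cases hx : rep x = t
    · have : mergeRep rep t p x = p := by simp [mergeRep, hx]
      rw [this, hmp]
    · have : mergeRep rep t p x = rep x := by simp [mergeRep, hx]
      rw [this]
      exact (h.mergeRep_eq_self_iff ht hn _).2 ⟨h.idem x, hx⟩
  · rcases h.adj a b hab with h' | ⟨h₁, h₂⟩
    · left; simp [mergeRep, h']
    · by_cases ha : a = t
      · subst ha
        have : b ∈ nbrs T rep a := mem_nbrs.2 ⟨hab, h₂⟩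
        rw [hn, mem_singleton] at this
        left; rw [this, hmp, hmt]
      · by_cases hb : b = t
        · subst hb
          have : a ∈ nbrs T rep b := mem_nbrs.2 ⟨hab.symm, h₁⟩
          rw [hn, mem_singleton] at this
          left; rw [this, hmp, hmt]
        · exact .inr ⟨(h.mergeRep_eq_self_iff ht hn a).2 ⟨h₁, ha⟩,
            (h.mergeRep_eq_self_iff ht hn b).2 ⟨h₂, hb⟩⟩
  · have hle : classGraph T rep ≤ classGraph T (mergeRep rep t p) := fun a b hab =>
      ⟨hab.1, by simp [mergeRep, hab.2]⟩
    by_cases hx : rep x = t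
    · have h₁ : mergeRep rep t p x = p := by simp [mergeRep, hx]
      have h₂ : (classGraph T (mergeRep rep t p)).Adj p t := ⟨hp.1.symm, by rw [hmp, hmt]⟩
      rw [h₁]
      have h₃ := h.conn x
      rw [hx] at h₃
      exact h₂.reachable.trans (h₃.mono hle)
    · have h₁ : mergeRep rep t p x = rep x := by simp [mergeRep, hx]
      rw [h₁]
      exact (h.conn x).mono hle

theorem nbrs_merge (x : W) : nbrs T (mergeRep rep t p) x = (nbrs T rep x).erase t := by
  ext y
  rw [mem_nbrs, mem_erase, mem_nbrs, h.mergeRep_eq_self_iff ht hn]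
  tauto

omit h in
theorem mem_nbrs_iff {x : W} (hx : rep x = x) : t ∈ nbrs T rep x ↔ x = p := by
  rw [← mem_singleton, ← hn, mem_nbrs, mem_nbrs, T.adj_comm]
  exact ⟨fun h => ⟨h.1, hx⟩, fun h => ⟨h.1, ht⟩⟩

end IsPeeling

/-! ### The borders that occur -/

variable {n : ℕ} {G : SimpleGraph (Fin n)}

theorem ncard_edgeBorder_side_le (D : BranchDecomposition G W) {s t : W} (h : D.tree.Adj s t) :
    (edgeBorder (D.side s t)).ncard ≤ D.width := by
  refine le_csSup ⟨n, ?_⟩ ⟨s, t, h, rfl⟩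
  rintro k ⟨s, t, -, rfl⟩
  exact (Set.ncard_le_card _).trans_eq (by simp)

theorem IsPeeling.side_eq {D : BranchDecomposition G W} (h : IsPeeling D.tree rep) {t p : W}
    (ht : rep t = t) (hn : nbrs D.tree rep t = {p}) :
    {e : G.edgeSet | rep (D.leaf e) = t} = D.side t p := by
  ext e
  exact h.rep_eq_iff_reachable ht hn _

/-- The border of a class with one neighbouring class. -/
theorem IsPeeling.ncard_edgeBorder_le {D : BranchDecomposition G W} (h : IsPeeling D.tree rep)
    {t p : W} (ht : rep t = t) (hn : nbrs D.tree rep t = {p}) :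
    (edgeBorder {e : G.edgeSet | rep (D.leaf e) = t}).ncard ≤ D.width := by
  rw [h.side_eq ht hn]
  exact ncard_edgeBorder_side_le D (mem_nbrs.1 (show p ∈ nbrs D.tree rep t by simp [hn])).1

theorem IsPeeling.ncard_edgeBorder_merge_le {D : BranchDecomposition G W}
    (h : IsPeeling D.tree rep) {t p : W} (ht : rep t = t) (hn : nbrs D.tree rep t = {p}) :
    (edgeBorder {e : G.edgeSet | mergeRep rep t p (D.leaf e) = p}).ncard ≤ D.width := by
  have hp : D.tree.Adj t p ∧ rep p = p := mem_nbrs.1 (by simp [hn])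
  have hmp : mergeRep rep t p p = p := (h.mergeRep_eq_self_iff ht hn p).2 ⟨hp.2, hp.1.ne.symm⟩
  have h' := h.isPeeling_mergeRep ht hn
  have hcard : #(nbrs D.tree (mergeRep rep t p) p) + 1 = #(nbrs D.tree rep p) := by
    rw [h.nbrs_merge ht hn, card_erase_add_one]
    exact mem_nbrs.2 ⟨hp.1.symm, ht⟩
  have hsub : (nbrs D.tree rep p : Set W) ⊆ D.tree.neighborSet p := fun y hy =>
    (mem_nbrs.1 (mem_coe.1 hy)).1
  rcases Nat.lt_trichotomy (#(nbrs D.tree (mergeRep rep t p) p)) 1 with h₀ | h₁ | h₂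
  · have := h'.eq_of_nbrs_eq_empty D.preconnected hmp (card_eq_zero.1 (by omega))
    have hE : edgeBorder {e : G.edgeSet | mergeRep rep t p (D.leaf e) = p} = ∅ := by
      ext v
      simp [edgeBorder, this]
    rw [hE]; simp
  · obtain ⟨q, hq⟩ := card_eq_one.1 h₁
    exact h'.ncard_edgeBorder_le hmp hq
  · have hle := Set.ncard_le_ncard hsub
    rw [Set.ncard_coe_finset] at hle
    have hdeg := D.leaf_or_degree_three p
    have heq : (nbrs D.tree rep p : Set W) = D.tree.neighborSet p := by
      refine Set.eq_of_subset_of_ncard_le hsub ?_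
      rw [Set.ncard_coe_finset]; omega
    have hall : ∀ y, D.tree.Adj p y → rep y = y := fun y hy => by
      have : y ∈ (nbrs D.tree rep p : Set W) := heq ▸ hy
      exact (mem_nbrs.1 (mem_coe.1 this)).2
    have : {e : G.edgeSet | mergeRep rep t p (D.leaf e) = p} =
        {e : G.edgeSet | rep (D.leaf e) = t} := by
      ext e
      simp only [mergeRep, Set.mem_ofPred_eq]
      split_ifs with hx
      · simp [hx]
      · refine ⟨fun hx' => ?_, fun hx' => absurd hx' hx⟩
        have h₃ := h.eq_of_rep_eq hp.2 hall hx'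
        have h₄ := (D.leaf e).2
        rw [h₃] at h₄
        omega
    rw [this]
    exact h.ncard_edgeBorder_le ht hn

/-- The number of nodes of a branch decomposition. -/
theorem card_nodes_le [Nonempty W] (D : BranchDecomposition G W) :
    Fintype.card W ≤ 3 * G.edgeSet.ncard ∧ 0 < G.edgeSet.ncard := by
  classical
  have hT : D.tree.IsTree := ⟨⟨D.preconnected⟩, D.acyclic⟩
  have h₁ := hT.card_edgeFinset
  have h₂ := D.tree.sum_degrees_eq_twice_card_edges
  have hd : ∀ x, D.tree.degree x = (D.tree.neighborSet x).ncard := fun x => by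
    rw [← SimpleGraph.card_neighborSet_eq_degree, Set.ncard_eq_toFinset_card', Set.toFinset_card]
  have h₃ : #{x | D.tree.degree x ≤ 1} = G.edgeSet.ncard := by
    rw [← Nat.card_coe_set_eq, Nat.card_congr D.leaf, Nat.card_eq_fintype_card,
      Fintype.card_subtype]
    simp only [hd]
  have h₄ : ∀ x, 3 ≤ D.tree.degree x + if D.tree.degree x ≤ 1 then 3 else 0 := fun x => by
    have := D.leaf_or_degree_three x
    rw [← hd] at this
    split_ifs <;> omega
  have h₅ := sum_le_sum fun x (_ : x ∈ (univ : Finset W)) => h₄ x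
  rw [sum_add_distrib, h₂, ← sum_filter, sum_const, sum_const, h₃, card_univ] at h₅
  simp only [smul_eq_mul] at h₅
  omega

end Peeling

/-! ### The program -/

namespace RAM

@[simp] theorem Store.setVar_var (σ : Store) (x v y : ℕ) :
    (σ.setVar x v).var y = if y = x then v else σ.var y := by
  simp [Store.setVar, Function.update_apply]

@[simp] theorem Store.setVar_arr (σ : Store) (x v : ℕ) : (σ.setVar x v).arr = σ.arr := rfl

@[simp] theorem Store.setEntry_var (σ : Store) (a i v : ℕ) : (σ.setEntry a i v).var = σ.var := rfl

@[simp] theorem Store.setEntry_arr (σ : Store) (a i v b : ℕ) :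
    (σ.setEntry a i v).arr b = if b = a then Function.update (σ.arr a) i v else σ.arr b := by
  simp [Store.setEntry, Function.update_apply]

attribute [simp] Expr.eval Prog.result

end RAM

namespace MaxTwoColor

open RAM

notation "vN" => (0 : ℕ)
notation "vM" => (1 : ℕ)
notation "vNodes" => (2 : ℕ)
notation "vTree" => (3 : ℕ)
notation "vI" => (4 : ℕ)
notation "vStride" => (5 : ℕ)
notation "vRow" => (6 : ℕ)
notation "vNext" => (7 : ℕ)
notation "vBlocks" => (8 : ℕ)
notation "vNode" => (9 : ℕ)
notation "vParent" => (10 : ℕ)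
notation "vBlock" => (11 : ℕ)
notation "vLeft" => (12 : ℕ)
notation "vRight" => (13 : ℕ)
notation "vRowL" => (14 : ℕ)
notation "vRowR" => (15 : ℕ)
notation "vLen" => (16 : ℕ)
notation "vWt" => (17 : ℕ)
notation "vSlot" => (18 : ℕ)
notation "vX1" => (19 : ℕ)
notation "vX2" => (20 : ℕ)
notation "vX" => (21 : ℕ)
notation "vCnt" => (22 : ℕ)
notation "vT" => (23 : ℕ)
notation "vOld" => (24 : ℕ)
notation "vG" => (25 : ℕ)
notation "vV1" => (26 : ℕ)
notation "vV2" => (27 : ℕ)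
notation "vVal" => (28 : ℕ)
notation "vAddr" => (29 : ℕ)
notation "vJ" => (30 : ℕ)

notation "aSrc" => (0 : ℕ)
notation "aDst" => (1 : ℕ)
notation "aLeaf" => (2 : ℕ)
notation "aTreeSrc" => (3 : ℕ)
notation "aTreeDst" => (4 : ℕ)
notation "aOut" => (5 : ℕ)
notation "aDeg" => (6 : ℕ)
notation "aTreeDeg" => (7 : ℕ)
notation "aTreeSum" => (8 : ℕ)
notation "aCur" => (9 : ℕ)
notation "aLeft" => (10 : ℕ)
notation "aRight" => (11 : ℕ)
notation "aRow" => (12 : ℕ)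
notation "aLen" => (13 : ℕ)
notation "aBase" => (14 : ℕ)
notation "aList" => (15 : ℕ)
notation "aWt" => (16 : ℕ)
notation "aCnt" => (17 : ℕ)
notation "aVal" => (18 : ℕ)
notation "aLp" => (19 : ℕ)
notation "aRp" => (20 : ℕ)
notation "aT1" => (21 : ℕ)
notation "aT2" => (22 : ℕ)
notation "aT3" => (23 : ℕ)
notation "aSel" => (24 : ℕ)
notation "aCol" => (25 : ℕ)

infixr:30 " ⨟ " => Prog.seq
infix:35 " ≔ " => Prog.assign
infixl:65 " +ₑ " => Expr.add
infixl:65 " -ₑ " => Expr.sub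

/-- Add one to a variable. -/
def incr (x : ℕ) : Prog := x ≔ .var x +ₑ .const 1

/-- Append a triple to the list of triples. -/
def pushTriple (e₁ e₂ e₃ : Expr) : Prog :=
  .store aT1 (.var vT) e₁ ⨟ .store aT2 (.var vT) e₂ ⨟ .store aT3 (.var vT) e₃ ⨟ incr vT

/-- Append the triples that arise from the triple with number `vG`. -/
def expandBody : Prog :=
  .ite (.var vX1) (pushTriple (.get aT1 (.var vG) +ₑ .var vX1) (.get aT2 (.var vG))
    (.get aT3 (.var vG) +ₑ .var vX)) .skip ⨟
  .ite (.var vX2) (pushTriple (.get aT1 (.var vG)) (.get aT2 (.var vG) +ₑ .var vX2)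
    (.get aT3 (.var vG) +ₑ .var vX)) .skip ⨟
  incr vG

/-- Append the triples that arise from using the current slot on one of the two sides. -/
def expand : Prog :=
  vOld ≔ .var vT ⨟ vG ≔ .const 0 ⨟ .loop (.var vOld -ₑ .var vG) expandBody

/-- Look up the current slot in the two blocks, and append it to the list of the new block if it
is still on the border. -/
def lookUp : Prog :=
  vX1 ≔ .get aWt (.var vRowL +ₑ .var vSlot) ⨟
  vX2 ≔ .get aWt (.var vRowR +ₑ .var vSlot) ⨟
  vCnt ≔ .get aCnt (.var vRowL +ₑ .var vSlot) +ₑ .get aCnt (.var vRowR +ₑ .var vSlot) ⨟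
  .ite (.get aDeg (.var vSlot) -ₑ .var vCnt)
    (vX ≔ .var vWt ⨟
      .store aList (.var vRow +ₑ .var vLen) (.var vSlot) ⨟
      .store aWt (.var vRow +ₑ .var vSlot) (.var vWt) ⨟
      .store aCnt (.var vRow +ₑ .var vSlot) (.var vCnt) ⨟
      incr vLen ⨟
      vWt ≔ .var vWt +ₑ .var vWt)
    (vX ≔ .const 0)

/-- Process the current slot. -/
def handle : Prog := lookUp ⨟ expand

def leftSlots : Prog :=
  vJ ≔ .const 0 ⨟
  .loop (.get aLen (.var vLeft) -ₑ .var vJ)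
    (vSlot ≔ .get aList (.var vRowL +ₑ .var vJ) ⨟ handle ⨟ incr vJ)

def rightSlots : Prog :=
  vJ ≔ .const 0 ⨟
  .loop (.get aLen (.var vRight) -ₑ .var vJ)
    (vSlot ≔ .get aList (.var vRowR +ₑ .var vJ) ⨟
      .ite (.get aWt (.var vRowL +ₑ .var vSlot)) .skip handle ⨟ incr vJ)

/-- Use the triple with number `vJ` to improve the new table. -/
def improveBody : Prog :=
  vV1 ≔ .get aVal (.get aBase (.var vLeft) +ₑ .get aT1 (.var vJ)) ⨟
  vV2 ≔ .get aVal (.get aBase (.var vRight) +ₑ .get aT2 (.var vJ)) ⨟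
  vVal ≔ .var vV1 +ₑ .var vV2 -ₑ .const 1 ⨟
  vAddr ≔ .var vNext +ₑ .get aT3 (.var vJ) ⨟
  .ite (.var vV1) (.ite (.var vV2) (.ite (.var vVal -ₑ .get aVal (.var vAddr))
    (.store aVal (.var vAddr) (.var vVal) ⨟
      .store aLp (.var vAddr) (.get aT1 (.var vJ)) ⨟
      .store aRp (.var vAddr) (.get aT2 (.var vJ))) .skip) .skip) .skip ⨟
  incr vJ

def improve : Prog := vJ ≔ .const 0 ⨟ .loop (.var vT -ₑ .var vJ) improveBody

def startBlock : Prog :=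
  vLeft ≔ .get aLeft (.var vBlock) ⨟ vRight ≔ .get aRight (.var vBlock) ⨟
  vRowL ≔ .get aRow (.var vLeft) ⨟ vRowR ≔ .get aRow (.var vRight) ⨟
  .store aT1 (.const 0) (.const 0) ⨟ .store aT2 (.const 0) (.const 0) ⨟
  .store aT3 (.const 0) (.const 0) ⨟
  vT ≔ .const 1 ⨟ vLen ≔ .const 0 ⨟ vWt ≔ .const 1

def finishBlock : Prog :=
  .store aLen (.var vBlock) (.var vLen) ⨟ .store aBase (.var vBlock) (.var vNext) ⨟
  .store aRow (.var vBlock) (.var vRow) ⨟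
  vNext ≔ .var vNext +ₑ .var vWt ⨟ vRow ≔ .var vRow +ₑ .var vStride ⨟ incr vBlock

/-- Compute the table of the block `vBlock` from those of its two parts. -/
def mergeBlock : Prog := startBlock ⨟ leftSlots ⨟ rightSlots ⨟ improve ⨟ finishBlock

/-- Compute the tables of all blocks. -/
def computeTables : Prog :=
  vBlock ≔ .var vNodes ⨟ .loop (.var vBlocks -ₑ .var vBlock) mergeBlock

def degrees : Prog :=
  vI ≔ .const 0 ⨟
  .loop (.var vM -ₑ .var vI)
    (vSlot ≔ .get aSrc (.var vI) +ₑ .get aSrc (.var vI) ⨟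
      .store aDeg (.var vSlot) (.get aDeg (.var vSlot) +ₑ .const 1) ⨟
      incr vSlot ⨟
      .store aDeg (.var vSlot) (.get aDeg (.var vSlot) +ₑ .const 1) ⨟
      vSlot ≔ .get aDst (.var vI) +ₑ .get aDst (.var vI) ⨟
      .store aDeg (.var vSlot) (.get aDeg (.var vSlot) +ₑ .const 1) ⨟
      incr vSlot ⨟
      .store aDeg (.var vSlot) (.get aDeg (.var vSlot) +ₑ .const 1) ⨟
      incr vI)

def treeDegrees : Prog :=
  vI ≔ .const 0 ⨟
  .loop (.var vTree -ₑ .var vI)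
    (vNode ≔ .get aTreeSrc (.var vI) ⨟ vParent ≔ .get aTreeDst (.var vI) ⨟
      .store aTreeDeg (.var vNode) (.get aTreeDeg (.var vNode) +ₑ .const 1) ⨟
      .store aTreeDeg (.var vParent) (.get aTreeDeg (.var vParent) +ₑ .const 1) ⨟
      .store aTreeSum (.var vNode) (.get aTreeSum (.var vNode) +ₑ .var vParent) ⨟
      .store aTreeSum (.var vParent) (.get aTreeSum (.var vParent) +ₑ .var vNode) ⨟
      incr vI)

/-- Every node is its own block. -/
def initCur : Prog :=
  vI ≔ .const 0 ⨟
  .loop (.var vNodes -ₑ .var vI) (.store aCur (.var vI) (.var vI) ⨟ incr vI)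

/-- Set up the blocks of the nodes, without edges. -/
def initBlocks : Prog :=
  vI ≔ .const 0 ⨟ vStride ≔ .var vN +ₑ .var vN ⨟
  .loop (.var vNodes -ₑ .var vI)
    (.store aBase (.var vI) (.var vNext) ⨟ .store aRow (.var vI) (.var vRow) ⨟
      .store aVal (.var vNext) (.const 1) ⨟
      vNext ≔ .var vNext +ₑ .const 16 ⨟ vRow ≔ .var vRow +ₑ .var vStride ⨟ incr vI)

/-- Put the current slot on the list of the block of a leaf, with number `j` and weight `w`. -/
def putSlot (j w : ℕ) : Prog :=
  .store aList (.var vRowL +ₑ .const j) (.var vSlot) ⨟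
  .store aWt (.var vRowL +ₑ .var vSlot) (.const w) ⨟
  .store aCnt (.var vRowL +ₑ .var vSlot) (.const 1)

/-- Set up the blocks of the leaves. -/
def initLeaves : Prog :=
  vI ≔ .const 0 ⨟
  .loop (.var vM -ₑ .var vI)
    (vNode ≔ .get aLeaf (.var vI) ⨟ vRowL ≔ .get aRow (.var vNode) ⨟
      .store aLen (.var vNode) (.const 4) ⨟
      vSlot ≔ .get aSrc (.var vI) +ₑ .get aSrc (.var vI) ⨟ putSlot 0 1 ⨟
      vSlot ≔ .get aDst (.var vI) +ₑ .get aDst (.var vI) ⨟ putSlot 1 2 ⨟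
      vSlot ≔ .get aSrc (.var vI) +ₑ .get aSrc (.var vI) +ₑ .const 1 ⨟ putSlot 2 4 ⨟
      vSlot ≔ .get aDst (.var vI) +ₑ .get aDst (.var vI) +ₑ .const 1 ⨟ putSlot 3 8 ⨟
      .store aVal (.get aBase (.var vNode) +ₑ .const 3) (.const 2) ⨟
      .store aVal (.get aBase (.var vNode) +ₑ .const 12) (.const 2) ⨟
      incr vI)

/-- Unite the block of the node `vNode` with that of its last neighbour. -/
def peelStep : Prog :=
  vParent ≔ .get aTreeSum (.var vNode) ⨟
  .store aLeft (.var vBlocks) (.get aCur (.var vParent)) ⨟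
  .store aRight (.var vBlocks) (.get aCur (.var vNode)) ⨟
  .store aCur (.var vParent) (.var vBlocks) ⨟
  incr vBlocks ⨟
  .store aTreeDeg (.var vNode) (.const 0) ⨟
  .store aTreeDeg (.var vParent) (.get aTreeDeg (.var vParent) -ₑ .const 1) ⨟
  .store aTreeSum (.var vParent) (.get aTreeSum (.var vParent) -ₑ .var vNode) ⨟
  vNode ≔ .var vParent

/-- Find an order in which the tree can be contracted by peeling off its leaves. -/
def peel : Prog :=
  vI ≔ .const 0 ⨟ vNode ≔ .const 0 ⨟ vBlocks ≔ .var vNodes ⨟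
  .loop (.var vNodes -ₑ .var vI)
    (.ite ((.get aTreeDeg (.var vNode) -ₑ .const 1) +ₑ (.const 1 -ₑ .get aTreeDeg (.var vNode)))
      (incr vI ⨟ vNode ≔ .var vI) peelStep)

/-- Follow the pointers from the last block to those of the nodes.  If there is only one node, its
edge receives the first colour. -/
def trace : Prog :=
  .store aCol (.const 3) (.const 1) ⨟ .store aCol (.const 12) (.const 2) ⨟
  .ite (.var vNodes -ₑ .const 1) .skip (.store aSel (.const 0) (.const 3)) ⨟
  vBlock ≔ .var vBlocks ⨟
  .loop (.var vBlock -ₑ .var vNodes)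
    (vBlock ≔ .var vBlock -ₑ .const 1 ⨟
      vAddr ≔ .get aBase (.var vBlock) +ₑ .get aSel (.var vBlock) ⨟
      .store aSel (.get aLeft (.var vBlock)) (.get aLp (.var vAddr)) ⨟
      .store aSel (.get aRight (.var vBlock)) (.get aRp (.var vAddr)))

def output : Prog :=
  vI ≔ .const 0 ⨟
  .loop (.var vM -ₑ .var vI)
    (.store aOut (.var vI) (.get aCol (.get aSel (.get aLeaf (.var vI)))) ⨟ incr vI)

/-- Compute a maximum 2-edge-colourable subgraph. -/
def program : Prog :=
  treeDegrees ⨟ initCur ⨟ peel ⨟ degrees ⨟ initBlocks ⨟ initLeaves ⨟ computeTables ⨟ trace ⨟ output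

end MaxTwoColor

namespace MaxTwoColor

open RAM

/-! ### Expanding the list of triples -/

/-- The list of triples in the memory. -/
structure Holds (σ : Store) (ts : List (ℕ × ℕ × ℕ)) : Prop where
  length : σ.var vT = ts.length
  get : ∀ i (h : i < ts.length), (σ.arr aT1 i, σ.arr aT2 i, σ.arr aT3 i) = ts[i]

theorem Holds.of_eq {σ τ : Store} {ts : List (ℕ × ℕ × ℕ)} (h : Holds σ ts)
    (hT : τ.var vT = σ.var vT) (h₁ : τ.arr aT1 = σ.arr aT1) (h₂ : τ.arr aT2 = σ.arr aT2)
    (h₃ : τ.arr aT3 = σ.arr aT3) : Holds τ ts :=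
  ⟨hT.trans h.length, fun i hi => by rw [h₁, h₂, h₃, h.get i hi]⟩

theorem Holds.push {σ τ : Store} {ts : List (ℕ × ℕ × ℕ)} {a b c : ℕ} (h : Holds σ ts)
    (hT : τ.var vT = ts.length + 1) (h₁ : τ.arr aT1 = Function.update (σ.arr aT1) ts.length a)
    (h₂ : τ.arr aT2 = Function.update (σ.arr aT2) ts.length b)
    (h₃ : τ.arr aT3 = Function.update (σ.arr aT3) ts.length c) : Holds τ (ts ++ [(a, b, c)]) := by
  refine ⟨by simpa using hT, fun i hi => ?_⟩
  rw [h₁, h₂, h₃]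
  rcases Nat.lt_or_ge i ts.length with hlt | hge
  · rw [List.getElem_append_left hlt]
    simpa [Function.update_apply, hlt.ne] using h.get i hlt
  · have : i = ts.length := by simp at hi; omega
    subst this
    simp

/-- The triples that arise from a triple by using a slot on one of the two sides. -/
def expandStep (x₁ x₂ x : ℕ) (t : ℕ × ℕ × ℕ) : List (ℕ × ℕ × ℕ) :=
  (if x₁ = 0 then [] else [(t.1 + x₁, t.2.1, t.2.2 + x)]) ++
    if x₂ = 0 then [] else [(t.1, t.2.1 + x₂, t.2.2 + x)]

theorem runs_expand {σ : Store} {ts : List (ℕ × ℕ × ℕ)} (h : Holds σ ts) :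
    Runs expand σ (60 * (ts.length + 1)) fun τ =>
      Holds τ (ts ++ ts.flatMap (expandStep (σ.var vX1) (σ.var vX2) (σ.var vX))) := by
  have body : ∀ j τ, j < ts.length →
      (τ.var vOld = ts.length ∧ τ.var vG = j ∧ τ.var vX1 = σ.var vX1 ∧ τ.var vX2 = σ.var vX2 ∧
        τ.var vX = σ.var vX ∧ Holds τ (ts ++ (ts.take j).flatMap
          (expandStep (σ.var vX1) (σ.var vX2) (σ.var vX)))) →
      Runs expandBody τ expandBody.maxCost fun τ =>
        τ.var vOld = ts.length ∧ τ.var vG = j + 1 ∧ τ.var vX1 = σ.var vX1 ∧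
        τ.var vX2 = σ.var vX2 ∧ τ.var vX = σ.var vX ∧ Holds τ (ts ++ (ts.take (j + 1)).flatMap
          (expandStep (σ.var vX1) (σ.var vX2) (σ.var vX))) := by
    rintro j τ hj ⟨hO, hG, h1, h2, h3, hH⟩
    refine Runs.of_result rfl ?_
    have hget := hH.get j (by simp; omega)
    rw [List.getElem_append_left hj] at hget
    have hlen := hH.length
    rw [List.take_add_one, List.getElem?_eq_getElem hj, Option.toList_some, List.flatMap_append,
      List.flatMap_singleton, ← List.append_assoc, expandStep, ← hget]
    set us := ts ++ (ts.take j).flatMap (expandStep (σ.var vX1) (σ.var vX2) (σ.var vX)) with hus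
    have hju : j < us.length := by simp [hus]; omega
    by_cases hx1 : σ.var vX1 = 0 <;> by_cases hx2 : σ.var vX2 = 0
    · refine ⟨?_, ?_, ?_, ?_, ?_, ?_⟩ <;>
        simp [expandBody, pushTriple, incr, h1, h2, h3, hO, hG, hx1, hx2]
      exact hH.of_eq (by simp) rfl rfl rfl
    · refine ⟨?_, ?_, ?_, ?_, ?_, ?_⟩ <;>
        simp [expandBody, pushTriple, incr, h1, h2, h3, hO, hG, hx1, hx2]
      exact hH.push (by simp [hlen]) (by simp [hlen]) (by simp [hlen]) (by simp [hlen])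
    · refine ⟨?_, ?_, ?_, ?_, ?_, ?_⟩ <;>
        simp [expandBody, pushTriple, incr, h1, h2, h3, hO, hG, hx1, hx2]
      exact hH.push (by simp [hlen]) (by simp [hlen]) (by simp [hlen]) (by simp [hlen])
    · refine ⟨?_, ?_, ?_, ?_, ?_, ?_⟩ <;>
        simp [expandBody, pushTriple, incr, h1, h2, h3, hO, hG, hx1, hx2]
      have step1 : Holds (((((τ.setEntry aT1 us.length (τ.arr aT1 j + σ.var vX1)).setEntry aT2
        us.length (τ.arr aT2 j)).setEntry aT3 us.length (τ.arr aT3 j + σ.var vX))).setVar vT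
          (us.length + 1)) (us ++ [(τ.arr aT1 j + σ.var vX1, τ.arr aT2 j, τ.arr aT3 j + σ.var vX)]) :=
        hH.push (by simp) (by simp) (by simp) (by simp)
      have := step1.push (τ := (((((((((τ.setEntry aT1 us.length (τ.arr aT1 j + σ.var vX1)).setEntry aT2
        us.length (τ.arr aT2 j)).setEntry aT3 us.length (τ.arr aT3 j + σ.var vX))).setVar vT
          (us.length + 1)).setEntry aT1 (us.length + 1) (τ.arr aT1 j)).setEntry aT2 (us.length + 1)
            (τ.arr aT2 j + σ.var vX2)).setEntry aT3 (us.length + 1) (τ.arr aT3 j + σ.var vX)).setVar vT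
              (us.length + 1 + 1))) (a := τ.arr aT1 j) (b := τ.arr aT2 j + σ.var vX2)
        (c := τ.arr aT3 j + σ.var vX) (by simp) (by simp) (by simp) (by simp)
      rw [List.append_assoc] at this
      refine this.of_eq ?_ ?_ ?_ ?_ <;> simp [hlen, hju.ne]
  refine ((Runs.of_result (p := vOld ≔ .var vT) (Q := fun τ => τ.var vOld = ts.length ∧ Holds τ ts ∧
    τ.var vX1 = σ.var vX1 ∧ τ.var vX2 = σ.var vX2 ∧ τ.var vX = σ.var vX) rfl ?_).seq fun τ hτ => 
    (Runs.of_result (p := vG ≔ .const 0) (Q := fun τ => τ.var vOld = ts.length ∧ τ.var vG = 0 ∧ Holds τ ts ∧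
    τ.var vX1 = σ.var vX1 ∧ τ.var vX2 = σ.var vX2 ∧ τ.var vX = σ.var vX) rfl ?_).seq fun ρ hρ =>
    Runs.for_loop (T := expandBody.maxCost) (n := ts.length) (I := fun j τ => τ.var vOld = ts.length ∧ τ.var vG = j ∧
      τ.var vX1 = σ.var vX1 ∧ τ.var vX2 = σ.var vX2 ∧
        τ.var vX = σ.var vX ∧ Holds τ (ts ++ (ts.take j).flatMap
          (expandStep (σ.var vX1) (σ.var vX2) (σ.var vX)))) ?_ (fun j τ hj hI _ => body j τ hj hI) ?_).mono ?_ ?_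
  · simp [h.length]; exact h.of_eq (by simp) rfl rfl rfl
  · obtain ⟨h1, h2, h3⟩ := hτ
    simp [h1, h3]; exact h2.of_eq (by simp) rfl rfl rfl
  · rintro j τ - ⟨h1, h2, -⟩ -
    simp [h1, h2]
    omega
  · simp [hρ]
  · simp only [Prog.maxCost, Expr.cost, expandBody, pushTriple, incr, Nat.max_def]
    norm_num
    omega
  · rintro τ ⟨-, -, -, -, -, hH⟩
    simpa using hH

end MaxTwoColor

namespace MaxTwoColor

open RAM SlotCode Finset

/-- The triples of codes of pairs of disjoint sets of slots among those in `u`. -/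
def IsTripleList (l₁ l₂ l : List ℕ) (u : Finset ℕ) (ts : List (ℕ × ℕ × ℕ)) : Prop :=
  ∀ t, t ∈ ts ↔ ∃ S₁ S₂ : Finset ℕ, (∀ s ∈ S₁, s ∈ l₁ ∧ s ∈ u) ∧ (∀ s ∈ S₂, s ∈ l₂ ∧ s ∈ u) ∧
    Disjoint S₁ S₂ ∧ t = (code l₁ S₁, code l₂ S₂, code l (S₁ ∪ S₂))

theorem isTripleList_empty (l₁ l₂ l : List ℕ) : IsTripleList l₁ l₂ l ∅ [(0, 0, 0)] := by
  intro t
  rw [List.mem_singleton]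
  constructor
  · rintro rfl
    exact ⟨∅, ∅, by simp [code]⟩
  · rintro ⟨S₁, S₂, h₁, h₂, -, rfl⟩
    obtain rfl : S₁ = ∅ := eq_empty_of_forall_notMem fun s hs => by simpa using (h₁ s hs).2
    obtain rfl : S₂ = ∅ := eq_empty_of_forall_notMem fun s hs => by simpa using (h₂ s hs).2
    simp [code]

theorem mem_expandStep {x₁ x₂ x : ℕ} {t t' : ℕ × ℕ × ℕ} : t' ∈ expandStep x₁ x₂ x t ↔
    (x₁ ≠ 0 ∧ t' = (t.1 + x₁, t.2.1, t.2.2 + x)) ∨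
      (x₂ ≠ 0 ∧ t' = (t.1, t.2.1 + x₂, t.2.2 + x)) := by
  unfold expandStep
  split_ifs <;> simp_all

theorem IsTripleList.expand {l₁ l₂ l l' : List ℕ} {u : Finset ℕ} {ts : List (ℕ × ℕ × ℕ)} {s : ℕ}
    (h : IsTripleList l₁ l₂ l u ts) (hs : s ∉ u) (hl : ∀ s' ∈ u, wt l' s' = wt l s') :
    IsTripleList l₁ l₂ l' (insert s u)
      (ts ++ ts.flatMap (expandStep (wt l₁ s) (wt l₂ s) (wt l' s))) := by
  have hcode : ∀ S₁ S₂ : Finset ℕ, (∀ s ∈ S₁, s ∈ l₁ ∧ s ∈ u) → (∀ s ∈ S₂, s ∈ l₂ ∧ s ∈ u) →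
      code l' (S₁ ∪ S₂) = code l (S₁ ∪ S₂) := fun S₁ S₂ h₁ h₂ =>
    code_congr fun s' hs' => hl s' (by
      rcases mem_union.1 hs' with h' | h'
      exacts [(h₁ s' h').2, (h₂ s' h').2])
  intro t
  rw [List.mem_append, List.mem_flatMap]
  constructor
  · rintro (ht | ⟨t', ht', ht⟩)
    · obtain ⟨S₁, S₂, h₁, h₂, hd, rfl⟩ := (h t).1 ht
      exact ⟨S₁, S₂, fun s' hs' => ⟨(h₁ s' hs').1, mem_insert_of_mem (h₁ s' hs').2⟩,
        fun s' hs' => ⟨(h₂ s' hs').1, mem_insert_of_mem (h₂ s' hs').2⟩, hd, by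
          rw [hcode S₁ S₂ h₁ h₂]⟩
    · obtain ⟨S₁, S₂, h₁, h₂, hd, rfl⟩ := (h t').1 ht'
      have hs₁ : s ∉ S₁ := fun hs' => hs (h₁ s hs').2
      have hs₂ : s ∉ S₂ := fun hs' => hs (h₂ s hs').2
      have hs₃ : s ∉ S₁ ∪ S₂ := by simp [hs₁, hs₂]
      rcases mem_expandStep.1 ht with ⟨hx, rfl⟩ | ⟨hx, rfl⟩
      · refine ⟨insert s S₁, S₂, fun s' hs' => ?_, fun s' hs' => ⟨(h₂ s' hs').1,
          mem_insert_of_mem (h₂ s' hs').2⟩, by simp [hs₂, hd], ?_⟩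
        · rcases mem_insert.1 hs' with rfl | hs'
          · exact ⟨wt_ne_zero.1 hx, mem_insert_self _ _⟩
          · exact ⟨(h₁ s' hs').1, mem_insert_of_mem (h₁ s' hs').2⟩
        · rw [insert_union, code_insert hs₁, code_insert hs₃, hcode S₁ S₂ h₁ h₂]
      · refine ⟨S₁, insert s S₂, fun s' hs' => ⟨(h₁ s' hs').1,
          mem_insert_of_mem (h₁ s' hs').2⟩, fun s' hs' => ?_, by simp [hs₁, hd], ?_⟩
        · rcases mem_insert.1 hs' with rfl | hs'
          · exact ⟨wt_ne_zero.1 hx, mem_insert_self _ _⟩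
          · exact ⟨(h₂ s' hs').1, mem_insert_of_mem (h₂ s' hs').2⟩
        · rw [union_insert, code_insert hs₂, code_insert hs₃, hcode S₁ S₂ h₁ h₂]
  · rintro ⟨S₁, S₂, h₁, h₂, hd, rfl⟩
    have h₁' : ∀ s' ∈ S₁.erase s, s' ∈ l₁ ∧ s' ∈ u := fun s' hs' =>
      ⟨(h₁ s' (mem_of_mem_erase hs')).1, mem_of_mem_insert_of_ne (h₁ s' (mem_of_mem_erase hs')).2
        (ne_of_mem_erase hs')⟩
    have h₂' : ∀ s' ∈ S₂.erase s, s' ∈ l₂ ∧ s' ∈ u := fun s' hs' =>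
      ⟨(h₂ s' (mem_of_mem_erase hs')).1, mem_of_mem_insert_of_ne (h₂ s' (mem_of_mem_erase hs')).2
        (ne_of_mem_erase hs')⟩
    have ht := (h _).2 ⟨S₁.erase s, S₂.erase s, h₁', h₂',
      hd.mono (erase_subset _ _) (erase_subset _ _), rfl⟩
    have hs₁ : s ∉ S₁.erase s := notMem_erase _ _
    have hs₂ : s ∉ S₂.erase s := notMem_erase _ _
    have hs₃ : s ∉ S₁.erase s ∪ S₂.erase s := by simp
    by_cases hs1 : s ∈ S₁
    · have hs2 : s ∉ S₂ := disjoint_left.1 hd hs1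
      refine .inr ⟨_, ht, mem_expandStep.2 (.inl ⟨wt_ne_zero.2 (h₁ s hs1).1, ?_⟩)⟩
      rw [← hcode _ _ h₁' h₂', ← code_insert hs₁, ← code_insert hs₃, ← insert_union,
        insert_erase hs1, erase_eq_of_notMem hs2]
    · by_cases hs2 : s ∈ S₂
      · refine .inr ⟨_, ht, mem_expandStep.2 (.inr ⟨wt_ne_zero.2 (h₂ s hs2).1, ?_⟩)⟩
        rw [← hcode _ _ h₁' h₂', ← code_insert hs₂, ← code_insert hs₃, ← union_insert,
          insert_erase hs2, erase_eq_of_notMem hs1]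
      · left
        rw [← hcode _ _ h₁' h₂', erase_eq_of_notMem hs1, erase_eq_of_notMem hs2] at ht
        exact ht

theorem length_expand (x₁ x₂ x : ℕ) (ts : List (ℕ × ℕ × ℕ)) :
    (ts ++ ts.flatMap (expandStep x₁ x₂ x)).length ≤
      ts.length * 2 ^ ((if x₁ = 0 then 0 else 1) + if x₂ = 0 then 0 else 1) := by
  have : ∀ t, (expandStep x₁ x₂ x t).length =
      (if x₁ = 0 then 0 else 1) + if x₂ = 0 then 0 else 1 := fun t => by
    unfold expandStep; split_ifs <;> rfl
  simp only [List.length_append, List.length_flatMap, this, List.map_const', List.sum_replicate,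
    smul_eq_mul]
  split_ifs <;> omega

/-! ### Processing a slot -/

/-- The new rows after the slots in `u` have been processed: `l` is the new list, `c` the number of
edges of the new block at a slot, and `D` the number of all edges there. -/
structure Rows (S r : ℕ) (c D : ℕ → ℕ) (σ : Store) (u : Finset ℕ) (l : List ℕ) (τ : Store) :
    Prop where
  len : τ.var vLen = l.length
  weight : τ.var vWt = 2 ^ l.length
  list_new : ∀ i (h : i < l.length), τ.arr aList (r + i) = l[i]
  list_old : ∀ a < r, τ.arr aList a = σ.arr aList a
  wt_new : ∀ s < S, τ.arr aWt (r + s) = wt l s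
  wt_old : ∀ a < r, τ.arr aWt a = σ.arr aWt a
  wt_above : ∀ a, r + S ≤ a → τ.arr aWt a = 0
  cnt_new : ∀ s < S, τ.arr aCnt (r + s) = if s ∈ l then c s else 0
  cnt_old : ∀ a < r, τ.arr aCnt a = σ.arr aCnt a
  cnt_above : ∀ a, r + S ≤ a → τ.arr aCnt a = 0
  nodup : l.Nodup
  mem : ∀ s, s ∈ l ↔ s ∈ u ∧ c s < D s

theorem Rows.of_frame {S r : ℕ} {c D : ℕ → ℕ} {σ τ ρ : Store} {u : Finset ℕ} {l : List ℕ}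
    (h : Rows S r c D σ u l τ) (h₁ : ρ.var vLen = τ.var vLen) (h₂ : ρ.var vWt = τ.var vWt)
    (h₃ : ρ.arr aList = τ.arr aList) (h₄ : ρ.arr aWt = τ.arr aWt) (h₅ : ρ.arr aCnt = τ.arr aCnt) :
    Rows S r c D σ u l ρ where
  len := h₁.trans h.len
  weight := h₂.trans h.weight
  list_new := h₃ ▸ h.list_new
  list_old := h₃ ▸ h.list_old
  wt_new := h₄ ▸ h.wt_new
  wt_old := h₄ ▸ h.wt_old
  wt_above := h₄ ▸ h.wt_above
  cnt_new := h₅ ▸ h.cnt_new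
  cnt_old := h₅ ▸ h.cnt_old
  cnt_above := h₅ ▸ h.cnt_above
  nodup := h.nodup
  mem := h.mem

/-- What the two old blocks contribute while a new block is computed. -/
structure Sources (S r rL rR : ℕ) (c D : ℕ → ℕ) (l₁ l₂ : List ℕ) (σ : Store) : Prop where
  lt_left : rL + S ≤ r
  lt_right : rR + S ≤ r
  wt_left : ∀ s < S, σ.arr aWt (rL + s) = wt l₁ s
  wt_right : ∀ s < S, σ.arr aWt (rR + s) = wt l₂ s
  cnt_eq : ∀ s < S, s ∈ l₁ ∨ s ∈ l₂ → σ.arr aCnt (rL + s) + σ.arr aCnt (rR + s) = c s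
  deg : ∀ s < S, σ.arr aDeg s = D s
  row : σ.var vRow = r
  rowL : σ.var vRowL = rL
  rowR : σ.var vRowR = rR

theorem runs_lookUp {S r rL rR : ℕ} {c D : ℕ → ℕ} {l₁ l₂ : List ℕ} {σ τ : Store}
    {u : Finset ℕ} {l : List ℕ} (hσ : Sources S r rL rR c D l₁ l₂ σ)
    (hvr : τ.var vRow = σ.var vRow) (hvl : τ.var vRowL = σ.var vRowL)
    (hvR : τ.var vRowR = σ.var vRowR) (hd : τ.arr aDeg = σ.arr aDeg)
    (h : Rows S r c D σ u l τ) (hs : τ.var vSlot < S) (hu : τ.var vSlot ∉ u)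
    (hmem : τ.var vSlot ∈ l₁ ∨ τ.var vSlot ∈ l₂) :
    Runs lookUp τ lookUp.maxCost fun ρ => ∃ l',
      Rows S r c D σ (insert (τ.var vSlot) u) l' ρ ∧ ρ.var vX1 = wt l₁ (τ.var vSlot) ∧
        ρ.var vX2 = wt l₂ (τ.var vSlot) ∧ ρ.var vX = wt l' (τ.var vSlot) ∧
        ∀ s ∈ u, wt l' s = wt l s := by
  refine Runs.of_result rfl ?_
  set s := τ.var vSlot with hsdef
  have e₁ : τ.arr aWt (rL + s) = wt l₁ s := by
    rw [h.wt_old _ (by have := hσ.lt_left; omega), hσ.wt_left s hs]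
  have e₂ : τ.arr aWt (rR + s) = wt l₂ s := by
    rw [h.wt_old _ (by have := hσ.lt_right; omega), hσ.wt_right s hs]
  have e₃ : τ.arr aCnt (rL + s) + τ.arr aCnt (rR + s) = c s := by
    rw [h.cnt_old _ (by have := hσ.lt_left; omega), h.cnt_old _ (by have := hσ.lt_right; omega),
      hσ.cnt_eq s hs hmem]
  have e₄ : τ.arr aDeg s = D s := by rw [hd, hσ.deg s hs]
  have hsl : s ∉ l := fun h' => hu ((h.mem s).1 h').1
  have hvr' := hvr.trans hσ.row
  have hvl' := hvl.trans hσ.rowL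
  have hvR' := hvR.trans hσ.rowR
  by_cases hlt : c s < D s
  · have hne : D s - c s ≠ 0 := by omega
    refine ⟨l ++ [s], ⟨?_, ?_, ?_, ?_, ?_, ?_, ?_, ?_, ?_, ?_, ?_, ?_⟩, ?_, ?_, ?_, ?_⟩
    any_goals simp [lookUp, incr, ← hsdef, hvr', hvl', hvR', e₁, e₂, e₃, e₄, hne, h.len, h.weight]
    · rw [pow_succ]; omega
    · intro i hi
      rcases Nat.lt_or_ge i l.length with hi' | hi'
      · rw [Function.update_of_ne (by omega), List.getElem_append_left hi', h.list_new i hi']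
      · obtain rfl : i = l.length := by omega
        simp
    · intro a ha
      rw [Function.update_of_ne (by omega), h.list_old a ha]
    · intro s' hs'
      by_cases hss : s' = s
      · subst hss; simp [wt_append_self hsl]
      · rw [Function.update_of_ne (by omega), wt_append_of_ne hss, h.wt_new s' hs']
    · intro a ha
      rw [Function.update_of_ne (by omega), h.wt_old a ha]
    · intro a ha
      rw [Function.update_of_ne (by omega), h.wt_above a ha]
    · intro s' hs'
      by_cases hss : s' = s
      · subst hss; simp
      · rw [Function.update_of_ne (by omega), h.cnt_new s' hs']
        simp [hss]
    · intro a ha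
      rw [Function.update_of_ne (by omega), h.cnt_old a ha]
    · intro a ha
      rw [Function.update_of_ne (by omega), h.cnt_above a ha]
    · rw [List.nodup_append]
      exact ⟨h.nodup, by simp, by simpa using fun a ha (hs : a = s) => hsl (hs ▸ ha)⟩
    · intro s'
      rw [h.mem]
      by_cases hss : s' = s
      · subst hss; simp [hlt]
      · simp [hss]
    · rw [wt_append_self hsl]
    · intro s' hs'
      exact wt_append_of_ne fun hss => hu (hss ▸ hs')
  · have hne : D s - c s = 0 := by omega
    refine ⟨l, ⟨?_, ?_, ?_, ?_, ?_, ?_, ?_, ?_, ?_, ?_, ?_, ?_⟩, ?_, ?_, ?_, ?_⟩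
    any_goals simp [lookUp, ← hsdef, hvl', hvR', e₁, e₂, e₃, e₄, hne, h.len, h.weight]
    · exact h.list_new
    · exact h.list_old
    · exact h.wt_new
    · exact h.wt_old
    · exact h.wt_above
    · exact h.cnt_new
    · exact h.cnt_old
    · exact h.cnt_above
    · exact h.nodup
    · intro s'
      rw [h.mem]
      by_cases hss : s' = s
      · subst hss; simp [hu, hlt]
      · simp [hss]
    · simp [wt, hsl]

/-- The state after the slots in `u` have been processed. -/
def Processed (S r : ℕ) (c D : ℕ → ℕ) (l₁ l₂ : List ℕ) (σ : Store) (u : Finset ℕ) (τ : Store) :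
    Prop :=
  ∃ l ts, Rows S r c D σ u l τ ∧ Holds τ ts ∧ IsTripleList l₁ l₂ l u ts ∧
    ts.length ≤ 2 ^ (#(u ∩ l₁.toFinset) + #(u ∩ l₂.toFinset))

theorem Processed.of_frame {S r : ℕ} {c D : ℕ → ℕ} {l₁ l₂ : List ℕ} {σ τ ρ : Store}
    {u : Finset ℕ} (h : Processed S r c D l₁ l₂ σ u τ) (h₀ : ρ.var vT = τ.var vT)
    (h₁ : ρ.var vLen = τ.var vLen) (h₂ : ρ.var vWt = τ.var vWt) (ha : ρ.arr = τ.arr) :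
    Processed S r c D l₁ l₂ σ u ρ :=
  let ⟨l, ts, hr, hh, ht⟩ := h
  ⟨l, ts, hr.of_frame h₁ h₂ (by rw [ha]) (by rw [ha]) (by rw [ha]),
    hh.of_eq h₀ (by rw [ha]) (by rw [ha]) (by rw [ha]), ht⟩

theorem card_inter_le_length (u : Finset ℕ) (l : List ℕ) : #(u ∩ l.toFinset) ≤ l.length :=
  (card_le_card inter_subset_right).trans (List.toFinset_card_le l)

theorem runs_handle {S r rL rR : ℕ} {c D : ℕ → ℕ} {l₁ l₂ : List ℕ} {σ τ : Store}
    {u : Finset ℕ} {M : ℕ} (hσ : Sources S r rL rR c D l₁ l₂ σ)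
    (hvr : τ.var vRow = σ.var vRow) (hvl : τ.var vRowL = σ.var vRowL)
    (hvR : τ.var vRowR = σ.var vRowR) (hd : τ.arr aDeg = σ.arr aDeg)
    (h : Processed S r c D l₁ l₂ σ u τ) (hs : τ.var vSlot < S) (hu : τ.var vSlot ∉ u)
    (hmem : τ.var vSlot ∈ l₁ ∨ τ.var vSlot ∈ l₂) (hM : 2 ^ (l₁.length + l₂.length) ≤ M) :
    Runs handle τ (lookUp.maxCost + 60 * (M + 1)) fun ρ =>
      Processed S r c D l₁ l₂ σ (insert (τ.var vSlot) u) ρ := by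
  obtain ⟨l, ts, hr, hh, ht, hlen⟩ := h
  refine (runs_lookUp hσ hvr hvl hvR hd hr hs hu hmem).seq_frame fun ρ hρ hF => ?_
  obtain ⟨l', hr', h₁, h₂, h₃, h₄⟩ := hρ
  have hh' := hh.of_eq (hF.var vT rfl) (hF.arr aT1 rfl) (hF.arr aT2 rfl) (hF.arr aT3 rfl)
  have hle := Nat.pow_le_pow_right (n := 2) (by norm_num)
    (Nat.add_le_add (card_inter_le_length u l₁) (card_inter_le_length u l₂))
  refine ((runs_expand hh').frame).mono (by gcongr; omega) fun π hπ => ?_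
  obtain ⟨hH, hF'⟩ := hπ
  rw [h₁, h₂, h₃] at hH
  refine ⟨l', _, hr'.of_frame (hF'.var _ rfl) (hF'.var _ rfl) (hF'.arr _ rfl) (hF'.arr _ rfl)
    (hF'.arr _ rfl), hH, ht.expand hu h₄, (length_expand ..).trans ?_⟩
  have key : ∀ l : List ℕ, #(insert (τ.var vSlot) u ∩ l.toFinset) =
      #(u ∩ l.toFinset) + if wt l (τ.var vSlot) = 0 then 0 else 1 := fun l => by
    by_cases hl : τ.var vSlot ∈ l
    · rw [insert_inter_of_mem (by simpa using hl), card_insert_of_notMem (by simp [hu]),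
        if_neg (wt_ne_zero.2 hl)]
    · rw [insert_inter_of_notMem (by simpa using hl), if_pos (by simp [wt, hl])]
      rfl
  rw [key, key]
  calc _ ≤ 2 ^ (#(u ∩ l₁.toFinset) + #(u ∩ l₂.toFinset)) * _ := Nat.mul_le_mul_right _ hlen
    _ = _ := by rw [← pow_add]; congr 1; omega

end MaxTwoColor

namespace MaxTwoColor

open RAM SlotCode Finset

/-- The memory `τ` agrees with `σ` on what is not changed while slots are processed. -/
structure Same (σ τ : Store) : Prop where
  row : τ.var vRow = σ.var vRow
  rowL : τ.var vRowL = σ.var vRowL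
  rowR : τ.var vRowR = σ.var vRowR
  left : τ.var vLeft = σ.var vLeft
  right : τ.var vRight = σ.var vRight
  deg : τ.arr aDeg = σ.arr aDeg
  len : τ.arr aLen = σ.arr aLen

theorem Same.trans {σ τ ρ : Store} (h : Same σ τ) (h' : Same τ ρ) : Same σ ρ :=
  ⟨h'.row.trans h.row, h'.rowL.trans h.rowL, h'.rowR.trans h.rowR, h'.left.trans h.left,
    h'.right.trans h.right, h'.deg.trans h.deg, h'.len.trans h.len⟩

theorem Same.of_frame {p : Prog} {σ τ : Store} (h : Frame p σ τ)
    (hv : ∀ x ∈ [vRow, vRowL, vRowR, vLeft, vRight], p.setsVar x = false)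
    (ha : ∀ a ∈ [aDeg, aLen], p.setsArr a = false) : Same σ τ :=
  ⟨h.var _ (hv _ (by simp)), h.var _ (hv _ (by simp)), h.var _ (hv _ (by simp)),
    h.var _ (hv _ (by simp)), h.var _ (hv _ (by simp)), h.arr _ (ha _ (by simp)),
    h.arr _ (ha _ (by simp))⟩

/-- The lists of the two old blocks. -/
structure SourceLists (S rL rR : ℕ) (l₁ l₂ : List ℕ) (σ : Store) : Prop where
  nodup_left : l₁.Nodup
  nodup_right : l₂.Nodup
  lt_left : ∀ s ∈ l₁, s < S
  lt_right : ∀ s ∈ l₂, s < S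
  list_left : ∀ i (h : i < l₁.length), σ.arr aList (rL + i) = l₁[i]
  list_right : ∀ i (h : i < l₂.length), σ.arr aList (rR + i) = l₂[i]
  len_left : σ.arr aLen (σ.var vLeft) = l₁.length
  len_right : σ.arr aLen (σ.var vRight) = l₂.length

theorem length_le_of_nodup {S : ℕ} {l : List ℕ} (h : l.Nodup) (hS : ∀ s ∈ l, s < S) :
    l.length ≤ S := by
  rw [← List.toFinset_card_of_nodup h]
  exact (card_le_card (t := range S) fun s hs => by
    simpa using hS s (List.mem_toFinset.1 hs)).trans_eq (card_range S)

theorem mem_take_succ {α : Type} {l : List α} {j : ℕ} (h : j < l.length) {s : α} :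
    s ∈ l.take (j + 1) ↔ s ∈ l.take j ∨ s = l[j] := by
  rw [List.take_add_one, List.getElem?_eq_getElem h, List.mem_append, Option.toList_some,
    List.mem_singleton]

theorem toFinset_take_succ {l : List ℕ} {j : ℕ} (h : j < l.length) :
    (l.take (j + 1)).toFinset = insert l[j] (l.take j).toFinset := by
  ext s
  rw [List.mem_toFinset, mem_insert, List.mem_toFinset, mem_take_succ h]
  exact or_comm

theorem getElem_notMem_take {l : List ℕ} {j : ℕ} (hl : l.Nodup) (h : j < l.length) :
    l[j] ∉ l.take j := by
  intro hm
  obtain ⟨i, hi, he⟩ := List.mem_iff_getElem.1 hm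
  rw [List.getElem_take] at he
  have := (List.Nodup.getElem_inj_iff hl).1 he
  simp at hi
  omega

variable {S r rL rR : ℕ} {c D : ℕ → ℕ} {l₁ l₂ : List ℕ} {σ τ : Store} {M : ℕ}

theorem runs_leftSlots (hσ : Sources S r rL rR c D l₁ l₂ σ) (hl : SourceLists S rL rR l₁ l₂ σ)
    (hτ : Same σ τ) (h : Processed S r c D l₁ l₂ σ ∅ τ) (hM : 2 ^ (l₁.length + l₂.length) ≤ M) :
    Runs leftSlots τ (200 * (l₁.length + 1) * (M + 1)) fun ρ =>
      Processed S r c D l₁ l₂ σ l₁.toFinset ρ := by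
  refine ((Runs.of_result (p := vJ ≔ .const 0) (Q := fun τ => τ.var vJ = 0 ∧ Same σ τ ∧
    Processed S r c D l₁ l₂ σ ∅ τ) rfl ?_).seq fun τ hτ => Runs.for_loop (n := l₁.length)
    (T := 80 + 60 * (M + 1)) (I := fun j τ => τ.var vJ = j ∧ Same σ τ ∧
      Processed S r c D l₁ l₂ σ (l₁.take j).toFinset τ) ?_ ?_ ?_).mono ?_ ?_
  · refine ⟨by simp, ⟨?_, ?_, ?_, ?_, ?_, ?_, ?_⟩, h.of_frame ?_ ?_ ?_ ?_⟩ <;>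
      simp [hτ.row, hτ.rowL, hτ.rowR, hτ.left, hτ.right, hτ.deg, hτ.len]
  · rintro j τ - ⟨hj, hs, -⟩ -
    simp [hj, hs.len, hs.left, hl.len_left]
    omega
  · rintro j τ hj ⟨hvj, hs, hP⟩ -
    have hlist : τ.arr aList (rL + j) = l₁[j] := by
      obtain ⟨l, ts, hr, -⟩ := hP
      have := length_le_of_nodup hl.nodup_left hl.lt_left
      rw [hr.list_old _ (by have := hσ.lt_left; omega), hl.list_left j hj]
    have step₁ : Runs (vSlot ≔ .get aList (.var vRowL +ₑ .var vJ)) τ 5 (fun ρ =>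
        ρ.var vSlot = l₁[j] ∧ Same σ ρ ∧ ρ.var vJ = j ∧
          Processed S r c D l₁ l₂ σ (l₁.take j).toFinset ρ) := by
      refine Runs.of_result rfl ⟨?_, ⟨?_, ?_, ?_, ?_, ?_, ?_, ?_⟩, ?_, hP.of_frame ?_ ?_ ?_ ?_⟩ <;>
      simp [hs.row, hs.rowL, hs.rowR, hs.left, hs.right, hs.deg, hs.len, hσ.rowL, hvj, hlist]
    refine (step₁.seq fun ρ hρ => ((runs_handle (M := M) hσ hρ.2.1.row hρ.2.1.rowL hρ.2.1.rowR
      hρ.2.1.deg hρ.2.2.2 ?_ ?_ ?_ hM).seq_frame (Q := fun τ => τ.var vJ = j + 1 ∧ Same σ τ ∧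
      Processed S r c D l₁ l₂ σ (l₁.take (j + 1)).toFinset τ) (U := 4) fun π hπ hF => ?_)).mono
      ?_ fun _ h => h
    · rw [hρ.1]; exact hl.lt_left _ (List.getElem_mem hj)
    · rw [hρ.1, List.mem_toFinset]; exact getElem_notMem_take hl.nodup_left hj
    · rw [hρ.1]; exact .inl (List.getElem_mem hj)
    · rw [hρ.1, ← toFinset_take_succ hj] at hπ
      have hs' := hρ.2.1.trans (Same.of_frame hF (by decide) (by decide))
      have hv := hF.var vJ rfl
      refine Runs.of_result (p := incr vJ) rfl ⟨?_, ⟨?_, ?_, ?_, ?_, ?_, ?_, ?_⟩,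
        hπ.of_frame ?_ ?_ ?_ ?_⟩ <;>
      simp [incr, hs'.row, hs'.rowL, hs'.rowR, hs'.left, hs'.right, hs'.deg, hs'.len, hv, hρ.2.2.1]
    · have : lookUp.maxCost ≤ 71 := by decide
      omega
  · simpa using hτ
  · simp only [Prog.maxCost, Expr.cost]
    nlinarith [Nat.zero_le (l₁.length * M)]
  · rintro τ ⟨-, -, h⟩
    simpa using h

theorem runs_rightSlots (hσ : Sources S r rL rR c D l₁ l₂ σ) (hl : SourceLists S rL rR l₁ l₂ σ)
    (hτ : Same σ τ) (h : Processed S r c D l₁ l₂ σ l₁.toFinset τ)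
    (hM : 2 ^ (l₁.length + l₂.length) ≤ M) :
    Runs rightSlots τ (200 * (l₂.length + 1) * (M + 1)) fun ρ =>
      Processed S r c D l₁ l₂ σ (l₁.toFinset ∪ l₂.toFinset) ρ := by
  refine ((Runs.of_result (p := vJ ≔ .const 0) (Q := fun τ => τ.var vJ = 0 ∧ Same σ τ ∧
    Processed S r c D l₁ l₂ σ l₁.toFinset τ) rfl ?_).seq fun τ hτ => Runs.for_loop
    (n := l₂.length) (T := 85 + 60 * (M + 1)) (I := fun j τ => τ.var vJ = j ∧ Same σ τ ∧
      Processed S r c D l₁ l₂ σ (l₁.toFinset ∪ (l₂.take j).toFinset) τ) ?_ ?_ ?_).mono ?_ ?_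
  · refine ⟨by simp, ⟨?_, ?_, ?_, ?_, ?_, ?_, ?_⟩, h.of_frame ?_ ?_ ?_ ?_⟩ <;>
      simp [hτ.row, hτ.rowL, hτ.rowR, hτ.left, hτ.right, hτ.deg, hτ.len]
  · rintro j τ - ⟨hj, hs, -⟩ -
    simp [hj, hs.len, hs.right, hl.len_right]
    omega
  · rintro j τ hj ⟨hvj, hs, hP⟩ -
    have hlist : τ.arr aList (rR + j) = l₂[j] := by
      obtain ⟨l, ts, hr, -⟩ := hP
      have := length_le_of_nodup hl.nodup_right hl.lt_right
      rw [hr.list_old _ (by have := hσ.lt_right; omega), hl.list_right j hj]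
    have hlt := hl.lt_right _ (List.getElem_mem hj)
    have hwt : τ.arr aWt (rL + l₂[j]) = wt l₁ l₂[j] := by
      obtain ⟨l, ts, hr, -⟩ := hP
      rw [hr.wt_old _ (by have := hσ.lt_left; omega), hσ.wt_left _ hlt]
    have step₁ : Runs (vSlot ≔ .get aList (.var vRowR +ₑ .var vJ)) τ 5 (fun ρ =>
        ρ.var vSlot = l₂[j] ∧ Same σ ρ ∧ ρ.var vJ = j ∧ ρ.arr aWt (rL + l₂[j]) = wt l₁ l₂[j] ∧
          Processed S r c D l₁ l₂ σ (l₁.toFinset ∪ (l₂.take j).toFinset) ρ) := by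
      refine Runs.of_result rfl
        ⟨?_, ⟨?_, ?_, ?_, ?_, ?_, ?_, ?_⟩, ?_, ?_, hP.of_frame ?_ ?_ ?_ ?_⟩ <;>
      simp [hs.row, hs.rowL, hs.rowR, hs.left, hs.right, hs.deg, hs.len, hσ.rowR, hvj, hlist, hwt]
    refine (step₁.seq fun ρ hρ => ((Runs.ite (p := .skip) (q := handle) (T := 71 + 60 * (M + 1))
      (Q := fun τ => Processed S r c D l₁ l₂ σ (l₁.toFinset ∪ (l₂.take (j + 1)).toFinset) τ)
      ?_ ?_).seq_frame (Q := fun τ => τ.var vJ = j + 1 ∧ Same σ τ ∧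
      Processed S r c D l₁ l₂ σ (l₁.toFinset ∪ (l₂.take (j + 1)).toFinset) τ) (U := 4)
      fun π hπ hF => ?_)).mono ?_ fun _ h => h
    · intro hne
      simp only [Expr.eval, hρ.1, hρ.2.1.rowL, hσ.rowL, hρ.2.2.2.1] at hne
      have hm := wt_ne_zero.1 hne
      rw [toFinset_take_succ hj, union_insert, insert_eq_of_mem (by simp [hm])]
      exact (Runs.of_result (p := .skip) rfl hρ.2.2.2.2).mono
        (by simp only [Prog.maxCost]; omega) fun _ h => h
    · intro he
      simp only [Expr.eval, hρ.1, hρ.2.1.rowL, hσ.rowL, hρ.2.2.2.1] at he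
      have hm : l₂[j] ∉ l₁ := fun hm => wt_ne_zero.2 hm he
      refine (runs_handle (M := M) hσ hρ.2.1.row hρ.2.1.rowL hρ.2.1.rowR
        hρ.2.1.deg hρ.2.2.2.2 ?_ ?_ ?_ hM).mono ?_ fun π hπ => ?_
      · rw [hρ.1]; exact hlt
      · rw [hρ.1, mem_union, List.mem_toFinset, List.mem_toFinset]
        exact not_or.2 ⟨hm, getElem_notMem_take hl.nodup_right hj⟩
      · rw [hρ.1]; exact .inr (List.getElem_mem hj)
      · have : lookUp.maxCost ≤ 71 := by decide
        omega
      · rw [toFinset_take_succ hj, union_insert]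
        rwa [hρ.1] at hπ
    · have hs' := hρ.2.1.trans (Same.of_frame hF (by decide) (by decide))
      have hv := hF.var vJ rfl
      refine Runs.of_result (p := incr vJ) rfl ⟨?_, ⟨?_, ?_, ?_, ?_, ?_, ?_, ?_⟩,
        hπ.of_frame ?_ ?_ ?_ ?_⟩ <;>
      simp [incr, hs'.row, hs'.rowL, hs'.rowR, hs'.left, hs'.right, hs'.deg, hs'.len, hv, hρ.2.2.1]
    · simp only [Expr.cost]
      omega
  · simpa using hτ
  · simp only [Prog.maxCost, Expr.cost]
    nlinarith [Nat.zero_le (l₂.length * M)]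
  · rintro τ ⟨-, -, h⟩
    simpa using h

/-! ### Improving the new table -/

/-- The new table, after the triples in `us` have been used. -/
structure Improved (next w : ℕ) (ts us : List (ℕ × ℕ × ℕ)) (V₁ V₂ : ℕ → ℕ) (σ τ : Store) :
    Prop where
  val_old : ∀ a < next, τ.arr aVal a = σ.arr aVal a
  lp_old : ∀ a < next, τ.arr aLp a = σ.arr aLp a
  rp_old : ∀ a < next, τ.arr aRp a = σ.arr aRp a
  above : ∀ a, next + w ≤ a → τ.arr aVal a = 0
  le : ∀ t ∈ us, V₁ t.1 ≠ 0 → V₂ t.2.1 ≠ 0 → V₁ t.1 + V₂ t.2.1 ≤ τ.arr aVal (next + t.2.2) + 1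
  origin : ∀ c, τ.arr aVal (next + c) ≠ 0 → ∃ t ∈ ts, t.2.2 = c ∧ τ.arr aLp (next + c) = t.1 ∧
    τ.arr aRp (next + c) = t.2.1 ∧ V₁ t.1 ≠ 0 ∧ V₂ t.2.1 ≠ 0 ∧
    V₁ t.1 + V₂ t.2.1 = τ.arr aVal (next + c) + 1

theorem runs_improve {σ : Store} {ts : List (ℕ × ℕ × ℕ)} {w : ℕ} (h : Holds σ ts)
    (hw : ∀ t ∈ ts, t.2.2 < w) (hz : ∀ a, σ.var vNext ≤ a → σ.arr aVal a = 0)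
    (h₁ : ∀ t ∈ ts, σ.arr aBase (σ.var vLeft) + t.1 < σ.var vNext)
    (h₂ : ∀ t ∈ ts, σ.arr aBase (σ.var vRight) + t.2.1 < σ.var vNext) :
    Runs improve σ (100 * (ts.length + 1)) fun τ => Improved (σ.var vNext) w ts ts
      (fun c => σ.arr aVal (σ.arr aBase (σ.var vLeft) + c))
      (fun c => σ.arr aVal (σ.arr aBase (σ.var vRight) + c)) σ τ := by
  set V₁ := fun c => σ.arr aVal (σ.arr aBase (σ.var vLeft) + c) with hV₁
  set V₂ := fun c => σ.arr aVal (σ.arr aBase (σ.var vRight) + c) with hV₂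
  set next := σ.var vNext with hnext
  have start : ∀ τ : Store, τ.arr = σ.arr → Improved next w ts [] V₁ V₂ σ τ := fun τ hτ =>
    ⟨fun _ _ => by rw [hτ], fun _ _ => by rw [hτ], fun _ _ => by rw [hτ],
      fun a ha => by rw [hτ]; exact hz a (by omega), by simp,
      fun c hc => absurd (hz (next + c) (by omega)) (by rwa [hτ] at hc)⟩
  refine ((Runs.of_result (p := vJ ≔ .const 0) (Q := fun τ => τ.var vJ = 0 ∧
      Improved next w ts [] V₁ V₂ σ τ) rfl ?_).seq_frame fun τ hτ hF => Runs.for_loop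
      (n := ts.length) (T := improveBody.maxCost) (I := fun j τ => τ.var vJ = j ∧
      Improved next w ts (ts.take j) V₁ V₂ σ τ) ?_ ?_ ?_).mono ?_ ?_
  · exact ⟨by simp, start _ (by simp)⟩
  · rintro j τ' - ⟨hj, -⟩ hF'
    have e := hF'.var vT rfl
    rw [hF.var vT rfl, h.length] at e
    simp [hj, e]
    omega
  · rintro j ρ hj ⟨hvj, hI⟩ hF'
    have hm := List.getElem_mem hj
    have eL := (hF'.var vLeft rfl).trans (hF.var vLeft rfl)
    have eR := (hF'.var vRight rfl).trans (hF.var vRight rfl)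
    have eN : ρ.var vNext = next := (hF'.var vNext rfl).trans (hF.var vNext rfl)
    have eB := (hF'.arr aBase rfl).trans (hF.arr aBase rfl)
    have hget : (ρ.arr aT1 j, ρ.arr aT2 j, ρ.arr aT3 j) = ts[j] := by
      rw [hF'.arr aT1 rfl, hF.arr aT1 rfl, hF'.arr aT2 rfl, hF.arr aT2 rfl, hF'.arr aT3 rfl,
        hF.arr aT3 rfl]
      exact h.get j hj
    set t := ts[j] with ht
    have g₁ : ρ.arr aT1 j = t.1 := by rw [← hget]
    have g₂ : ρ.arr aT2 j = t.2.1 := by rw [← hget]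
    have g₃ : ρ.arr aT3 j = t.2.2 := by rw [← hget]
    have e₁ : ρ.arr aVal (ρ.arr aBase (ρ.var vLeft) + t.1) = V₁ t.1 := by
      rw [eL, eB, hI.val_old _ (h₁ _ hm)]
    have e₂ : ρ.arr aVal (ρ.arr aBase (ρ.var vRight) + t.2.1) = V₂ t.2.1 := by
      rw [eR, eB, hI.val_old _ (h₂ _ hm)]
    have hmem : ∀ t', t' ∈ ts.take (j + 1) ↔ t' ∈ ts.take j ∨ t' = t := fun t' => mem_take_succ hj
    have hw' := hw t hm
    refine Runs.of_result rfl ?_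
    by_cases hcase : V₁ t.1 ≠ 0 ∧ V₂ t.2.1 ≠ 0 ∧
        V₁ t.1 + V₂ t.2.1 - 1 - ρ.arr aVal (next + t.2.2) ≠ 0
    · obtain ⟨c₁, c₂, c₃⟩ := hcase
      refine ⟨?_, ⟨?_, ?_, ?_, ?_, ?_, ?_⟩⟩ <;>
        simp only [improveBody, incr, Prog.result, Expr.eval, Store.setVar_var, Store.setVar_arr,
          Store.setEntry_var, Store.setEntry_arr, hvj, g₁, g₂, g₃, e₁, e₂, eN, c₁, c₂, c₃,
          if_true, if_false, Nat.reduceEqDiff]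
      · intro a ha
        rw [Function.update_of_ne (by omega), hI.val_old a ha]
      · intro a ha
        rw [Function.update_of_ne (by omega), hI.lp_old a ha]
      · intro a ha
        rw [Function.update_of_ne (by omega), hI.rp_old a ha]
      · intro a ha
        rw [Function.update_of_ne (by omega), hI.above a ha]
      · intro t' ht' n₁ n₂
        by_cases ht₂ : t'.2.2 = t.2.2
        · rw [ht₂, Function.update_self]
          rcases (hmem t').1 ht' with h' | rfl
          · have := hI.le t' h' n₁ n₂
            rw [ht₂] at this
            omega
          · omega
        · rw [Function.update_of_ne (by omega)]
          rcases (hmem t').1 ht' with h' | rfl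
          · exact hI.le t' h' n₁ n₂
          · exact absurd rfl ht₂
      · intro c hc
        by_cases hct : c = t.2.2
        · subst hct
          simp only [Function.update_self] at hc ⊢
          exact ⟨t, hm, rfl, rfl, rfl, c₁, c₂, by omega⟩
        · rw [Function.update_of_ne (by omega)] at hc ⊢
          rw [Function.update_of_ne (by omega), Function.update_of_ne (by omega)]
          exact hI.origin c hc
    · have hres : (improveBody.result ρ).var vJ = j + 1 ∧ (improveBody.result ρ).arr = ρ.arr := by
        by_cases c₁ : V₁ t.1 = 0
        · simp [improveBody, incr, hvj, g₁, g₂, g₃, e₁, e₂, eN, c₁]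
        · by_cases c₂ : V₂ t.2.1 = 0
          · simp [improveBody, incr, hvj, g₁, g₂, g₃, e₁, e₂, eN, c₁, c₂]
          · have c₃ : V₁ t.1 + V₂ t.2.1 - 1 - ρ.arr aVal (next + t.2.2) = 0 := by tauto
            simp [improveBody, incr, hvj, g₁, g₂, g₃, e₁, e₂, eN, c₁, c₂, c₃]
      obtain ⟨hr₁, hr₂⟩ := hres
      refine ⟨hr₁, ?_⟩
      have hI' := hI
      refine ⟨hr₂ ▸ hI.val_old, hr₂ ▸ hI.lp_old, hr₂ ▸ hI.rp_old, hr₂ ▸ hI.above, ?_,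
        hr₂ ▸ hI.origin⟩
      rw [hr₂]
      intro t' ht' n₁ n₂
      rcases (hmem t').1 ht' with h' | rfl
      · exact hI.le t' h' n₁ n₂
      · by_contra hlt
        exact hcase ⟨n₁, n₂, by omega⟩
  · simpa using hτ
  · have : improveBody.maxCost ≤ 60 := by decide
    simp only [Prog.maxCost, Expr.cost]
    nlinarith
  · rintro τ ⟨-, h⟩
    simpa using h

end MaxTwoColor

namespace MaxTwoColor

open RAM SlotCode Slots Finset

/-! ### Tables -/

/-- A graph with vertices `0, …, n - 1` and edges `0, …, m - 1`, and a binary tree of sets of edges,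
called blocks.  The blocks below `N` have at most one edge, and each later one is the disjoint union
of two earlier ones and has a small border. -/
structure Plan where
  (src dst leaf left right par : ℕ → ℕ)
  (m n N h : ℕ)
  X : ℕ → Finset ℕ
  src_lt : ∀ i < m, src i < n
  dst_lt : ∀ i < m, dst i < n
  ne : ∀ i < m, src i ≠ dst i
  inj : ∀ i < m, ∀ j < m, s(src i, dst i) = s(src j, dst j) → i = j
  leaf_lt : ∀ i < m, leaf i < N
  leaf_inj : ∀ i < m, ∀ j < m, leaf i = leaf j → i = j
  X_node : ∀ b < N, X b = {i ∈ range m | leaf i = b}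
  left_lt : ∀ b, N ≤ b → b < 2 * N - 1 → left b < b
  right_lt : ∀ b, N ≤ b → b < 2 * N - 1 → right b < b
  X_merge : ∀ b, N ≤ b → b < 2 * N - 1 → X b = X (left b) ∪ X (right b)
  disj : ∀ b, N ≤ b → b < 2 * N - 1 → Disjoint (X (left b)) (X (right b))
  border_le : ∀ b, N ≤ b → b < 2 * N - 1 → #(border src dst m (X b)) ≤ 2 * h
  par_left : ∀ b, N ≤ b → b < 2 * N - 1 → par (left b) = b
  par_right : ∀ b, N ≤ b → b < 2 * N - 1 → par (right b) = b
  left_ne_right : ∀ b, N ≤ b → b < 2 * N - 1 → left b ≠ right b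
  root : 0 < N → X (2 * N - 2) = range m

namespace Plan

variable (P : Plan)

theorem X_subset (b : ℕ) (hb : b < 2 * P.N - 1) : P.X b ⊆ range P.m := by
  induction b using Nat.strong_induction_on with
  | _ b ih =>
    rcases Nat.lt_or_ge b P.N with h | h
    · rw [P.X_node b h]; exact filter_subset _ _
    · have h₁ := P.left_lt b h hb
      have h₂ := P.right_lt b h hb
      rw [P.X_merge b h hb]
      exact union_subset (ih _ h₁ (by omega)) (ih _ h₂ (by omega))

theorem lt_of_mem {b : ℕ} (hb : b < 2 * P.N - 1) {l : List ℕ}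
    (hl : BorderList P.src P.dst P.m (P.X b) l) {s : ℕ} (hs : s ∈ l) : s < 2 * P.n := by
  have := cnt_pos.1 (hl.touch s hs)
  obtain ⟨i, hi, hs⟩ := mem_biUnion.1 this
  have hi := mem_range.1 (P.X_subset b hb hi)
  have h₁ := P.src_lt i hi
  have h₂ := P.dst_lt i hi
  simp only [touch, mem_insert, mem_singleton] at hs
  omega

/-- The memory holds the table of the block `b`, whose states are coded by the list `l`. -/
structure BlockOK (next b : ℕ) (l : List ℕ) (σ : Store) : Prop where
  list : BorderList P.src P.dst P.m (P.X b) l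
  len_le : l.length ≤ 2 * P.h + 4
  len : σ.arr aLen b = l.length
  row : σ.arr aRow b = b * (2 * P.n)
  get : ∀ i (h : i < l.length), σ.arr aList (b * (2 * P.n) + i) = l[i]
  weight : ∀ s < 2 * P.n, σ.arr aWt (b * (2 * P.n) + s) = wt l s
  count : ∀ s < 2 * P.n, σ.arr aCnt (b * (2 * P.n) + s) =
    if s ∈ l then cnt P.src P.dst (P.X b) s else 0
  base : σ.arr aBase b + 2 ^ l.length ≤ next
  complete : ∀ f, Valid P.src P.dst (P.X b) f →
    size (P.X b) f + 1 ≤ σ.arr aVal (σ.arr aBase b + code l (used P.src P.dst (P.X b) f))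

/-- The entry `c` of the table of the block `b` is attained by the colouring `f`. -/
def Attains (b : ℕ) (l : List ℕ) (σ : Store) (c : ℕ) (f : ℕ → ℕ) : Prop :=
  Valid P.src P.dst (P.X b) f ∧ code l (used P.src P.dst (P.X b) f) = c ∧
    size (P.X b) f + 1 = σ.arr aVal (σ.arr aBase b + c)

/-- The colour that the code of a state at a leaf stands for. -/
def colorOf (c : ℕ) : ℕ := if c = 3 then 1 else if c = 12 then 2 else 0

/-- The entries of the table of a node. -/
def NodeOK (b : ℕ) (l : List ℕ) (σ : Store) : Prop :=
  ∀ c < 2 ^ l.length, σ.arr aVal (σ.arr aBase b + c) ≠ 0 → ∀ f : ℕ → ℕ,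
    (∀ i ∈ P.X b, f i = colorOf c) → P.Attains b l σ c f

/-- The pointers of the table of a union of two blocks. -/
def MergeOK (b : ℕ) (L : ℕ → List ℕ) (σ : Store) : Prop :=
  ∀ c < 2 ^ (L b).length, σ.arr aVal (σ.arr aBase b + c) ≠ 0 →
    ∃ c₁ c₂, σ.arr aLp (σ.arr aBase b + c) = c₁ ∧ σ.arr aRp (σ.arr aBase b + c) = c₂ ∧
      c₁ < 2 ^ (L (P.left b)).length ∧ c₂ < 2 ^ (L (P.right b)).length ∧
      σ.arr aVal (σ.arr aBase (P.left b) + c₁) ≠ 0 ∧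
      σ.arr aVal (σ.arr aBase (P.right b) + c₂) ≠ 0 ∧
      ∀ f, P.Attains (P.left b) (L (P.left b)) σ c₁ f →
        P.Attains (P.right b) (L (P.right b)) σ c₂ f → P.Attains b (L b) σ c f

/-- The memory holds the tables of the blocks below `B`, with the lists `L`. -/
structure Tables (B : ℕ) (L : ℕ → List ℕ) (σ : Store) : Prop where
  stride : σ.var vStride = 2 * P.n
  row : σ.var vRow = B * (2 * P.n)
  deg : ∀ s, σ.arr aDeg s = cnt P.src P.dst (range P.m) s
  left : ∀ b, P.N ≤ b → b < 2 * P.N - 1 → σ.arr aLeft b = P.left b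
  right : ∀ b, P.N ≤ b → b < 2 * P.N - 1 → σ.arr aRight b = P.right b
  wt_above : ∀ a, B * (2 * P.n) ≤ a → σ.arr aWt a = 0
  cnt_above : ∀ a, B * (2 * P.n) ≤ a → σ.arr aCnt a = 0
  val_above : ∀ a, σ.var vNext ≤ a → σ.arr aVal a = 0
  block : ∀ b < B, P.BlockOK (σ.var vNext) b (L b) σ
  node : ∀ b < P.N, P.NodeOK b (L b) σ
  merge : ∀ b, P.N ≤ b → b < B → P.MergeOK b L σ
  exact : ∀ b, P.N ≤ b → b < B → ∀ s ∈ L b, s ∈ border P.src P.dst P.m (P.X b)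

variable {P}

theorem BlockOK.length_le {next b : ℕ} {l : List ℕ} {σ : Store} (h : P.BlockOK next b l σ)
    (hb : b < 2 * P.N - 1) : l.length ≤ 2 * P.n :=
  length_le_of_nodup h.list.nodup fun _ hs => P.lt_of_mem hb h.list hs

theorem BlockOK.congr {next next' b r : ℕ} {l : List ℕ} {σ τ : Store} (h : P.BlockOK next b l σ)
    (hb : b < 2 * P.N - 1)
    (hn : next ≤ next') (hr : b * (2 * P.n) + 2 * P.n ≤ r)
    (h₁ : τ.arr aLen b = σ.arr aLen b) (h₂ : τ.arr aRow b = σ.arr aRow b)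
    (h₃ : τ.arr aBase b = σ.arr aBase b) (h₄ : ∀ a < r, τ.arr aList a = σ.arr aList a)
    (h₅ : ∀ a < r, τ.arr aWt a = σ.arr aWt a) (h₆ : ∀ a < r, τ.arr aCnt a = σ.arr aCnt a)
    (h₇ : ∀ a < next, τ.arr aVal a = σ.arr aVal a) : P.BlockOK next' b l τ where
  list := h.list
  len_le := h.len_le
  len := h₁.trans h.len
  row := h₂.trans h.row
  get i hi := by rw [h₄ _ (by have := h.length_le hb; omega), h.get i hi]
  weight s hs := by rw [h₅ _ (by omega), h.weight s hs]
  count s hs := by rw [h₆ _ (by omega), h.count s hs]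
  base := by rw [h₃]; exact h.base.trans hn
  complete f hf := by
    have := code_lt l (used P.src P.dst (P.X b) f)
    have hbase := h.base
    rw [h₃, h₇ _ (by omega)]
    exact h.complete f hf

theorem Attains.congr {next b c : ℕ} {l : List ℕ} {σ τ : Store} {f : ℕ → ℕ}
    (hb : P.BlockOK next b l σ) (hc : c < 2 ^ l.length) (h₃ : τ.arr aBase b = σ.arr aBase b)
    (h₇ : ∀ a < next, τ.arr aVal a = σ.arr aVal a) :
    P.Attains b l τ c f ↔ P.Attains b l σ c f := by
  have := hb.base
  unfold Attains
  rw [h₃, h₇ _ (by omega)]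

theorem NodeOK.congr {next b : ℕ} {l : List ℕ} {σ τ : Store} (h : P.NodeOK b l σ)
    (hb : P.BlockOK next b l σ) (h₃ : τ.arr aBase b = σ.arr aBase b)
    (h₇ : ∀ a < next, τ.arr aVal a = σ.arr aVal a) : P.NodeOK b l τ := by
  intro c hc hv f hf
  have := hb.base
  rw [Attains.congr hb hc h₃ h₇]
  rw [h₃, h₇ _ (by omega)] at hv
  exact h c hc hv f hf

theorem MergeOK.congr {next b : ℕ} {L L' : ℕ → List ℕ} {σ τ : Store} (h : P.MergeOK b L σ)
    (hb : P.BlockOK next b (L b) σ) (hl : P.BlockOK next (P.left b) (L (P.left b)) σ)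
    (hr : P.BlockOK next (P.right b) (L (P.right b)) σ) (e : L' b = L b)
    (e₁ : L' (P.left b) = L (P.left b)) (e₂ : L' (P.right b) = L (P.right b))
    (h₀ : τ.arr aBase b = σ.arr aBase b)
    (h₁ : τ.arr aBase (P.left b) = σ.arr aBase (P.left b))
    (h₂ : τ.arr aBase (P.right b) = σ.arr aBase (P.right b))
    (h₇ : ∀ a < next, τ.arr aVal a = σ.arr aVal a) (h₈ : ∀ a < next, τ.arr aLp a = σ.arr aLp a)
    (h₉ : ∀ a < next, τ.arr aRp a = σ.arr aRp a) : P.MergeOK b L' τ := by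
  intro c hc hv
  rw [e] at hc ⊢
  rw [e₁, e₂]
  have b₀ := hb.base
  have b₁ := hl.base
  have b₂ := hr.base
  rw [h₀, h₇ _ (by omega)] at hv
  obtain ⟨c₁, c₂, g₁, g₂, g₃, g₄, g₅, g₆, g₇⟩ := h c hc hv
  refine ⟨c₁, c₂, ?_, ?_, g₃, g₄, ?_, ?_, fun f hf₁ hf₂ => ?_⟩
  · rw [h₀, h₈ _ (by omega), g₁]
  · rw [h₀, h₉ _ (by omega), g₂]
  · rwa [h₁, h₇ _ (by omega)]
  · rwa [h₂, h₇ _ (by omega)]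
  · rw [Attains.congr hb hc h₀ h₇]
    rw [Attains.congr hl g₃ h₁ h₇] at hf₁
    rw [Attains.congr hr g₄ h₂ h₇] at hf₂
    exact g₇ f hf₁ hf₂

/-- The bound for the number of triples. -/
def tripleBound (P : Plan) : ℕ := 2 ^ (4 * P.h + 8)

theorem runs_mergeBlock {b : ℕ} {L : ℕ → List ℕ} {σ : Store} (h : P.Tables b L σ) (hN : P.N ≤ b)
    (hb : b < 2 * P.N - 1) (hv : σ.var vBlock = b) :
    Runs mergeBlock σ (1000 * (P.h + 3) * (P.tripleBound + 1)) fun τ =>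
      (∃ l, P.Tables (b + 1) (Function.update L b l) τ) ∧ τ.var vBlock = b + 1 := by
  have hlt₁ := P.left_lt b hN hb
  have hlt₂ := P.right_lt b hN hb
  have B₁ := h.block _ hlt₁
  have B₂ := h.block _ hlt₂
  set l₁ := L (P.left b) with hl₁
  set l₂ := L (P.right b) with hl₂
  set X₁ := P.X (P.left b) with hX₁
  set X₂ := P.X (P.right b) with hX₂
  have hXb : P.X b = X₁ ∪ X₂ := P.X_merge b hN hb
  have hdisj : Disjoint X₁ X₂ := P.disj b hN hb
  have hsub : X₁ ∪ X₂ ⊆ range P.m := hXb ▸ P.X_subset b hb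
  set S := 2 * P.n with hS
  set c : ℕ → ℕ := fun s => cnt P.src P.dst X₁ s + cnt P.src P.dst X₂ s with hc
  set D : ℕ → ℕ := cnt P.src P.dst (range P.m) with hD
  have hcD : ∀ s, c s ≤ D s := fun s => by
    rw [hc, hD]; simp only [← cnt_union hdisj]; exact cnt_mono hsub s
  have hrow₁ : P.left b * S + S ≤ b * S := by
    rw [← Nat.succ_mul]; exact Nat.mul_le_mul_right _ hlt₁
  have hrow₂ : P.right b * S + S ≤ b * S := by
    rw [← Nat.succ_mul]; exact Nat.mul_le_mul_right _ hlt₂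
  have hM : 2 ^ (l₁.length + l₂.length) ≤ P.tripleBound := by
    refine Nat.pow_le_pow_right (by norm_num) ?_
    have := B₁.len_le
    have := B₂.len_le
    omega
  have start : Runs startBlock σ startBlock.maxCost fun τ => Sources S (b * S) (P.left b * S)
      (P.right b * S) c D l₁ l₂ τ ∧ SourceLists S (P.left b * S) (P.right b * S) l₁ l₂ τ ∧
      Processed S (b * S) c D l₁ l₂ τ ∅ τ ∧ τ.var vLeft = P.left b ∧ τ.var vRight = P.right b := by
    refine Runs.of_result rfl ?_
    have hf : Frame startBlock σ (startBlock.result σ) := by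
      obtain ⟨t, τ, he, -, hτ⟩ := (Runs.of_result (p := startBlock) (σ := σ)
        (Q := fun τ => τ = startBlock.result σ) rfl rfl)
      exact hτ ▸ he.frame
    have v₁ : (startBlock.result σ).var vLeft = P.left b := by
      simp [startBlock, hv, h.left b hN hb]
    have v₂ : (startBlock.result σ).var vRight = P.right b := by
      simp [startBlock, hv, h.right b hN hb]
    have v₃ : (startBlock.result σ).var vRowL = P.left b * S := by
      simp [startBlock, hv, h.left b hN hb, B₁.row, hS]
    have v₄ : (startBlock.result σ).var vRowR = P.right b * S := by
      simp [startBlock, hv, h.right b hN hb, B₂.row, hS]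
    have v₅ : (startBlock.result σ).var vT = 1 := by simp [startBlock]
    have v₆ : (startBlock.result σ).var vLen = 0 := by simp [startBlock]
    have v₇ : (startBlock.result σ).var vWt = 1 := by simp [startBlock]
    have v₈ : (startBlock.result σ).arr aT1 0 = 0 := by simp [startBlock]
    have v₉ : (startBlock.result σ).arr aT2 0 = 0 := by simp [startBlock]
    have v₁₀ : (startBlock.result σ).arr aT3 0 = 0 := by simp [startBlock]
    generalize startBlock.result σ = τ at *
    have aW := hf.arr aWt rfl
    have aC := hf.arr aCnt rfl
    have aL := hf.arr aList rfl
    refine ⟨⟨hrow₁, hrow₂, ?_, ?_, ?_, ?_, ?_, v₃, v₄⟩, ⟨B₁.list.nodup, B₂.list.nodup,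
      fun s hs => P.lt_of_mem (by omega) B₁.list hs, fun s hs => P.lt_of_mem (by omega) B₂.list hs,
      ?_, ?_, ?_, ?_⟩, ⟨[], [(0, 0, 0)], ⟨?_, ?_, ?_, ?_, ?_, ?_, ?_, ?_, ?_, ?_, ?_, ?_⟩, ?_,
      isTripleList_empty _ _ _, by simp⟩, v₁, v₂⟩
    · rw [aW]; exact B₁.weight
    · rw [aW]; exact B₂.weight
    · intro s hs hm
      rw [aC, B₁.count s hs, B₂.count s hs]
      have h₁ := hcD s
      have p₁ := B₁.list.touch s
      have p₂ := B₂.list.touch s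
      have q₁ := B₁.list.border s
      have q₂ := B₂.list.border s
      simp only [hc, hD, hX₁, hX₂] at h₁ ⊢
      by_cases m₁ : s ∈ l₁ <;> by_cases m₂ : s ∈ l₂
      · simp [m₁, m₂]
      · simp only [m₁, m₂, if_true, if_false]
        have := p₁ m₁
        have : ¬ 0 < cnt P.src P.dst (P.X (P.right b)) s := fun hp => m₂ (q₂ hp (by omega))
        omega
      · simp only [m₁, m₂, if_true, if_false]
        have := p₂ m₂
        have : ¬ 0 < cnt P.src P.dst (P.X (P.left b)) s := fun hp => m₁ (q₁ hp (by omega))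
        omega
      · tauto
    · intro s hs; rw [hf.arr aDeg rfl, h.deg]
    · rw [hf.var vRow rfl, h.row]
    · rw [aL]; exact B₁.get
    · rw [aL]; exact B₂.get
    · rw [v₁, hf.arr aLen rfl, B₁.len]
    · rw [v₂, hf.arr aLen rfl, B₂.len]
    · simpa using v₆
    · simpa using v₇
    · simp
    · simp
    · intro s hs
      rw [aW, h.wt_above _ (Nat.le_add_right _ _)]; simp [wt]
    · simp
    · intro a ha
      rw [aW, h.wt_above _ ((Nat.le_add_right _ _).trans ha)]
    · intro s hs
      rw [aC, h.cnt_above _ (Nat.le_add_right _ _)]; simp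
    · simp
    · intro a ha
      rw [aC, h.cnt_above _ ((Nat.le_add_right _ _).trans ha)]
    · simp
    · simp
    · refine ⟨by simpa using v₅, fun i hi => ?_⟩
      obtain rfl : i = 0 := by simpa using hi
      simp [v₈, v₉, v₁₀]
  refine (start.seq_frame (U := 998 * (P.h + 3) * (P.tripleBound + 1)) fun σ₁ ⟨hsrc, hsl, hpr, e₁, e₂⟩ F₁ =>
    ((runs_leftSlots hsrc hsl ⟨rfl, rfl, rfl, rfl, rfl, rfl, rfl⟩ hpr hM).seq_frame
    fun σ₂ h₂ F₂ => (runs_rightSlots hsrc hsl (Same.of_frame F₂ (by decide) (by decide)) h₂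
    hM).seq_frame fun σ₃ h₃ F₃ => ?_).mono (T := 200 * (l₁.length + 1) * (P.tripleBound + 1) +
      (200 * (l₂.length + 1) * (P.tripleBound + 1) + (100 * (P.tripleBound + 1) + 40)))
      ?_ fun _ h => h).mono ?_ fun _ h => h
  · obtain ⟨l, ts, hR, hH, hT, htl⟩ := h₃
    have hml : MergedList P.src P.dst P.m X₁ X₂ l₁ l₂ l := ⟨hdisj, hsub, B₁.list, B₂.list,
      hR.nodup, fun s => by rw [hR.mem]; simp [hc, hD]⟩
    have hlen : l.length ≤ 2 * P.h := by
      rw [hml.length_eq, ← hXb]; exact P.border_le b hN hb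
    have hlen' : ts.length ≤ P.tripleBound := htl.trans ((Nat.pow_le_pow_right (by norm_num)
      (Nat.add_le_add (card_inter_le_length _ _) (card_inter_le_length _ _))).trans hM)
    have hnext : σ₃.var vNext = σ.var vNext := by
      rw [F₃.var vNext rfl, F₂.var vNext rfl, F₁.var vNext rfl]
    have hval : σ₃.arr aVal = σ.arr aVal := by
      rw [F₃.arr aVal rfl, F₂.arr aVal rfl, F₁.arr aVal rfl]
    have hbase : σ₃.arr aBase = σ.arr aBase := by
      rw [F₃.arr aBase rfl, F₂.arr aBase rfl, F₁.arr aBase rfl]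
    have hleft : σ₃.var vLeft = P.left b := by
      rw [F₃.var vLeft rfl, F₂.var vLeft rfl, e₁]
    have hright : σ₃.var vRight = P.right b := by
      rw [F₃.var vRight rfl, F₂.var vRight rfl, e₂]
    have imp := runs_improve (w := 2 ^ l.length) hH ?_ ?_ ?_ ?_
    rotate_left
    · intro t ht
      obtain ⟨S₁, S₂, -, -, -, rfl⟩ := (hT t).1 ht
      exact code_lt _ _
    · rw [hnext, hval]; exact h.val_above
    · intro t ht
      obtain ⟨S₁, S₂, -, -, -, rfl⟩ := (hT t).1 ht
      rw [hbase, hleft, hnext]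
      have := B₁.base
      have := code_lt l₁ S₁
      simp only
      omega
    · intro t ht
      obtain ⟨S₁, S₂, -, -, -, rfl⟩ := (hT t).1 ht
      rw [hbase, hright, hnext]
      have := B₂.base
      have := code_lt l₂ S₂
      simp only
      omega
    rw [hbase, hleft, hright, hval, hnext] at imp
    set V₁ := fun c => σ.arr aVal (σ.arr aBase (P.left b) + c) with hV₁
    set V₂ := fun c => σ.arr aVal (σ.arr aBase (P.right b) + c) with hV₂
    refine ((imp.mono (Nat.mul_le_mul_left 100 (Nat.succ_le_succ hlen')) fun _ h => h).seq_frame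
      (U := 40) fun σ₄ h₄ F₄ => ?_)
    have hrow : σ₄.var vRow = b * S := by
      rw [F₄.var vRow rfl, F₃.var vRow rfl, F₂.var vRow rfl, F₁.var vRow rfl, h.row]
    have hblk : σ₄.var vBlock = b := by
      rw [F₄.var vBlock rfl, F₃.var vBlock rfl, F₂.var vBlock rfl, F₁.var vBlock rfl, hv]
    have hstr : σ₄.var vStride = S := by
      rw [F₄.var vStride rfl, F₃.var vStride rfl, F₂.var vStride rfl, F₁.var vStride rfl, h.stride]
    have hnext₄ : σ₄.var vNext = σ.var vNext := by rw [F₄.var vNext rfl, hnext]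
    have hLen₄ : σ₄.var vLen = l.length := by rw [F₄.var vLen rfl, hR.len]
    have hWt₄ : σ₄.var vWt = 2 ^ l.length := by rw [F₄.var vWt rfl, hR.weight]
    have fin : Runs finishBlock σ₄ finishBlock.maxCost fun τ =>
        τ.arr aLen = Function.update (σ.arr aLen) b l.length ∧
        τ.arr aBase = Function.update (σ.arr aBase) b (σ.var vNext) ∧
        τ.arr aRow = Function.update (σ.arr aRow) b (b * S) ∧
        τ.var vNext = σ.var vNext + 2 ^ l.length ∧ τ.var vRow = b * S + S ∧
        τ.var vBlock = b + 1 := by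
      have a₁ : σ₄.arr aLen = σ.arr aLen := by
        rw [F₄.arr aLen rfl, F₃.arr aLen rfl, F₂.arr aLen rfl, F₁.arr aLen rfl]
      have a₂ : σ₄.arr aBase = σ.arr aBase := by rw [F₄.arr aBase rfl, hbase]
      have a₃ : σ₄.arr aRow = σ.arr aRow := by
        rw [F₄.arr aRow rfl, F₃.arr aRow rfl, F₂.arr aRow rfl, F₁.arr aRow rfl]
      refine Runs.of_result rfl ?_
      simp [finishBlock, incr, hrow, hblk, hstr, hnext₄, hLen₄, hWt₄, a₁, a₂, a₃]
    refine (fin.frame).mono (by decide) fun τ hτ => ?_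
    obtain ⟨⟨t₁, t₂, t₃, t₄, t₅, t₆⟩, F₅⟩ := hτ
    refine ⟨⟨l, ?_⟩, t₆⟩
    have tL : τ.arr aList = σ₃.arr aList := by rw [F₅.arr aList rfl, F₄.arr aList rfl]
    have tW : τ.arr aWt = σ₃.arr aWt := by rw [F₅.arr aWt rfl, F₄.arr aWt rfl]
    have tC : τ.arr aCnt = σ₃.arr aCnt := by rw [F₅.arr aCnt rfl, F₄.arr aCnt rfl]
    have tV : τ.arr aVal = σ₄.arr aVal := F₅.arr aVal rfl
    have tP : τ.arr aLp = σ₄.arr aLp := F₅.arr aLp rfl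
    have tQ : τ.arr aRp = σ₄.arr aRp := F₅.arr aRp rfl
    have oW : σ₁.arr aWt = σ.arr aWt := F₁.arr aWt rfl
    have oL : σ₁.arr aList = σ.arr aList := F₁.arr aList rfl
    have oC : σ₁.arr aCnt = σ.arr aCnt := F₁.arr aCnt rfl
    have oP : σ₃.arr aLp = σ.arr aLp := by
      rw [F₃.arr aLp rfl, F₂.arr aLp rfl, F₁.arr aLp rfl]
    have oQ : σ₃.arr aRp = σ.arr aRp := by
      rw [F₃.arr aRp rfl, F₂.arr aRp rfl, F₁.arr aRp rfl]
    have fL : ∀ a < b * S, τ.arr aList a = σ.arr aList a := fun a ha => by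
      rw [tL, hR.list_old a ha, oL]
    have fW : ∀ a < b * S, τ.arr aWt a = σ.arr aWt a := fun a ha => by
      rw [tW, hR.wt_old a ha, oW]
    have fC : ∀ a < b * S, τ.arr aCnt a = σ.arr aCnt a := fun a ha => by
      rw [tC, hR.cnt_old a ha, oC]
    have fV : ∀ a < σ.var vNext, τ.arr aVal a = σ.arr aVal a := fun a ha => by
      rw [tV, h₄.val_old a ha, hval]
    have fP : ∀ a < σ.var vNext, τ.arr aLp a = σ.arr aLp a := fun a ha => by
      rw [tP, h₄.lp_old a ha, oP]
    have fQ : ∀ a < σ.var vNext, τ.arr aRp a = σ.arr aRp a := fun a ha => by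
      rw [tQ, h₄.rp_old a ha, oQ]
    have fB : ∀ b' < b, τ.arr aBase b' = σ.arr aBase b' := fun b' hb' => by
      rw [t₂, Function.update_of_ne hb'.ne]
    have hUL : ∀ b' < b, Function.update L b l b' = L b' := fun b' hb' =>
      Function.update_of_ne hb'.ne _ _
    have hbb : τ.arr aBase b = σ.var vNext := by rw [t₂, Function.update_self]
    have hold : ∀ b' < b, P.BlockOK (τ.var vNext) b' (L b') τ := fun b' hb' =>
      (h.block b' hb').congr (r := b * S) (by omega) (by omega)
        (by rw [← hS, ← Nat.succ_mul]; exact Nat.mul_le_mul_right _ hb')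
        (by rw [t₁, Function.update_of_ne hb'.ne]) (by rw [t₃, Function.update_of_ne hb'.ne])
        (fB b' hb') fL fW fC fV
    have hnew : P.BlockOK (τ.var vNext) b l τ := by
      refine ⟨hXb ▸ hml.borderList, by omega, ?_, ?_, ?_, ?_, ?_, ?_, ?_⟩
      · rw [t₁, Function.update_self]
      · rw [t₃, Function.update_self]
      · intro i hi; rw [tL]; exact hR.list_new i hi
      · intro s hs; rw [tW]; exact hR.wt_new s hs
      · intro s hs; rw [tC, hXb, cnt_union hdisj]; exact hR.cnt_new s hs
      · rw [hbb, t₄]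
      · intro f hf
        rw [hXb] at hf ⊢
        obtain ⟨f₁, f₂, fd⟩ := (valid_union hdisj).1 hf
        have key := h₄.le (code l₁ (used P.src P.dst X₁ f ∩ l₁.toFinset),
          code l₂ (used P.src P.dst X₂ f ∩ l₂.toFinset), code l (used P.src P.dst X₁ f ∩
          l₁.toFinset ∪ used P.src P.dst X₂ f ∩ l₂.toFinset)) ((hT _).2 ⟨_, _, ?_, ?_, ?_, rfl⟩)
        · have c₁ : code l₁ (used P.src P.dst X₁ f ∩ l₁.toFinset) =
              code l₁ (used P.src P.dst X₁ f) := code_eq_of_forall fun s hs => by simp [hs]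
          have c₂ : code l₂ (used P.src P.dst X₂ f ∩ l₂.toFinset) =
              code l₂ (used P.src P.dst X₂ f) := code_eq_of_forall fun s hs => by simp [hs]
          have g₁ := B₁.complete f f₁
          have g₂ := B₂.complete f f₂
          rw [← hX₁, ← c₁] at g₁
          rw [← hX₂, ← c₂] at g₂
          have key' := key (by simp only [hV₁]; omega) (by simp only [hV₂]; omega)
          rw [hbb, tV, size_union hdisj, hml.code_used f₁ f₂
            (S₁ := used P.src P.dst X₁ f ∩ l₁.toFinset)
            (S₂ := used P.src P.dst X₂ f ∩ l₂.toFinset) (by simp +contextual)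
            (by simp +contextual) (by simp) (by simp)]
          simp only [hV₁, hV₂] at key'
          omega
        · intro s hs; simp at hs; simp [hs]
        · intro s hs; simp at hs; simp [hs]
        · exact fd.mono inter_subset_left inter_subset_left
    refine ⟨?_, ?_, ?_, ?_, ?_, ?_, ?_, ?_, ?_, ?_, ?_, ?_⟩
    · rw [F₅.var vStride rfl, hstr]
    · rw [t₅, Nat.succ_mul]
    · intro s
      rw [F₅.arr aDeg rfl, F₄.arr aDeg rfl, F₃.arr aDeg rfl, F₂.arr aDeg rfl, F₁.arr aDeg rfl,
        h.deg]
    · intro b' h₁ h₂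
      rw [F₅.arr aLeft rfl, F₄.arr aLeft rfl, F₃.arr aLeft rfl, F₂.arr aLeft rfl,
        F₁.arr aLeft rfl, h.left b' h₁ h₂]
    · intro b' h₁ h₂
      rw [F₅.arr aRight rfl, F₄.arr aRight rfl, F₃.arr aRight rfl, F₂.arr aRight rfl,
        F₁.arr aRight rfl, h.right b' h₁ h₂]
    · intro a ha; rw [tW]; exact hR.wt_above a (by rw [Nat.succ_mul] at ha; omega)
    · intro a ha; rw [tC]; exact hR.cnt_above a (by rw [Nat.succ_mul] at ha; omega)
    · intro a ha; rw [tV]; exact h₄.above a (by omega)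
    · intro b' hb'
      rcases Nat.lt_succ_iff_lt_or_eq.1 hb' with hlt | rfl
      · rw [hUL b' hlt]; exact hold b' hlt
      · rw [Function.update_self]; exact hnew
    · intro b' hb'
      rw [hUL b' (by omega)]
      exact (h.node b' hb').congr (h.block b' (by omega)) (fB b' (by omega)) fV
    · intro b' h₁ hb'
      rcases Nat.lt_succ_iff_lt_or_eq.1 hb' with hlt | rfl
      · have g₁ := P.left_lt b' h₁ (by omega)
        have g₂ := P.right_lt b' h₁ (by omega)
        exact (h.merge b' h₁ hlt).congr (h.block b' hlt) (h.block _ (by omega))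
          (h.block _ (by omega)) (hUL _ hlt) (hUL _ (by omega)) (hUL _ (by omega)) (fB _ hlt)
          (fB _ (by omega)) (fB _ (by omega)) fV fP fQ
      · intro c' hc' hne
        rw [hUL _ hlt₁, hUL _ hlt₂, ← hl₁, ← hl₂]
        rw [Function.update_self] at hc' ⊢
        rw [hbb, tV] at hne
        obtain ⟨t, ht, o₁, o₂, o₃, o₄, o₅, o₆⟩ := h₄.origin c' hne
        obtain ⟨S₁, S₂, s₁, s₂, sd, rfl⟩ := (hT t).1 ht
        have k₁ := code_lt l₁ S₁
        have k₂ := code_lt l₂ S₂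
        have w₁ := B₁.base
        have w₂ := B₂.base
        refine ⟨code l₁ S₁, code l₂ S₂, ?_, ?_, k₁, k₂, ?_, ?_, ?_⟩
        · rw [hbb, tP, o₂]
        · rw [hbb, tQ, o₃]
        · rw [fB _ hlt₁, fV _ (by omega)]; exact o₄
        · rw [fB _ hlt₂, fV _ (by omega)]; exact o₅
        · intro f hf₁ hf₂
          rw [Attains.congr B₁ k₁ (fB _ hlt₁) fV] at hf₁
          rw [Attains.congr B₂ k₂ (fB _ hlt₂) fV] at hf₂
          obtain ⟨x₁, x₂, x₃⟩ := hf₁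
          obtain ⟨y₁, y₂, y₃⟩ := hf₂
          have z₁ := code_inj x₂
          have z₂ := code_inj y₂
          refine ⟨?_, ?_, ?_⟩
          · rw [hXb]; exact hml.valid x₁ y₁ z₁ z₂ sd
          · rw [hXb, ← o₁]
            exact hml.code_used x₁ y₁ z₁ z₂ (fun s hs => (s₁ s hs).1) fun s hs => (s₂ s hs).1
          · rw [hXb, size_union hdisj, hbb, tV]
            simp only [hV₁, hV₂, ← hX₁, ← hX₂] at o₆ x₃ y₃
            omega
    · intro b' h₁ hb' s hs
      rcases Nat.lt_succ_iff_lt_or_eq.1 hb' with hlt | rfl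
      · rw [hUL b' hlt] at hs; exact h.exact b' h₁ hlt s hs
      · rw [Function.update_self] at hs
        rw [hXb]; exact (hml.mem_iff s).1 hs
  · have g₁ := B₁.len_le
    have g₂ := B₂.len_le
    have : 200 * (l₁.length + 1) * (P.tripleBound + 1) ≤ 200 * (2 * P.h + 5) * (P.tripleBound + 1) :=
      Nat.mul_le_mul_right _ (by omega)
    have : 200 * (l₂.length + 1) * (P.tripleBound + 1) ≤ 200 * (2 * P.h + 5) * (P.tripleBound + 1) :=
      Nat.mul_le_mul_right _ (by omega)
    nlinarith [Nat.zero_le (P.h * P.tripleBound)]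
  · have : startBlock.maxCost ≤ 40 := by decide
    have h1 : 256 ≤ P.tripleBound :=
      Nat.pow_le_pow_right (n := 2) (by norm_num) (show 8 ≤ 4 * P.h + 8 by omega)
    nlinarith [Nat.zero_le (P.h * P.tripleBound)]

end Plan

end MaxTwoColor

namespace MaxTwoColor

open RAM SlotCode Slots Finset

namespace Plan

variable {P : Plan}

theorem runs_computeTables {L : ℕ → List ℕ} {σ : Store} (h : P.Tables P.N L σ)
    (hN : σ.var vNodes = P.N) (hB : σ.var vBlocks = 2 * P.N - 1) :
    Runs computeTables σ (2000 * (P.N + 1) * (P.h + 3) * (P.tripleBound + 1)) fun τ =>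
      ∃ L, P.Tables (2 * P.N - 1) L τ := by
  refine ((Runs.of_result (p := vBlock ≔ .var vNodes) (Q := fun τ => τ.var vBlock = P.N ∧
    P.Tables P.N L τ) rfl ?_).seq_frame fun τ hτ F => Runs.for_loop (n := P.N - 1)
    (T := 1000 * (P.h + 3) * (P.tripleBound + 1))
    (I := fun j τ => τ.var vBlock = P.N + j ∧ ∃ L, P.Tables (P.N + j) L τ) ?_ ?_ ?_).mono ?_ ?_
  · refine ⟨by simp [hN], ?_, ?_, ?_, ?_, ?_, ?_, ?_, ?_, ?_, ?_, ?_, ?_⟩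
    · simpa using h.stride
    · simpa using h.row
    · simpa using h.deg
    · simpa using h.left
    · simpa using h.right
    · simpa using h.wt_above
    · simpa using h.cnt_above
    · simpa using h.val_above
    · intro b hb
      exact (h.block b hb).congr (r := b * (2 * P.n) + 2 * P.n) (by omega) (by simp) le_rfl rfl rfl
        rfl (fun _ _ => rfl) (fun _ _ => rfl) (fun _ _ => rfl) fun _ _ => rfl
    · exact h.node
    · intro b h₁ h₂; omega
    · exact h.exact
  · rintro j ρ hj ⟨hv, -⟩ F'
    have := (F'.var vBlocks rfl).trans (F.var vBlocks rfl)
    simp only [Expr.eval, hv, this, hB]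
    omega
  · rintro j ρ hj ⟨hv, L', hT⟩ F'
    refine (runs_mergeBlock hT (by omega) (by omega) hv).mono le_rfl fun π hπ => ?_
    obtain ⟨⟨l, hl⟩, hv'⟩ := hπ
    exact ⟨hv', _, hl⟩
  · exact ⟨by simpa using hτ.1, L, by simpa using hτ.2⟩
  · simp only [Prog.maxCost, Expr.cost]
    have h1 : 1 ≤ (P.h + 3) * (P.tripleBound + 1) := Nat.mul_pos (by omega) (by omega)
    calc _ ≤ 1 + 1 + (P.N * (1 + 1 + 1 + 1 + 1000 * (P.h + 3) * (P.tripleBound + 1)) +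
          (1 + 1 + 1 + 1)) := by gcongr; omega
      _ ≤ _ := by
        rw [mul_assoc, mul_assoc, mul_assoc]
        generalize (P.h + 3) * (P.tripleBound + 1) = z at *
        nlinarith [Nat.zero_le (P.N * z)]
  · rintro τ ⟨-, L, hL⟩
    rcases Nat.eq_zero_or_pos P.N with h0 | h0
    · exact ⟨L, by simpa [h0] using hL⟩
    · exact ⟨L, by rwa [show P.N + (P.N - 1) = 2 * P.N - 1 by omega] at hL⟩

/-- The memory holds consistent choices of table entries. -/
structure Traced (P : Plan) (k : ℕ) (σ τ : Store) : Prop where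
  left : ∀ b, P.N ≤ b → k ≤ b → b < 2 * P.N - 1 →
    τ.arr aSel (P.left b) = σ.arr aLp (σ.arr aBase b + τ.arr aSel b)
  right : ∀ b, P.N ≤ b → k ≤ b → b < 2 * P.N - 1 →
    τ.arr aSel (P.right b) = σ.arr aRp (σ.arr aBase b + τ.arr aSel b)
  root : τ.arr aSel (2 * P.N - 2) = if P.N ≤ 1 then 3 else 0

theorem runs_trace {σ : Store} (hl : ∀ b, P.N ≤ b → b < 2 * P.N - 1 → σ.arr aLeft b = P.left b)
    (hr : ∀ b, P.N ≤ b → b < 2 * P.N - 1 → σ.arr aRight b = P.right b)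
    (hN : σ.var vNodes = P.N) (hB : σ.var vBlocks = 2 * P.N - 1) (hs : ∀ a, σ.arr aSel a = 0)
    (hc : ∀ a, σ.arr aCol a = 0) :
    Runs trace σ (40 * (P.N + 1)) fun τ => Traced P P.N σ τ ∧ ∀ c, τ.arr aCol c = colorOf c := by
  have h₁ : Runs (.store aCol (.const 3) (.const 1)) σ 3 fun τ => τ.arr aCol =
      Function.update (σ.arr aCol) 3 1 := Runs.of_result rfl (by simp)
  refine (h₁.seq_frame fun σ₁ e₁ F₁ => (Runs.of_result
    (p := .store aCol (.const 12) (.const 2)) (Q := fun τ => τ.arr aCol =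
      Function.update (Function.update (σ.arr aCol) 3 1) 12 2) rfl (by simp [e₁])).seq_frame
    fun σ₂ e₂ F₂ => (Runs.of_result (p := .ite (.var vNodes -ₑ .const 1) .skip
      (.store aSel (.const 0) (.const 3))) (Q := fun τ => τ.arr aSel =
        if P.N ≤ 1 then Function.update (σ.arr aSel) 0 3 else σ.arr aSel) rfl ?_).seq_frame
    fun σ₃ e₃ F₃ => (Runs.of_result (p := vBlock ≔ .var vBlocks) (Q := fun τ =>
      τ.var vBlock = 2 * P.N - 1 ∧ τ.arr = σ₃.arr) rfl ?_).seq_frame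
    fun σ₄ e₄ F₄ => (Runs.for_loop (n := P.N - 1) (T := 26)
      (I := fun j τ => τ.var vBlock = 2 * P.N - 1 - j ∧ Traced P (2 * P.N - 1 - j) σ τ ∧
        ∀ c, τ.arr aCol c = colorOf c)
    ?_ ?_ ?_)).mono ?_ ?_
  · have v₂ : σ₂.var vNodes = P.N := by rw [F₂.var vNodes rfl, F₁.var vNodes rfl, hN]
    have a₂ : σ₂.arr aSel = σ.arr aSel := by rw [F₂.arr aSel rfl, F₁.arr aSel rfl]
    by_cases h : P.N ≤ 1
    · simp [v₂, a₂, h]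
    · have : P.N - 1 ≠ 0 := by omega
      simp [v₂, a₂, h, this]
  · have v₃ : σ₃.var vBlocks = 2 * P.N - 1 := by
      rw [F₃.var vBlocks rfl, F₂.var vBlocks rfl, F₁.var vBlocks rfl, hB]
    simp [v₃]
  · rintro j τ hj ⟨hv, -⟩ F
    have : τ.var vNodes = P.N := by
      rw [F.var vNodes rfl, F₄.var vNodes rfl, F₃.var vNodes rfl, F₂.var vNodes rfl,
        F₁.var vNodes rfl, hN]
    simp only [Expr.eval, hv, this]
    omega
  · rintro j τ hj ⟨hv, hT, hcol⟩ F
    have fr : ∀ a, a ≠ aSel → a ≠ aCol → τ.arr a = σ.arr a := by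
      intro a h₁ h₂
      rw [F.arr a (by simp [Prog.setsArr, h₁]), F₄.arr a (by simp [Prog.setsArr]),
        F₃.arr a (by simp [Prog.setsArr, h₁]), F₂.arr a (by simp [Prog.setsArr, h₂]),
        F₁.arr a (by simp [Prog.setsArr, h₂])]
    have fB := fr aBase (by decide) (by decide)
    have fP := fr aLp (by decide) (by decide)
    have fQ := fr aRp (by decide) (by decide)
    have fl := fr aLeft (by decide) (by decide)
    have frr := fr aRight (by decide) (by decide)
    refine Runs.mono (Runs.of_result rfl ?_) (by decide) fun _ h => h
    set b := 2 * P.N - 1 - (j + 1) with hb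
    have hb1 : 2 * P.N - 1 - j - 1 = b := by omega
    have hNb : P.N ≤ b := by omega
    have hb2 : b < 2 * P.N - 1 := by omega
    have hll := hl b hNb hb2
    have hrr := hr b hNb hb2
    have hlt := P.left_lt b hNb hb2
    have hrt := P.right_lt b hNb hb2
    have hpl := P.par_left b hNb hb2
    have hpr := P.par_right b hNb hb2
    have hne := P.left_ne_right b hNb hb2
    set τ' := Prog.result _ τ with hτ'
    have hsel : τ'.arr aSel = Function.update (Function.update (τ.arr aSel) (P.left b)
        (σ.arr aLp (σ.arr aBase b + τ.arr aSel b))) (P.right b)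
        (σ.arr aRp (σ.arr aBase b + τ.arr aSel b)) := by
      rw [hτ']
      simp [hv, hb1, fB, fP, fQ, fl, frr, hll, hrr]
    have hother : ∀ x, x ≠ P.left b → x ≠ P.right b → τ'.arr aSel x = τ.arr aSel x :=
      fun x h₁ h₂ => by rw [hsel, Function.update_of_ne h₂, Function.update_of_ne h₁]
    have hself : τ'.arr aSel b = τ.arr aSel b := hother b (by omega) (by omega)
    have cases_b : ∀ b', b ≤ b' → b' = b ∨ 2 * P.N - 1 - j ≤ b' := fun b' h => by omega
    refine ⟨by rw [hτ']; simp [hv, hb1], ⟨?_, ?_, ?_⟩, ?_⟩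
    · intro b' h₁ h₂ h₃
      rcases cases_b b' h₂ with rfl | h₄
      · rw [hself, hsel, Function.update_of_ne hne, Function.update_self]
      · have hp := P.par_left b' h₁ h₃
        rw [hother b' (by omega) (by omega), hother (P.left b') (fun e => by rw [e] at hp; omega)
          (fun e => by rw [e] at hp; omega), hT.left b' h₁ h₄ h₃]
    · intro b' h₁ h₂ h₃
      rcases cases_b b' h₂ with rfl | h₄
      · rw [hself, hsel, Function.update_self]
      · have hp := P.par_right b' h₁ h₃
        rw [hother b' (by omega) (by omega), hother (P.right b') (fun e => by rw [e] at hp; omega)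
          (fun e => by rw [e] at hp; omega), hT.right b' h₁ h₄ h₃]
    · rw [hother _ (by omega) (by omega), hT.root]
    · intro c
      rw [← hcol c, hτ']
      simp
  · refine ⟨by simpa using e₄.1, ⟨?_, ?_, ?_⟩, ?_⟩
    · intro b h₁ h₂ h₃; omega
    · intro b h₁ h₂ h₃; omega
    · rw [e₄.2, e₃]
      split_ifs with h
      · rw [show 2 * P.N - 2 = 0 by omega]; simp
      · exact hs _
    · intro c
      rw [e₄.2, F₃.arr aCol rfl, e₂]
      simp only [Function.update_apply, hc, colorOf]
      split_ifs <;> omega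
  · simp only [Prog.maxCost, Expr.cost, Nat.max_def]
    norm_num
    omega
  · rintro τ ⟨-, ⟨h₁, h₂, h₃⟩, h₄⟩
    exact ⟨⟨fun b g₁ _ g₂ => h₁ b g₁ (by omega) g₂, fun b g₁ _ g₂ => h₂ b g₁ (by omega) g₂, h₃⟩, h₄⟩

/-- The colours that the consistent choices stand for are optimal. -/
theorem Traced.optimal {L : ℕ → List ℕ} {σ τ : Store} (hT : P.Tables (2 * P.N - 1) L σ)
    (h : Traced P P.N σ τ) {f : ℕ → ℕ}
    (hf : ∀ i < P.m, f i = colorOf (τ.arr aSel (P.leaf i))) :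
    Valid P.src P.dst (range P.m) f ∧
      ∀ g, Valid P.src P.dst (range P.m) g → size (range P.m) g ≤ size (range P.m) f := by
  rcases Nat.lt_or_ge P.N 2 with hN | hN
  · have h3 : ∀ i < P.m, f i = 1 ∧ i = 0 := by
      intro i hi
      have h₁ := P.leaf_lt i hi
      have h₂ := P.leaf_lt 0 (by omega)
      have h₄ : P.leaf i = 2 * P.N - 2 := by omega
      refine ⟨?_, P.leaf_inj i hi 0 (by omega) (by omega)⟩
      rw [hf i hi, h₄, h.root, if_pos (by omega)]
      rfl
    refine ⟨⟨fun i hi => ?_, fun i hi j hj hij => ?_⟩, fun g _ => ?_⟩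
    · rw [(h3 i (mem_range.1 hi)).1]; norm_num
    · rw [(h3 i (mem_range.1 hi)).2, (h3 j (mem_range.1 hj)).2] at hij
      exact absurd rfl hij
    · refine card_le_card fun i hi => ?_
      have := (mem_filter.1 hi).1
      exact mem_filter.2 ⟨this, by rw [(h3 i (mem_range.1 this)).1]; norm_num⟩
  · have key : ∀ b < 2 * P.N - 1, τ.arr aSel b < 2 ^ (L b).length →
        σ.arr aVal (σ.arr aBase b + τ.arr aSel b) ≠ 0 →
        P.Attains b (L b) σ (τ.arr aSel b) f := by
      intro b
      induction b using Nat.strong_induction_on with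
      | _ b ih =>
        intro hb hc hv
        rcases Nat.lt_or_ge b P.N with hbN | hbN
        · refine hT.node b hbN _ hc hv f fun i hi => ?_
          rw [P.X_node b hbN, mem_filter, mem_range] at hi
          rw [hf i hi.1, hi.2]
        · obtain ⟨c₁, c₂, e₁, e₂, g₁, g₂, v₁, v₂, H⟩ := hT.merge b hbN hb _ hc hv
          have hl := P.left_lt b hbN hb
          have hr := P.right_lt b hbN hb
          have s₁ := h.left b hbN hbN hb
          have s₂ := h.right b hbN hbN hb
          rw [e₁] at s₁
          rw [e₂] at s₂
          subst s₁
          subst s₂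
          exact H f (ih _ hl (by omega) g₁ v₁) (ih _ hr (by omega) g₂ v₂)
    have hroot := P.root (by omega)
    have hblk := hT.block (2 * P.N - 2) (by omega)
    have hnil : L (2 * P.N - 2) = [] := by
      refine List.eq_nil_iff_forall_not_mem.2 fun s hs => ?_
      have := mem_border.1 (hT.exact (2 * P.N - 2) (by omega) (by omega) s hs)
      rw [hroot] at this
      omega
    have hcode : ∀ S, code [] S = 0 := fun S => by simp [code, wt]
    have hcomp := hblk.complete
    rw [hnil, hroot] at hcomp
    simp only [hcode, add_zero] at hcomp
    have h0 : σ.arr aVal (σ.arr aBase (2 * P.N - 2)) ≠ 0 := by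
      have := hcomp (fun _ => 0) ⟨fun _ _ => by norm_num, fun _ _ _ _ _ => by simp [slots]⟩
      omega
    have hr0 : τ.arr aSel (2 * P.N - 2) = 0 := by rw [h.root, if_neg (by omega)]
    obtain ⟨a₁, -, a₃⟩ := key (2 * P.N - 2) (by omega) (by rw [hr0]; positivity)
      (by rwa [hr0, add_zero])
    rw [hroot] at a₁ a₃
    rw [hr0, add_zero] at a₃
    exact ⟨a₁, fun g hg => by have := hcomp g hg; omega⟩

theorem runs_output {σ : Store} {m : ℕ} (hm : σ.var vM = m) :
    Runs output σ (20 * (m + 1)) fun τ =>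
      ∀ i < m, τ.arr aOut i = σ.arr aCol (σ.arr aSel (σ.arr aLeaf i)) := by
  refine ((Runs.of_result (p := vI ≔ .const 0) (Q := fun τ => τ.var vI = 0) rfl
    (by simp)).seq_frame fun τ hτ F => Runs.for_loop (n := m) (T := 11)
    (I := fun j τ => τ.var vI = j ∧
      ∀ i < j, τ.arr aOut i = σ.arr aCol (σ.arr aSel (σ.arr aLeaf i))) ?_ ?_ ?_).mono ?_ ?_
  · rintro j ρ - ⟨hj, -⟩ F'
    have := (F'.var vM rfl).trans (F.var vM rfl)
    simp only [Expr.eval, hj, this, hm]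
    omega
  · rintro j ρ hj ⟨hv, hI⟩ F'
    have a₁ := (F'.arr aCol rfl).trans (F.arr aCol rfl)
    have a₂ := (F'.arr aSel rfl).trans (F.arr aSel rfl)
    have a₃ := (F'.arr aLeaf rfl).trans (F.arr aLeaf rfl)
    refine Runs.mono (Runs.of_result rfl ?_) (by decide) fun _ h => h
    refine ⟨by simp [incr, hv], fun i hi => ?_⟩
    rcases Nat.lt_succ_iff_lt_or_eq.1 hi with hlt | rfl
    · simp [incr, hv, Function.update_of_ne hlt.ne, hI i hlt]
    · simp [incr, hv, a₁, a₂, a₃]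
  · exact ⟨hτ, fun i hi => absurd hi (by omega)⟩
  · simp only [Prog.maxCost, Expr.cost]
    omega
  · exact fun τ h => h.2

theorem runs_solve {L : ℕ → List ℕ} {σ : Store} (h : P.Tables P.N L σ)
    (hN : σ.var vNodes = P.N) (hm : σ.var vM = P.m) (hB : σ.var vBlocks = 2 * P.N - 1)
    (hs : ∀ a, σ.arr aSel a = 0) (hc : ∀ a, σ.arr aCol a = 0)
    (hl : ∀ i < P.m, σ.arr aLeaf i = P.leaf i) :
    Runs (computeTables ⨟ trace ⨟ output) σ
      (2100 * (P.N + 1) * (P.h + 3) * (P.tripleBound + 1) + 20 * (P.m + 1)) fun τ =>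
      Valid P.src P.dst (range P.m) (τ.arr aOut) ∧ ∀ g, Valid P.src P.dst (range P.m) g →
        size (range P.m) g ≤ size (range P.m) (τ.arr aOut) := by
  refine ((runs_computeTables h hN hB).seq_frame fun σ₁ h₁ F₁ => ?_ :
    Runs _ _ (_ + (40 * (P.N + 1) + 20 * (P.m + 1))) _).mono ?_ fun _ h => h
  · obtain ⟨L', hL⟩ := h₁
    refine (runs_trace hL.left hL.right ((F₁.var vNodes rfl).trans hN)
      ((F₁.var vBlocks rfl).trans hB) (fun a => by rw [F₁.arr aSel rfl, hs])
      (fun a => by rw [F₁.arr aCol rfl, hc])).seq_frame fun σ₂ h₂ F₂ => ?_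
    refine (runs_output (m := P.m)
      (by rw [F₂.var vM rfl, F₁.var vM rfl, hm])).mono le_rfl fun τ hτ => ?_
    refine h₂.1.optimal hL fun i hi => ?_
    rw [hτ i hi, h₂.2, F₂.arr aLeaf rfl, F₁.arr aLeaf rfl, hl i hi]
  · have h1 : 1 ≤ (P.h + 3) * (P.tripleBound + 1) := Nat.mul_pos (by omega) (by omega)
    rw [mul_assoc, mul_assoc, mul_assoc, mul_assoc]
    generalize (P.h + 3) * (P.tripleBound + 1) = z at *
    nlinarith [Nat.zero_le (P.N * z)]

/-! ### The number of edges -/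

theorem card_X_le_one (b : ℕ) (hb : b < P.N) : #(P.X b) ≤ 1 := by
  rw [P.X_node b hb]
  refine card_le_one.2 fun i hi j hj => ?_
  rw [mem_filter, mem_range] at hi hj
  exact P.leaf_inj i hi.1 j hj.1 (hi.2.trans hj.2.symm)

theorem card_border_le (b : ℕ) (hb : b < 2 * P.N - 1) :
    #(border P.src P.dst P.m (P.X b)) ≤ 2 * P.h + 4 := by
  rcases Nat.lt_or_ge b P.N with h | h
  · refine (card_le_card (filter_subset _ _)).trans ((card_biUnion_le_card_mul _ _ 4
      fun i _ => ?_).trans ?_)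
    · unfold touch
      exact card_le_four
    · have := card_X_le_one (P := P) b h
      omega
  · have := P.border_le b h hb
    omega

theorem m_le (h : 0 < P.N) : P.m ≤ (4 * P.h + 9) * (2 * P.n) := by
  have key : ∀ b < 2 * P.N - 1, #(captured P.src P.dst P.m (P.X b)) ≤
      (2 * (2 * P.h + 4) + 1) * #(finished P.src P.dst P.m (P.X b)) := by
    intro b
    induction b using Nat.strong_induction_on with
    | _ b ih =>
      intro hb
      rcases Nat.lt_or_ge b P.N with hbN | hbN
      · exact card_captured_of_card_le_one (card_X_le_one b hbN)
      · have hl := P.left_lt b hbN hb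
        have hr := P.right_lt b hbN hb
        have hX := P.X_merge b hbN hb
        rw [hX]
        exact card_captured_union P.inj (P.disj b hbN hb) (hX ▸ P.X_subset b hb)
          (card_border_le _ (by omega)) (card_border_le _ (by omega)) (ih _ hl (by omega))
          (ih _ hr (by omega))
  have := key (2 * P.N - 2) (by omega)
  rw [P.root h] at this
  have hcap : captured P.src P.dst P.m (range P.m) = range P.m := by
    refine filter_true_of_mem fun i hi => ⟨2 * P.src i, by simp [touch], fun hb => ?_⟩
    have := mem_border.1 hb
    omega
  have hfin : #(finished P.src P.dst P.m (range P.m)) ≤ 2 * P.n := by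
    refine (card_le_card (t := range (2 * P.n)) fun s hs => ?_).trans_eq (card_range _)
    obtain ⟨i, hi, hs⟩ := mem_biUnion.1 (mem_sdiff.1 hs).1
    have h₁ := P.src_lt i (mem_range.1 hi)
    have h₂ := P.dst_lt i (mem_range.1 hi)
    simp only [touch, mem_insert, mem_singleton] at hs
    rw [mem_range]
    omega
  rw [hcap, card_range] at this
  exact this.trans ((Nat.mul_le_mul_left _ hfin).trans_eq (by ring))

end Plan

end MaxTwoColor

namespace MaxTwoColor

open RAM SlotCode Slots Finset

/-! ### Setting up the tables of the nodes -/

theorem cnt_range_succ (src dst : ℕ → ℕ) (j s : ℕ) : cnt src dst (range (j + 1)) s =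
    cnt src dst (range j) s + if s ∈ touch src dst j then 1 else 0 := by
  unfold cnt
  rw [range_add_one, filter_insert]
  split_ifs with h
  · rw [card_insert_of_notMem (by simp)]
  · rfl

theorem runs_degrees {σ : Store} {m : ℕ} (hm : σ.var vM = m)
    (hne : ∀ i < m, σ.arr aSrc i ≠ σ.arr aDst i) (h0 : ∀ a, σ.arr aDeg a = 0) :
    Runs degrees σ (70 * (m + 1)) fun τ =>
      ∀ s, τ.arr aDeg s = cnt (σ.arr aSrc) (σ.arr aDst) (range m) s := by
  refine ((Runs.of_result (p := vI ≔ .const 0) (Q := fun τ => τ.var vI = 0) rfl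
    (by simp)).seq_frame fun τ hτ F => Runs.for_loop (n := m) (T := 60)
    (I := fun j τ => τ.var vI = j ∧
      ∀ s, τ.arr aDeg s = cnt (σ.arr aSrc) (σ.arr aDst) (range j) s) ?_ ?_ ?_).mono ?_ ?_
  · rintro j ρ - ⟨hj, -⟩ F'
    have := (F'.var vM rfl).trans (F.var vM rfl)
    simp only [Expr.eval, hj, this, hm]
    omega
  · rintro j ρ hj ⟨hv, hI⟩ F'
    have a₁ := (F'.arr aSrc rfl).trans (F.arr aSrc rfl)
    have a₂ := (F'.arr aDst rfl).trans (F.arr aDst rfl)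
    have hn := hne j hj
    refine Runs.mono (Runs.of_result rfl ?_) (by decide) fun _ h => h
    refine ⟨by simp [incr, hv], fun s => ?_⟩
    rw [cnt_range_succ, ← hI]
    simp only [incr, Prog.result, Expr.eval, Store.setVar_var, Store.setVar_arr,
      Store.setEntry_var, Store.setEntry_arr, hv, a₁, a₂, if_true, if_false, Nat.reduceEqDiff,
      touch, mem_insert, mem_singleton, Function.update_apply]
    generalize σ.arr aSrc j = u at *
    generalize σ.arr aDst j = v at *
    by_cases e₁ : s = u + u
    · subst e₁
      have : u + u ≠ v + v + 1 := by omega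
      have : u + u ≠ v + v := by omega
      simp [*, two_mul]
    · by_cases e₂ : s = u + u + 1
      · subst e₂
        have : u + u + 1 ≠ v + v := by omega
        have : u ≠ v := by omega
        simp [*, two_mul]
        omega
      · by_cases e₃ : s = v + v
        · subst e₃
          simp [*, two_mul]
        · by_cases e₄ : s = v + v + 1
          · subst e₄
            have : v + v ≠ u + u := by omega
            simp [*, two_mul]
          · simp [*, two_mul]
  · exact ⟨hτ, fun s => by rw [F.arr aDeg rfl, h0]; simp [cnt]⟩
  · simp only [Prog.maxCost, Expr.cost]
    omega
  · exact fun τ h => h.2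

theorem runs_initBlocks {σ : Store} {n N : ℕ} (hn : σ.var vN = n) (hN : σ.var vNodes = N)
    (hrow : σ.var vRow = 0) (hnext : σ.var vNext = 0) (hz : ∀ a, σ.arr aVal a = 0) :
    Runs initBlocks σ (60 * (N + 1)) fun τ =>
      τ.var vStride = 2 * n ∧ τ.var vRow = N * (2 * n) ∧ τ.var vNext = 16 * N ∧
      (∀ t < N, τ.arr aBase t = 16 * t ∧ τ.arr aRow t = t * (2 * n)) ∧
      ∀ a, τ.arr aVal a = if a % 16 = 0 ∧ a < 16 * N then 1 else 0 := by
  refine ((Runs.of_result (p := vI ≔ .const 0) (Q := fun τ => τ.var vI = 0) rfl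
    (by simp)).seq_frame fun τ hτ F => (Runs.of_result (p := vStride ≔ .var vN +ₑ .var vN)
      (Q := fun ρ => ρ.var vI = 0 ∧ ρ.var vStride = 2 * n) rfl ?_).seq_frame fun ρ hρ F₂ =>
    Runs.for_loop (n := N) (T := 50)
    (I := fun j τ => τ.var vI = j ∧ τ.var vStride = 2 * n ∧ τ.var vRow = j * (2 * n) ∧
      τ.var vNext = 16 * j ∧
      (∀ t < j, τ.arr aBase t = 16 * t ∧ τ.arr aRow t = t * (2 * n)) ∧
      ∀ a, τ.arr aVal a = if a % 16 = 0 ∧ a < 16 * j then 1 else 0) ?_ ?_ ?_).mono ?_ ?_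
  · have := F.var vN rfl
    simp [hτ, this, hn]
    omega
  · rintro j π - ⟨hj, -⟩ F'
    have : π.var vNodes = N := by rw [F'.var vNodes rfl, F₂.var vNodes rfl, F.var vNodes rfl, hN]
    simp only [Expr.eval, hj, this]
    omega
  · rintro j π hj ⟨h₁, h₂, h₃, h₄, h₅, h₆⟩ -
    refine Runs.mono (Runs.of_result rfl ?_) (by decide) fun _ h => h
    refine ⟨?_, ?_, ?_, ?_, ?_, ?_⟩
    · simp [incr, h₁]
    · simp [incr, h₂]
    · simp [incr, h₂, h₃, Nat.add_mul]
    · simp [incr, h₄]; omega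
    · intro t ht
      rcases Nat.lt_succ_iff_lt_or_eq.1 ht with hlt | rfl
      · simp [incr, h₁, Function.update_of_ne hlt.ne, h₅ t hlt]
      · simp [incr, h₁, h₃, h₄]
    · intro a
      simp only [incr, Prog.result, Expr.eval, Store.setVar_var, Store.setVar_arr,
        Store.setEntry_var, Store.setEntry_arr, if_true, if_false, Nat.reduceEqDiff,
        Function.update_apply, h₄, h₆]
      split_ifs <;> omega
  · refine ⟨hρ.1, hρ.2, ?_, ?_, by simp, fun a => ?_⟩
    · rw [F₂.var vRow rfl, F.var vRow rfl, hrow]; simp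
    · rw [F₂.var vNext rfl, F.var vNext rfl, hnext]
    · rw [F₂.arr aVal rfl, F.arr aVal rfl, hz]; simp
  · simp only [Prog.maxCost, Expr.cost]
    omega
  · exact fun τ h => h.2

/-- The slots at the ends of an edge, as a list. -/
def slotList (src dst : ℕ → ℕ) (i : ℕ) : List ℕ :=
  [2 * src i, 2 * dst i, 2 * src i + 1, 2 * dst i + 1]

theorem mem_slotList {src dst : ℕ → ℕ} {i s : ℕ} :
    s ∈ slotList src dst i ↔ s ∈ touch src dst i := by
  simp [slotList, touch]

theorem wt_slotList {src dst : ℕ → ℕ} {i : ℕ} (h : src i ≠ dst i) (s : ℕ) :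
    wt (slotList src dst i) s = if s = 2 * dst i + 1 then 8 else if s = 2 * src i + 1 then 4 else
      if s = 2 * dst i then 2 else if s = 2 * src i then 1 else 0 := by
  have h₁ : 2 * src i ≠ 2 * dst i := by omega
  have h₂ : 2 * src i ≠ 2 * src i + 1 := by omega
  have h₃ : 2 * src i ≠ 2 * dst i + 1 := by omega
  have h₄ : 2 * dst i ≠ 2 * src i + 1 := by omega
  have h₅ : 2 * dst i ≠ 2 * dst i + 1 := by omega
  have h₆ : 2 * src i + 1 ≠ 2 * dst i + 1 := by omega
  unfold wt slotList
  by_cases e₁ : s = 2 * dst i + 1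
  · rw [if_pos (by simp [e₁]), e₁, List.idxOf_cons_ne _ h₃, List.idxOf_cons_ne _ h₅,
      List.idxOf_cons_ne _ h₆, List.idxOf_cons_self]
    simp
  · by_cases e₂ : s = 2 * src i + 1
    · rw [if_pos (by simp [e₂]), e₂, List.idxOf_cons_ne _ h₂, List.idxOf_cons_ne _ h₄,
        List.idxOf_cons_self]
      simp [h]
    · by_cases e₃ : s = 2 * dst i
      · rw [if_pos (by simp [e₃]), e₃, List.idxOf_cons_ne _ h₁, List.idxOf_cons_self]
        simp [h₄]
      · by_cases e₄ : s = 2 * src i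
        · rw [if_pos (by simp [e₄]), e₄, List.idxOf_cons_self]
          simp [h₁, h₃]
        · simp [e₁, e₂, e₃, e₄]

theorem nodup_slotList {src dst : ℕ → ℕ} {i : ℕ} (h : src i ≠ dst i) :
    (slotList src dst i).Nodup := by
  simp [slotList, h]
  omega

/-- The code of the state of a leaf whose edge has the colour `c`. -/
theorem code_slotList {src dst : ℕ → ℕ} {i c : ℕ} (h : src i ≠ dst i) (hc : c ≤ 2) :
    code (slotList src dst i) (slots src dst i c) =
      if c = 0 then 0 else if c = 1 then 3 else 12 := by
  interval_cases c
  · simp [code, slots]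
  · have h₁ : 2 * src i ≠ 2 * dst i := by omega
    simp only [code, slots, one_ne_zero, if_false, Nat.sub_self, add_zero]
    rw [sum_pair h₁, wt_slotList h, wt_slotList h]
    have h₂ : 2 * src i ≠ 2 * dst i + 1 := by omega
    have h₃ : 2 * dst i ≠ 2 * src i + 1 := by omega
    simp [h₁, h₂, h₃]
  · have h₁ : 2 * src i + 1 ≠ 2 * dst i + 1 := by omega
    simp only [code, slots, OfNat.ofNat_ne_zero, if_false, Nat.add_one_sub_one]
    rw [sum_pair h₁, wt_slotList h, wt_slotList h]
    simp [h]

/-- The memory holds the block of the node `t`, with the list `l`. -/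
structure NodeRow (S t : ℕ) (l : List ℕ) (σ : Store) : Prop where
  len : σ.arr aLen t = l.length
  get : ∀ i (h : i < l.length), σ.arr aList (t * S + i) = l[i]
  weight : ∀ s < S, σ.arr aWt (t * S + s) = wt l s
  count : ∀ s < S, σ.arr aCnt (t * S + s) = if s ∈ l then 1 else 0
  val : ∀ c < 16, σ.arr aVal (16 * t + c) =
    if c = 0 then 1 else if (c = 3 ∨ c = 12) ∧ l ≠ [] then 2 else 0

theorem NodeRow.congr {S t : ℕ} {l : List ℕ} {σ τ : Store} (h : NodeRow S t l σ)
    (hl : l.length ≤ S) (h₁ : τ.arr aLen t = σ.arr aLen t)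
    (h₂ : ∀ s < S, τ.arr aList (t * S + s) = σ.arr aList (t * S + s))
    (h₃ : ∀ s < S, τ.arr aWt (t * S + s) = σ.arr aWt (t * S + s))
    (h₄ : ∀ s < S, τ.arr aCnt (t * S + s) = σ.arr aCnt (t * S + s))
    (h₅ : ∀ c < 16, τ.arr aVal (16 * t + c) = σ.arr aVal (16 * t + c)) : NodeRow S t l τ where
  len := h₁.trans h.len
  get i hi := by rw [h₂ i (by omega), h.get i hi]
  weight s hs := by rw [h₃ s hs, h.weight s hs]
  count s hs := by rw [h₄ s hs, h.count s hs]
  val c hc := by rw [h₅ c hc, h.val c hc]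

theorem row_ne {S t t' s s' : ℕ} (h : t ≠ t') (hs : s < S) (hs' : s' < S) :
    t * S + s ≠ t' * S + s' := by
  rcases Nat.lt_or_gt_of_ne h with h | h
  · have := Nat.mul_le_mul_right S (Nat.succ_le_of_lt h)
    rw [Nat.succ_mul] at this
    omega
  · have := Nat.mul_le_mul_right S (Nat.succ_le_of_lt h)
    rw [Nat.succ_mul] at this
    omega

namespace Plan

variable (P : Plan)

/-- The memory after the first `j` leaves have been set up. -/
structure Leaves (j : ℕ) (L : ℕ → List ℕ) (σ : Store) : Prop where
  row : ∀ t < P.N, NodeRow (2 * P.n) t (L t) σ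
  leaf : ∀ i < j, L (P.leaf i) = slotList P.src P.dst i
  nil : ∀ t, (∀ i < j, P.leaf i ≠ t) → L t = []
  wt_above : ∀ a, P.N * (2 * P.n) ≤ a → σ.arr aWt a = 0
  cnt_above : ∀ a, P.N * (2 * P.n) ≤ a → σ.arr aCnt a = 0
  val_above : ∀ a, 16 * P.N ≤ a → σ.arr aVal a = 0

variable {P}

theorem runs_initLeaves {σ : Store} (hm : σ.var vM = P.m)
    (hsrc : ∀ i < P.m, σ.arr aSrc i = P.src i) (hdst : ∀ i < P.m, σ.arr aDst i = P.dst i)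
    (hleaf : ∀ i < P.m, σ.arr aLeaf i = P.leaf i)
    (hbase : ∀ t < P.N, σ.arr aBase t = 16 * t ∧ σ.arr aRow t = t * (2 * P.n))
    (h0 : P.Leaves 0 (fun _ => []) σ) :
    Runs initLeaves σ (130 * (P.m + 1)) fun τ => ∃ L, P.Leaves P.m L τ := by
  refine ((Runs.of_result (p := vI ≔ .const 0) (Q := fun τ => τ.var vI = 0 ∧
    P.Leaves 0 (fun _ => []) τ) rfl ?_).seq_frame fun τ hτ F => Runs.for_loop (n := P.m) (T := 120)
    (I := fun j τ => τ.var vI = j ∧ ∃ L, P.Leaves j L τ) ?_ ?_ ?_).mono ?_ ?_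
  · exact ⟨by simp, ⟨fun t ht => (h0.row t ht).congr (by simp) (by simp) (by simp) (by simp)
      (by simp) (by simp), h0.leaf, h0.nil, by simpa using h0.wt_above, by simpa using h0.cnt_above,
      by simpa using h0.val_above⟩⟩
  · rintro j ρ - ⟨hj, -⟩ F'
    have := (F'.var vM rfl).trans (F.var vM rfl)
    simp only [Expr.eval, hj, this, hm]
    omega
  · rintro j ρ hj ⟨hv, L, hL⟩ F'
    have a₁ : ρ.arr aSrc j = P.src j := by rw [F'.arr aSrc rfl, F.arr aSrc rfl, hsrc j hj]
    have a₂ : ρ.arr aDst j = P.dst j := by rw [F'.arr aDst rfl, F.arr aDst rfl, hdst j hj]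
    have a₃ : ρ.arr aLeaf j = P.leaf j := by rw [F'.arr aLeaf rfl, F.arr aLeaf rfl, hleaf j hj]
    have hlt := P.leaf_lt j hj
    have a₄ : ρ.arr aBase (P.leaf j) = 16 * P.leaf j := by
      rw [F'.arr aBase rfl, F.arr aBase rfl, (hbase _ hlt).1]
    have a₅ : ρ.arr aRow (P.leaf j) = P.leaf j * (2 * P.n) := by
      rw [F'.arr aRow rfl, F.arr aRow rfl, (hbase _ hlt).2]
    have hs := P.src_lt j hj
    have hd := P.dst_lt j hj
    have hne := P.ne j hj
    refine Runs.mono (Runs.of_result rfl ?_) (by decide) fun _ h => h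
    set S := 2 * P.n with hS
    set t := P.leaf j with ht
    set τ' := Prog.result _ ρ with hτ'
    have r₀ : τ'.var vI = j + 1 := by simp [hτ', incr, putSlot, hv]
    have r₁ : τ'.arr aLen = Function.update (ρ.arr aLen) t 4 := by
      simp [hτ', incr, putSlot, hv, a₃]
    have r₂ : τ'.arr aList = Function.update (Function.update (Function.update (Function.update
        (ρ.arr aList) (t * S) (2 * P.src j)) (t * S + 1) (2 * P.dst j))
        (t * S + 2) (2 * P.src j + 1)) (t * S + 3) (2 * P.dst j + 1) := by
      simp [hτ', incr, putSlot, hv, a₃, a₁, a₂, a₅, two_mul]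
    have r₃ : τ'.arr aWt = Function.update (Function.update (Function.update (Function.update
        (ρ.arr aWt) (t * S + 2 * P.src j) 1) (t * S + 2 * P.dst j) 2)
        (t * S + (2 * P.src j + 1)) 4) (t * S + (2 * P.dst j + 1)) 8 := by
      simp [hτ', incr, putSlot, hv, a₃, a₁, a₂, a₅, two_mul]
    have r₄ : τ'.arr aCnt = Function.update (Function.update (Function.update (Function.update
        (ρ.arr aCnt) (t * S + 2 * P.src j) 1) (t * S + 2 * P.dst j) 1)
        (t * S + (2 * P.src j + 1)) 1) (t * S + (2 * P.dst j + 1)) 1 := by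
      simp [hτ', incr, putSlot, hv, a₃, a₁, a₂, a₅, two_mul]
    have r₅ : τ'.arr aVal = Function.update (Function.update (ρ.arr aVal) (16 * t + 3) 2)
        (16 * t + 12) 2 := by
      simp [hτ', incr, putSlot, hv, a₃, a₁, a₂, a₄]
    have htN : (t + 1) * S ≤ P.N * S := Nat.mul_le_mul_right _ hlt
    rw [Nat.succ_mul] at htN
    have hold : L t = [] := hL.nil t fun i hi e => by
      have := P.leaf_inj i (by omega) j hj e
      omega
    have hrow : NodeRow S t (L t) ρ := hL.row t hlt
    rw [hold] at hrow
    refine ⟨r₀, Function.update L t (slotList P.src P.dst j), ⟨?_, ?_, ?_, ?_, ?_, ?_⟩⟩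
    · intro t' ht'
      by_cases e : t' = t
      · subst e
        rw [Function.update_self]
        change NodeRow S t _ τ'
        refine ⟨by rw [r₁]; simp [slotList], ?_, ?_, ?_, ?_⟩
        · intro i hi
          rw [r₂]
          simp only [slotList, List.length_cons, List.length_nil] at hi
          interval_cases i <;> simp [slotList]
        · intro s hs'
          have := hrow.weight s hs'
          rw [r₃, wt_slotList hne]
          simp only [Function.update_apply, Nat.add_left_cancel_iff, this]
          simp [wt]
        · intro s hs'
          have := hrow.count s hs'
          rw [r₄]
          simp only [Function.update_apply, Nat.add_left_cancel_iff, this, slotList, List.mem_cons,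
            List.not_mem_nil, or_false, if_false]
          split_ifs <;> simp_all
        · intro c hc
          have := hrow.val c hc
          rw [r₅]
          simp only [Function.update_apply, Nat.add_left_cancel_iff, this]
          simp only [slotList]
          split_ifs <;> simp_all
      · rw [Function.update_of_ne e]
        have hlen : (L t').length ≤ S := by
          by_cases hex : ∃ i < j, P.leaf i = t'
          · obtain ⟨i, hi, rfl⟩ := hex
            rw [hL.leaf i hi]
            have := P.src_lt i (by omega)
            have := P.dst_lt i (by omega)
            have := P.ne i (by omega)
            simp only [slotList, List.length_cons, List.length_nil]
            omega
          · push Not at hex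
            rw [hL.nil t' hex]; simp
        have hx : ∀ s < S, ∀ s' < S, t' * S + s ≠ t * S + s' := fun s h₁ s' h₂ => row_ne e h₁ h₂
        have hrow' : NodeRow S t' (L t') ρ := hL.row t' ht'
        refine hrow'.congr hlen ?_ ?_ ?_ ?_ ?_
        · rw [r₁, Function.update_of_ne e]
        · intro s h₁
          rw [r₂, Function.update_of_ne (hx s h₁ 3 (by omega)),
            Function.update_of_ne (hx s h₁ 2 (by omega)),
            Function.update_of_ne (hx s h₁ 1 (by omega)),
            Function.update_of_ne (by simpa using hx s h₁ 0 (by omega))]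
        · intro s h₁
          rw [r₃, Function.update_of_ne (hx s h₁ _ (by omega)),
            Function.update_of_ne (hx s h₁ _ (by omega)),
            Function.update_of_ne (hx s h₁ _ (by omega)),
            Function.update_of_ne (hx s h₁ _ (by omega))]
        · intro s h₁
          rw [r₄, Function.update_of_ne (hx s h₁ _ (by omega)),
            Function.update_of_ne (hx s h₁ _ (by omega)),
            Function.update_of_ne (hx s h₁ _ (by omega)),
            Function.update_of_ne (hx s h₁ _ (by omega))]
        · intro c hc
          rw [r₅, Function.update_of_ne (by omega), Function.update_of_ne (by omega)]
    · intro i hi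
      rcases Nat.lt_succ_iff_lt_or_eq.1 hi with hlt | rfl
      · rw [Function.update_of_ne, hL.leaf i hlt]
        intro e
        have := P.leaf_inj i (by omega) j hj e
        omega
      · rw [← ht, Function.update_self]
    · intro t' ht'
      rw [Function.update_of_ne, hL.nil t' fun i hi => ht' i (by omega)]
      exact (ht' j (by omega)).symm
    · intro a ha
      change P.N * S ≤ a at ha
      rw [r₃, Function.update_of_ne (by omega), Function.update_of_ne (by omega),
        Function.update_of_ne (by omega), Function.update_of_ne (by omega), hL.wt_above a ha]
    · intro a ha
      change P.N * S ≤ a at ha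
      rw [r₄, Function.update_of_ne (by omega), Function.update_of_ne (by omega),
        Function.update_of_ne (by omega), Function.update_of_ne (by omega), hL.cnt_above a ha]
    · intro a ha
      rw [r₅, Function.update_of_ne (by omega), Function.update_of_ne (by omega),
        hL.val_above a ha]
  · exact ⟨hτ.1, _, hτ.2⟩
  · simp only [Prog.maxCost, Expr.cost]
    omega
  · exact fun τ h => h.2

theorem Leaves.tables {L : ℕ → List ℕ} {σ : Store} (h : P.Leaves P.m L σ)
    (hbase : ∀ t < P.N, σ.arr aBase t = 16 * t ∧ σ.arr aRow t = t * (2 * P.n))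
    (hS : σ.var vStride = 2 * P.n) (hrow : σ.var vRow = P.N * (2 * P.n))
    (hnext : σ.var vNext = 16 * P.N)
    (hdeg : ∀ s, σ.arr aDeg s = cnt P.src P.dst (range P.m) s)
    (hl : ∀ b, P.N ≤ b → b < 2 * P.N - 1 → σ.arr aLeft b = P.left b)
    (hr : ∀ b, P.N ≤ b → b < 2 * P.N - 1 → σ.arr aRight b = P.right b) : P.Tables P.N L σ := by
  have hX : ∀ b < P.N, (P.X b = ∅ ∧ L b = []) ∨
      ∃ i < P.m, P.X b = {i} ∧ L b = slotList P.src P.dst i := by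
    intro b hb
    rw [P.X_node b hb]
    by_cases hex : ∃ i < P.m, P.leaf i = b
    · obtain ⟨i, hi, rfl⟩ := hex
      refine .inr ⟨i, hi, ?_, h.leaf i hi⟩
      ext i'
      rw [mem_filter, mem_range, mem_singleton]
      exact ⟨fun h' => P.leaf_inj i' h'.1 i hi h'.2, fun h' => by subst h'; exact ⟨hi, rfl⟩⟩
    · push Not at hex
      refine .inl ⟨filter_eq_empty_iff.2 fun i hi => hex i (mem_range.1 hi), h.nil b hex⟩
  have hval : ∀ b < P.N, ∀ c < 16, σ.arr aVal (σ.arr aBase b + c) =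
      if c = 0 then 1 else if (c = 3 ∨ c = 12) ∧ L b ≠ [] then 2 else 0 := fun b hb c hc => by
    rw [(hbase b hb).1]; exact (h.row b hb).val c hc
  have hone : ∀ i s, cnt P.src P.dst {i} s = if s ∈ touch P.src P.dst i then 1 else 0 := by
    intro i s
    unfold cnt
    rw [filter_singleton]
    split_ifs <;> rfl
  have hused : ∀ i f, used P.src P.dst {i} f = slots P.src P.dst i (f i) := fun i f =>
    singleton_biUnion
  have hsize : ∀ i (f : ℕ → ℕ), size {i} f = if f i = 0 then 0 else 1 := by
    intro i f
    unfold size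
    rw [filter_singleton]
    split_ifs <;> simp_all
  refine ⟨hS, hrow, hdeg, hl, hr, h.wt_above, h.cnt_above, by rw [hnext]; exact h.val_above,
    fun b hb => ?_, fun b hb => ?_, fun b h₁ h₂ => absurd h₂ (by omega),
    fun b h₁ h₂ => absurd h₂ (by omega)⟩
  · have hrw := h.row b hb
    rcases hX b hb with ⟨hXb, hLb⟩ | ⟨i, hi, hXb, hLb⟩
    · rw [hLb] at hrw ⊢
      refine ⟨⟨by simp, fun s hs => ?_, by simp⟩, by simp, hrw.len, (hbase b hb).2, hrw.get,
        hrw.weight, ?_, ?_, fun f _ => ?_⟩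
      · rw [hXb] at hs; simp [cnt] at hs
      · intro s hs; rw [hrw.count s hs]; simp
      · rw [(hbase b hb).1, hnext]; simp; omega
      · have : code [] (used P.src P.dst (P.X b) f) = 0 := by simp [code, wt]
        rw [this, hval b hb 0 (by norm_num), hXb]
        simp [size]
    · have hne := P.ne i hi
      rw [hLb] at hrw ⊢
      refine ⟨⟨nodup_slotList hne, fun s hs _ => ?_, fun s hs => ?_⟩, ?_, hrw.len,
        (hbase b hb).2, hrw.get, hrw.weight, fun s hs => ?_, ?_, fun f hf => ?_⟩
      · rw [hXb, hone] at hs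
        rw [mem_slotList]
        by_contra hn
        simp [hn] at hs
      · rw [hXb, hone, if_pos (mem_slotList.1 hs)]; norm_num
      · simp [slotList]
      · rw [hrw.count s hs, hXb, hone]
        simp only [mem_slotList]
        split_ifs <;> rfl
      · rw [(hbase b hb).1, hnext]; simp [slotList]; omega
      · rw [hXb] at hf ⊢
        have h2 := hf.1 i (mem_singleton_self i)
        rw [hused, hsize, code_slotList hne h2, hval b hb _ (by split_ifs <;> norm_num), hLb]
        interval_cases f i <;> simp [slotList]
  · intro c hc hv f hf
    rcases hX b hb with ⟨hXb, hLb⟩ | ⟨i, hi, hXb, hLb⟩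
    · rw [hLb] at hc
      obtain rfl : c = 0 := by simpa using hc
      refine ⟨⟨by simp [hXb], by simp [hXb]⟩, by simp [code, wt, hLb], ?_⟩
      rw [hval b hb 0 (by norm_num), hXb]
      simp [size]
    · have hne := P.ne i hi
      have hc16 : c < 16 := by rw [hLb] at hc; simpa [slotList] using hc
      rw [hval b hb c hc16, hLb] at hv
      have hfi := hf i (by simp [hXb])
      have h2 : f i ≤ 2 := by rw [hfi]; unfold colorOf; split_ifs <;> norm_num
      refine ⟨⟨?_, ?_⟩, ?_, ?_⟩
      · rw [hXb]; simpa using h2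
      · rw [hXb]
        intro i₁ h₁ i₂ h₃ hij
        rw [mem_singleton] at h₁ h₃
        exact absurd (h₁.trans h₃.symm) hij
      · rw [hXb, hused, hLb, code_slotList hne h2, hfi]
        unfold colorOf
        split_ifs at hv ⊢ <;> simp_all
      · rw [hXb, hsize, hval b hb c hc16, hLb, hfi]
        unfold colorOf
        split_ifs at hv ⊢ <;> simp_all [slotList]

end Plan

end MaxTwoColor

namespace MaxTwoColor

open RAM SlotCode Slots Finset Peeling

/-! ### The arrays of the input -/

section Input

variable {n N : ℕ} {G : SimpleGraph (Fin n)} {D : BranchDecomposition G (Fin N)} (L : Listing G D)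

theorem arrayOf_of_lt {k i : ℕ} (f : Fin k → ℕ) (h : i < k) : arrayOf f i = f ⟨i, h⟩ := by
  simp [arrayOf, h]

/-- The first ends of the edges. -/
def srcN : ℕ → ℕ := arrayOf fun i => (L.src i : ℕ)

/-- The second ends of the edges. -/
def dstN : ℕ → ℕ := arrayOf fun i => (L.dst i : ℕ)

/-- The leaves of the edges. -/
noncomputable def leafN : ℕ → ℕ := arrayOf fun i => ((D.leaf (L.edge i) : Fin N) : ℕ)

theorem srcN_eq (i : Fin L.m) : srcN L i = L.src i := arrayOf_of_lt _ i.2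

theorem dstN_eq (i : Fin L.m) : dstN L i = L.dst i := arrayOf_of_lt _ i.2

theorem leafN_eq (i : Fin L.m) : leafN L i = (D.leaf (L.edge i) : Fin N) := arrayOf_of_lt _ i.2

theorem src_ne_dst (i : Fin L.m) : L.src i ≠ L.dst i := by
  have h := (L.edge i).2
  rw [L.edge_eq i, SimpleGraph.mem_edgeSet] at h
  exact h.ne

theorem treeSrc_ne_treeDst (i : Fin L.k) : L.treeSrc i ≠ L.treeDst i := by
  have h := (L.treeEdge i).2
  rw [L.treeEdge_eq i, SimpleGraph.mem_edgeSet] at h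
  exact h.ne

theorem ends_inj (i : ℕ) (hi : i < L.m) (j : ℕ) (hj : j < L.m)
    (h : s(srcN L i, dstN L i) = s(srcN L j, dstN L j)) : i = j := by
  have e₁ := srcN_eq L ⟨i, hi⟩
  have e₂ := dstN_eq L ⟨i, hi⟩
  have e₃ := srcN_eq L ⟨j, hj⟩
  have e₄ := dstN_eq L ⟨j, hj⟩
  simp only at e₁ e₂ e₃ e₄
  rw [e₁, e₂, e₃, e₄] at h
  have h' : s(L.src ⟨i, hi⟩, L.dst ⟨i, hi⟩) = s(L.src ⟨j, hj⟩, L.dst ⟨j, hj⟩) := by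
    rw [Sym2.eq_iff] at h ⊢
    simpa only [Fin.ext_iff] using h
  rw [← L.edge_eq, ← L.edge_eq, Subtype.coe_inj, L.edge.apply_eq_iff_eq, Fin.mk.injEq] at h'
  exact h'

theorem leafN_inj (i : ℕ) (hi : i < L.m) (j : ℕ) (hj : j < L.m)
    (h : leafN L i = leafN L j) : i = j := by
  have e₁ := leafN_eq L ⟨i, hi⟩
  have e₂ := leafN_eq L ⟨j, hj⟩
  simp only at e₁ e₂
  rw [e₁, e₂, ← Fin.ext_iff, Subtype.coe_inj, D.leaf.apply_eq_iff_eq, L.edge.apply_eq_iff_eq,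
    Fin.mk.injEq] at h
  exact h

/-- The numbers of the edges whose leaves satisfy `p`. -/
noncomputable def edgesAt (p : Fin N → Prop) : Finset ℕ :=
  open Classical in {i ∈ range L.m | ∃ h : i < L.m, p (D.leaf (L.edge ⟨i, h⟩))}

variable {L}

theorem mem_edgesAt {p : Fin N → Prop} {i : ℕ} :
    i ∈ edgesAt L p ↔ ∃ h : i < L.m, p (D.leaf (L.edge ⟨i, h⟩)) := by
  simp only [edgesAt, mem_filter, mem_range]
  exact ⟨fun h => h.2, fun h => ⟨h.1, h⟩⟩

theorem mem_touch_iff {i : ℕ} (hi : i < L.m) {s : ℕ} :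
    s ∈ touch (srcN L) (dstN L) i ↔ ∃ v : Fin n, (s = 2 * v ∨ s = 2 * v + 1) ∧
      v ∈ (L.edge ⟨i, hi⟩ : Sym2 (Fin n)) := by
  have e₁ := srcN_eq L ⟨i, hi⟩
  have e₂ := dstN_eq L ⟨i, hi⟩
  simp only at e₁ e₂
  simp only [touch, mem_insert, mem_singleton, e₁, e₂, L.edge_eq, Sym2.mem_iff]
  constructor
  · rintro (h | h | h | h)
    exacts [⟨_, .inl h, .inl rfl⟩, ⟨_, .inl h, .inr rfl⟩, ⟨_, .inr h, .inl rfl⟩,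
      ⟨_, .inr h, .inr rfl⟩]
  · rintro ⟨v, h, rfl | rfl⟩ <;> tauto

theorem card_border_edgesAt_le (p : Fin N → Prop) :
    #(border (srcN L) (dstN L) L.m (edgesAt L p)) ≤
      2 * (edgeBorder {e : G.edgeSet | p (D.leaf e)}).ncard := by
  classical
  set E := edgeBorder {e : G.edgeSet | p (D.leaf e)} with hE
  rw [Set.ncard_eq_toFinset_card' E]
  have hsub : border (srcN L) (dstN L) L.m (edgesAt L p) ⊆
      E.toFinset.image (fun v : Fin n => 2 * (v : ℕ)) ∪
        E.toFinset.image (fun v : Fin n => 2 * (v : ℕ) + 1) := by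
    intro s hs
    obtain ⟨h₁, h₂⟩ := mem_border.1 hs
    obtain ⟨i, hi, hsi⟩ := mem_biUnion.1 (cnt_pos.1 h₁)
    obtain ⟨him, hpi⟩ := mem_edgesAt.1 hi
    obtain ⟨v, hv, hvi⟩ := (mem_touch_iff him).1 hsi
    have : ∃ j ∈ range L.m, s ∈ touch (srcN L) (dstN L) j ∧ j ∉ edgesAt L p := by
      by_contra hcon
      push Not at hcon
      refine absurd h₂ (not_lt.2 (card_le_card fun j hj => ?_))
      rw [mem_filter] at hj ⊢
      exact ⟨hcon j hj.1 hj.2, hj.2⟩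
    obtain ⟨j, hj, hsj, hjp⟩ := this
    have hjm := mem_range.1 hj
    obtain ⟨w, hw, hwj⟩ := (mem_touch_iff hjm).1 hsj
    obtain rfl : v = w := Fin.ext (by omega)
    have hvE : v ∈ E := by
      refine ⟨⟨L.edge ⟨i, him⟩, hpi, hvi⟩, ⟨L.edge ⟨j, hjm⟩, fun h => hjp ?_, hwj⟩⟩
      exact mem_edgesAt.2 ⟨hjm, h⟩
    rw [mem_union, mem_image, mem_image]
    rcases hv with rfl | rfl
    · exact .inl ⟨v, Set.mem_toFinset.2 hvE, rfl⟩
    · exact .inr ⟨v, Set.mem_toFinset.2 hvE, rfl⟩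
  have := (card_le_card hsub).trans (card_union_le _ _)
  have h₁ := card_image_le (s := E.toFinset) (f := fun v : Fin n => 2 * (v : ℕ))
  have h₂ := card_image_le (s := E.toFinset) (f := fun v : Fin n => 2 * (v : ℕ) + 1)
  omega

variable (L) in
/-- A sum over the neighbours of a node of the tree as a sum over the list of edges. -/
theorem sum_nbrs_id (F : Fin N → ℕ) (x : Fin N) : ∑ y ∈ nbrs D.tree id x, F y =
    ∑ j : Fin L.k, ((if L.treeSrc j = x then F (L.treeDst j) else 0) +
      if L.treeDst j = x then F (L.treeSrc j) else 0) := by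
  classical
  have h₁ : ∀ y, (if y ∈ nbrs D.tree id x then F y else 0) =
      ∑ j : Fin L.k, if s(L.treeSrc j, L.treeDst j) = s(x, y) then F y else 0 := by
    intro y
    by_cases hy : D.tree.Adj x y
    · rw [if_pos (mem_nbrs.2 ⟨hy, rfl⟩)]
      have he : s(x, y) ∈ D.tree.edgeSet := hy
      rw [sum_eq_single (L.treeEdge.symm ⟨s(x, y), he⟩)]
      · rw [← L.treeEdge_eq, Equiv.apply_symm_apply, if_pos rfl]
      · intro j _ hj
        rw [if_neg]
        intro hs
        rw [← L.treeEdge_eq] at hs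
        refine hj (L.treeEdge.injective (Subtype.ext ?_))
        rw [hs, Equiv.apply_symm_apply]
      · simp
    · rw [if_neg (fun h => hy (mem_nbrs.1 h).1), sum_eq_zero]
      intro j _
      rw [if_neg]
      intro hs
      rw [← L.treeEdge_eq] at hs
      have h := (L.treeEdge j).2
      rw [hs] at h
      exact hy h
  have h₂ : ∑ y ∈ nbrs D.tree id x, F y = ∑ y, if y ∈ nbrs D.tree id x then F y else 0 := by
    simp
  rw [h₂, sum_congr rfl fun y _ => h₁ y, sum_comm]
  refine sum_congr rfl fun j _ => ?_
  have hne := treeSrc_ne_treeDst L j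
  by_cases hs : L.treeSrc j = x
  · have hd : L.treeDst j ≠ x := fun h => hne (hs.trans h.symm)
    rw [if_pos hs, if_neg hd, add_zero, sum_eq_single (L.treeDst j)]
    · rw [if_pos (by rw [hs])]
    · intro y _ hy
      rw [if_neg]
      rw [Sym2.eq_iff]
      rintro (⟨-, h⟩ | ⟨-, h⟩)
      exacts [hy h.symm, hd h]
    · simp
  · rw [if_neg hs, zero_add]
    by_cases hd : L.treeDst j = x
    · rw [if_pos hd, sum_eq_single (L.treeSrc j)]
      · rw [if_pos (by rw [hd, Sym2.eq_swap])]
      · intro y _ hy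
        rw [if_neg]
        rw [Sym2.eq_iff]
        rintro (⟨h, -⟩ | ⟨h, -⟩)
        exacts [hs h, hy h.symm]
      · simp
    · rw [if_neg hd, sum_eq_zero]
      intro y _
      rw [if_neg]
      rw [Sym2.eq_iff]
      rintro (⟨h, -⟩ | ⟨-, h⟩)
      exacts [hs h, hd h]

end Input

/-! ### Preparing the peeling -/

theorem runs_treeDegrees {σ : Store} {k : ℕ} (hk : σ.var vTree = k)
    (h₁ : ∀ a, σ.arr aTreeDeg a = 0) (h₂ : ∀ a, σ.arr aTreeSum a = 0) :
    Runs treeDegrees σ (60 * (k + 1)) fun τ =>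
      ∀ x, τ.arr aTreeDeg x = ∑ j ∈ range k, ((if σ.arr aTreeSrc j = x then 1 else 0) +
          if σ.arr aTreeDst j = x then 1 else 0) ∧
        τ.arr aTreeSum x = ∑ j ∈ range k,
          ((if σ.arr aTreeSrc j = x then σ.arr aTreeDst j else 0) +
            if σ.arr aTreeDst j = x then σ.arr aTreeSrc j else 0) := by
  refine ((Runs.of_result (p := vI ≔ .const 0) (Q := fun τ => τ.var vI = 0) rfl
    (by simp)).seq_frame fun τ hτ F => Runs.for_loop (n := k) (T := 50)
    (I := fun j τ => τ.var vI = j ∧ ∀ x, τ.arr aTreeDeg x = ∑ j ∈ range j,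
        ((if σ.arr aTreeSrc j = x then 1 else 0) + if σ.arr aTreeDst j = x then 1 else 0) ∧
        τ.arr aTreeSum x = ∑ j ∈ range j,
          ((if σ.arr aTreeSrc j = x then σ.arr aTreeDst j else 0) +
            if σ.arr aTreeDst j = x then σ.arr aTreeSrc j else 0)) ?_ ?_ ?_).mono ?_ ?_
  · rintro j ρ - ⟨hj, -⟩ F'
    have := (F'.var vTree rfl).trans (F.var vTree rfl)
    simp only [Expr.eval, hj, this, hk]
    omega
  · rintro j ρ hj ⟨hv, hI⟩ F'
    have a₁ := (F'.arr aTreeSrc rfl).trans (F.arr aTreeSrc rfl)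
    have a₂ := (F'.arr aTreeDst rfl).trans (F.arr aTreeDst rfl)
    refine Runs.mono (Runs.of_result rfl ?_) (by decide) fun _ h => h
    refine ⟨by simp [incr, hv], fun x => ?_⟩
    obtain ⟨i₁, i₂⟩ := hI x
    rw [sum_range_succ, ← i₁, sum_range_succ, ← i₂]
    clear hI i₁ i₂
    simp only [incr, Prog.result, Expr.eval, Store.setVar_var, Store.setVar_arr,
      Store.setEntry_var, Store.setEntry_arr, hv, a₁, a₂, if_true, if_false, Nat.reduceEqDiff,
      Function.update_apply]
    generalize σ.arr aTreeSrc j = u at *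
    generalize σ.arr aTreeDst j = v at *
    by_cases e₁ : x = u
    · subst e₁
      by_cases e₂ : x = v
      · subst e₂; simp; omega
      · simp [e₂, Ne.symm e₂]
    · by_cases e₂ : x = v
      · subst e₂; simp [e₁, Ne.symm e₁]
      · simp [e₁, e₂, Ne.symm e₁, Ne.symm e₂]
  · exact ⟨hτ, fun x => by rw [F.arr aTreeDeg rfl, F.arr aTreeSum rfl, h₁, h₂]; simp⟩
  · simp only [Prog.maxCost, Expr.cost]
    omega
  · exact fun τ h => h.2

theorem runs_initCur {σ : Store} {N : ℕ} (hN : σ.var vNodes = N) :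
    Runs initCur σ (20 * (N + 1)) fun τ => ∀ t < N, τ.arr aCur t = t := by
  refine ((Runs.of_result (p := vI ≔ .const 0) (Q := fun τ => τ.var vI = 0) rfl
    (by simp)).seq_frame fun τ hτ F => Runs.for_loop (n := N) (T := 10)
    (I := fun j τ => τ.var vI = j ∧ ∀ t < j, τ.arr aCur t = t) ?_ ?_ ?_).mono ?_ ?_
  · rintro j ρ - ⟨hj, -⟩ F'
    have := (F'.var vNodes rfl).trans (F.var vNodes rfl)
    simp only [Expr.eval, hj, this, hN]
    omega
  · rintro j ρ hj ⟨hv, hI⟩ F'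
    refine Runs.mono (Runs.of_result rfl ?_) (by decide) fun _ h => h
    refine ⟨by simp [incr, hv], fun t ht => ?_⟩
    rcases Nat.lt_succ_iff_lt_or_eq.1 ht with hlt | rfl
    · simp [incr, hv, Function.update_of_ne hlt.ne, hI t hlt]
    · simp [incr, hv]
  · exact ⟨hτ, fun i hi => absurd hi (by omega)⟩
  · simp only [Prog.maxCost, Expr.cost]
    omega
  · exact fun τ h => h.2

end MaxTwoColor

namespace MaxTwoColor

open RAM SlotCode Slots Finset Peeling

/-! ### Peeling -/

section Peel

variable {n N : ℕ} {G : SimpleGraph (Fin n)} {D : BranchDecomposition G (Fin N)}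

/-- The state of the peeling of the tree: the degrees and the sums of the neighbours in the
contracted tree, the blocks that belong to its nodes, and the blocks that were merged. -/
structure Peeled (L : Listing G D) (rep : Fin N → Fin N) (X : ℕ → Finset ℕ) (par : ℕ → ℕ) (B : ℕ)
    (deg sum cur left right : ℕ → ℕ) : Prop where
  peeling : IsPeeling D.tree rep
  deg_eq : ∀ x : Fin N, deg x = if rep x = x then #(nbrs D.tree rep x) else 0
  sum_eq : ∀ x : Fin N, rep x = x → sum x = ∑ y ∈ nbrs D.tree rep x, (y : ℕ)
  total : ∑ x : Fin N, deg x + 2 = 2 * #{x | rep x = x}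
  card : #{x | rep x = x} + B = 2 * N
  cur_lt : ∀ x : Fin N, rep x = x → cur x < B
  cur_inj : ∀ x y : Fin N, rep x = x → rep y = y → cur x = cur y → x = y
  par_cur : ∀ x : Fin N, rep x = x → par (cur x) = 0
  par_of_le : ∀ b, B ≤ b → par b = 0
  X_cur : ∀ x : Fin N, rep x = x → X (cur x) = edgesAt L (rep · = x)
  last : ∃ x : Fin N, rep x = x ∧ cur x + 1 = B
  X_node : ∀ b < N, X b = {i ∈ range L.m | leafN L i = b}
  merged : ∀ b, N ≤ b → b < B → left b < b ∧ right b < b ∧ X b = X (left b) ∪ X (right b) ∧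
    Disjoint (X (left b)) (X (right b)) ∧
    #(border (srcN L) (dstN L) L.m (X b)) ≤ 2 * D.width ∧
    par (left b) = b ∧ par (right b) = b ∧ left b ≠ right b

namespace Peeled

variable {L : Listing G D} {rep : Fin N → Fin N} {X : ℕ → Finset ℕ} {par : ℕ → ℕ} {B : ℕ}
  {deg sum cur left right : ℕ → ℕ} (h : Peeled L rep X par B deg sum cur left right)
include h

theorem of_eq {deg' sum' cur' left' right' : ℕ → ℕ} (h₁ : deg' = deg) (h₂ : sum' = sum)
    (h₃ : cur' = cur) (h₄ : left' = left) (h₅ : right' = right) :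
    Peeled L rep X par B deg' sum' cur' left' right' := by
  rwa [h₁, h₂, h₃, h₄, h₅]

theorem le_blocks : N ≤ B := by
  have h₁ := h.card
  have h₂ := card_le_univ ({x | rep x = x} : Finset (Fin N))
  rw [Fintype.card_fin] at h₂
  omega

/-- A node of degree one in the contracted tree. -/
theorem exists_nbrs_eq {t : Fin N} (ht : deg t = 1) :
    ∃ p, rep t = t ∧ nbrs D.tree rep t = {p} ∧ sum t = p := by
  have h₁ := h.deg_eq t
  by_cases hr : rep t = t
  · rw [if_pos hr, ht] at h₁
    obtain ⟨p, hp⟩ := card_eq_one.1 h₁.symm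
    exact ⟨p, hr, hp, by rw [h.sum_eq t hr, hp, sum_singleton]⟩
  · rw [if_neg hr] at h₁
    omega

theorem merge {t p : Fin N} (ht : rep t = t) (hn : nbrs D.tree rep t = {p}) :
    Peeled L (mergeRep rep t p) (Function.update X B (X (cur p) ∪ X (cur t)))
      (Function.update (Function.update par (cur p) B) (cur t) B) (B + 1)
      (Function.update (Function.update deg t 0) p (deg p - 1))
      (Function.update sum p (sum p - t)) (Function.update cur p B)
      (Function.update left B (cur p)) (Function.update right B (cur t)) := by
  have hp : D.tree.Adj t p ∧ rep p = p := mem_nbrs.1 (by simp [hn])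
  have hne : t ≠ p := hp.1.ne
  have hNB := h.le_blocks
  have hself := h.peeling.mergeRep_eq_self_iff ht hn
  have hnbrs := h.peeling.nbrs_merge ht hn
  have hmp : mergeRep rep t p p = p := (hself p).2 ⟨hp.2, hne.symm⟩
  have htp : t ∈ nbrs D.tree rep p := (IsPeeling.mem_nbrs_iff ht hn hp.2).2 rfl
  have hcp := h.cur_lt p hp.2
  have hct := h.cur_lt t ht
  have hcc : cur t ≠ cur p := fun e => hne (h.cur_inj t p ht hp.2 e)
  have halive : ({x | mergeRep rep t p x = x} : Finset (Fin N)) =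
      ({x | rep x = x} : Finset (Fin N)).erase t := by
    ext x
    simp only [mem_filter, mem_univ, true_and, mem_erase, hself]
    tauto
  have hcard : #{x | mergeRep rep t p x = x} + 1 = #{x | rep x = x} := by
    rw [halive, card_erase_add_one]
    simp [ht]
  have hdeg : ∀ x : Fin N, Function.update (Function.update deg t 0) p (deg p - 1) x =
      if x = p then deg p - 1 else if x = t then 0 else deg x := fun x => by
    simp only [Function.update_apply, Fin.val_inj]
  have hdegp := h.deg_eq p
  rw [if_pos hp.2] at hdegp
  have hdegt := h.deg_eq t
  rw [if_pos ht, hn, card_singleton] at hdegt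
  have hpos := card_pos.2 ⟨t, htp⟩
  have hX : X (cur p) ∪ X (cur t) = edgesAt L (mergeRep rep t p · = p) := by
    rw [h.X_cur p hp.2, h.X_cur t ht]
    ext i
    simp only [mem_union, mem_edgesAt, mergeRep]
    constructor
    · rintro (⟨hi, e⟩ | ⟨hi, e⟩)
      · exact ⟨hi, by rw [e]; split_ifs <;> rfl⟩
      · exact ⟨hi, by rw [e, if_pos rfl]⟩
    · rintro ⟨hi, e⟩
      split_ifs at e with h'
      exacts [.inr ⟨hi, h'⟩, .inl ⟨hi, e⟩]
  refine ⟨h.peeling.isPeeling_mergeRep ht hn, ?_, ?_, ?_, ?_, ?_, ?_, ?_, ?_, ?_, ?_, ?_, ?_⟩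
  · intro x
    rw [hdeg, hnbrs]
    by_cases hxp : x = p
    · subst hxp
      rw [if_pos rfl, if_pos hmp, card_erase_of_mem htp, hdegp]
    · rw [if_neg hxp]
      by_cases hxt : x = t
      · rw [if_pos hxt, if_neg fun e => ((hself x).1 e).2 hxt]
      · rw [if_neg hxt, h.deg_eq x]
        by_cases hx : rep x = x
        · rw [if_pos hx, if_pos ((hself x).2 ⟨hx, hxt⟩), erase_eq_of_notMem]
          exact fun hm => hxp ((IsPeeling.mem_nbrs_iff ht hn hx).1 hm)
        · rw [if_neg hx, if_neg fun e => hx ((hself x).1 e).1]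
  · intro x hx
    have hx' := (hself x).1 hx
    rw [hnbrs]
    by_cases hxp : x = p
    · subst hxp
      rw [Function.update_self, h.sum_eq x hx'.1, ← sum_erase_add _ _ htp, Nat.add_sub_cancel]
    · rw [Function.update_of_ne (fun e => hxp (Fin.ext e)), h.sum_eq x hx'.1, erase_eq_of_notMem]
      exact fun hm => hxp ((IsPeeling.mem_nbrs_iff ht hn hx'.1).1 hm)
  · have h₁ := h.total
    rw [← hcard] at h₁
    have hpt : p ∈ (univ : Finset (Fin N)).erase t := by simp [hne.symm]
    rw [← add_sum_erase _ _ (mem_univ t), ← add_sum_erase _ _ hpt] at h₁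
    rw [← add_sum_erase _ _ (mem_univ t), ← add_sum_erase _ _ hpt, hdeg, hdeg, if_neg hne,
      if_pos rfl, if_pos rfl, sum_congr rfl fun x hx => ?_]
    rotate_left
    · exact fun x => deg x
    · simp only [mem_erase] at hx
      rw [hdeg, if_neg hx.1, if_neg hx.2.1]
    · omega
  · have := h.card
    omega
  · intro x hx
    have hx' := (hself x).1 hx
    by_cases hxp : x = p
    · rw [hxp, Function.update_self]; omega
    · rw [Function.update_of_ne (fun e => hxp (Fin.ext e))]
      exact (h.cur_lt x hx'.1).trans (Nat.lt_succ_self _)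
  · intro x y hx hy e
    have hx' := (hself x).1 hx
    have hy' := (hself y).1 hy
    simp only [Function.update_apply, Fin.val_inj] at e
    have := h.cur_lt x hx'.1
    have := h.cur_lt y hy'.1
    split_ifs at e with h₁ h₂ h₃
    · exact h₁.trans h₂.symm
    · omega
    · omega
    · exact h.cur_inj x y hx'.1 hy'.1 e
  · intro x hx
    have hx' := (hself x).1 hx
    by_cases hxp : x = p
    · rw [hxp, Function.update_self, Function.update_of_ne hct.ne', Function.update_of_ne hcp.ne',
        h.par_of_le B le_rfl]
    · rw [Function.update_of_ne (fun e => hxp (Fin.ext e)),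
        Function.update_of_ne (fun e => hx'.2 (h.cur_inj x t hx'.1 ht e)),
        Function.update_of_ne (fun e => hxp (h.cur_inj x p hx'.1 hp.2 e)), h.par_cur x hx'.1]
  · intro b hb
    rw [Function.update_of_ne (by omega), Function.update_of_ne (by omega),
      h.par_of_le b (by omega)]
  · intro x hx
    have hx' := (hself x).1 hx
    by_cases hxp : x = p
    · rw [hxp, Function.update_self, Function.update_self, hX]
    · rw [Function.update_of_ne (fun e => hxp (Fin.ext e)),
        Function.update_of_ne (h.cur_lt x hx'.1).ne, h.X_cur x hx'.1]
      ext i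
      simp only [mem_edgesAt, mergeRep]
      refine exists_congr fun hi => ?_
      split_ifs with h'
      · rw [h']
        exact ⟨fun e => absurd e.symm hx'.2, fun e => absurd e.symm hxp⟩
      · rfl
  · exact ⟨p, hmp, by rw [Function.update_self]⟩
  · intro b hb
    rw [Function.update_of_ne (by omega), h.X_node b hb]
  · intro b hb hbB
    rcases Nat.lt_succ_iff_lt_or_eq.1 hbB with hlt | rfl
    · obtain ⟨h₁, h₂, h₃, h₄, h₅, h₆, h₇, h₈⟩ := h.merged b hb hlt
      have hN : 0 < N := p.pos
      have k₁ : ∀ x : Fin N, rep x = x → left b ≠ cur x := fun x hx e => by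
        have := h.par_cur x hx
        rw [← e, h₆] at this
        omega
      have k₂ : ∀ x : Fin N, rep x = x → right b ≠ cur x := fun x hx e => by
        have := h.par_cur x hx
        rw [← e, h₇] at this
        omega
      rw [Function.update_of_ne hlt.ne _ left, Function.update_of_ne hlt.ne _ right,
        Function.update_of_ne hlt.ne _ X, Function.update_of_ne (h₁.trans hlt).ne,
        Function.update_of_ne (h₂.trans hlt).ne, Function.update_of_ne (k₁ t ht),
        Function.update_of_ne (k₁ p hp.2), Function.update_of_ne (k₂ t ht),
        Function.update_of_ne (k₂ p hp.2)]
      exact ⟨h₁, h₂, h₃, h₄, h₅, h₆, h₇, h₈⟩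
    · rw [Function.update_self, Function.update_self, Function.update_self,
        Function.update_of_ne hcp.ne, Function.update_of_ne hct.ne, Function.update_self,
        Function.update_of_ne hcc.symm, Function.update_self]
      refine ⟨hcp, hct, rfl, ?_, ?_, rfl, rfl, hcc.symm⟩
      · rw [h.X_cur p hp.2, h.X_cur t ht, disjoint_left]
        intro i hi hi'
        obtain ⟨_, e⟩ := mem_edgesAt.1 hi
        obtain ⟨_, e'⟩ := mem_edgesAt.1 hi'
        exact hne (e'.symm.trans e)
      · rw [hX]
        exact (card_border_edgesAt_le _).trans
          (Nat.mul_le_mul_left 2 (h.peeling.ncard_edgeBorder_merge_le ht hn))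

/-- The peeling stops only when a single node is left. -/
theorem blocks_eq (hd : ∀ x : Fin N, deg x ≠ 1) : B + 1 = 2 * N := by
  have h₁ := h.card
  obtain ⟨x, hx, -⟩ := h.last
  have hpos : 0 < #{x | rep x = x} := card_pos.2 ⟨x, by simpa using hx⟩
  by_contra hB
  have h2 : 2 ≤ #{x | rep x = x} := by omega
  have : ∀ y ∈ ({x | rep x = x} : Finset (Fin N)), 2 ≤ deg y := by
    intro y hy
    have hy : rep y = y := by simpa using hy
    have h₃ := h.deg_eq y
    rw [if_pos hy] at h₃
    have h₄ := hd y
    rcases Nat.eq_zero_or_pos (deg y) with h₀ | h₀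
    · rw [h₀] at h₃
      have hall := h.peeling.eq_of_nbrs_eq_empty D.preconnected hy (card_eq_zero.1 h₃.symm)
      have : #{x | rep x = x} ≤ 1 := card_le_one.2 fun a ha b hb => by
        simp only [mem_filter, mem_univ, true_and, hall] at ha hb
        rw [← ha, ← hb]
      omega
    · omega
  have h₅ := card_nsmul_le_sum _ _ _ this
  have h₆ : ∑ y ∈ ({x | rep x = x} : Finset (Fin N)), deg y ≤ ∑ y : Fin N, deg y :=
    sum_le_sum_of_subset (filter_subset _ _)
  have h₇ := h.total
  rw [smul_eq_mul] at h₅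
  omega

theorem exists_plan (hd : ∀ x : Fin N, deg x ≠ 1) : ∃ P : Plan, P.src = srcN L ∧ P.dst = dstN L ∧
    P.leaf = leafN L ∧ P.m = L.m ∧ P.n = n ∧ P.N = N ∧ P.h = D.width ∧ P.left = left ∧
    P.right = right := by
  have hB := h.blocks_eq hd
  have hlt : ∀ b, b < 2 * N - 1 → b < B := fun b hb => by omega
  refine ⟨{ src := srcN L, dst := dstN L, leaf := leafN L, left := left, right := right,
            par := par, m := L.m, n := n, N := N, h := D.width, X := X
            src_lt := fun i hi => ?_
            dst_lt := fun i hi => ?_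
            ne := fun i hi e => ?_
            inj := ends_inj L
            leaf_lt := fun i hi => ?_
            leaf_inj := leafN_inj L
            X_node := h.X_node
            left_lt := fun b hb hb' => (h.merged b hb (hlt b hb')).1
            right_lt := fun b hb hb' => (h.merged b hb (hlt b hb')).2.1
            X_merge := fun b hb hb' => (h.merged b hb (hlt b hb')).2.2.1
            disj := fun b hb hb' => (h.merged b hb (hlt b hb')).2.2.2.1
            border_le := fun b hb hb' => (h.merged b hb (hlt b hb')).2.2.2.2.1
            par_left := fun b hb hb' => (h.merged b hb (hlt b hb')).2.2.2.2.2.1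
            par_right := fun b hb hb' => (h.merged b hb (hlt b hb')).2.2.2.2.2.2.1
            left_ne_right := fun b hb hb' => (h.merged b hb (hlt b hb')).2.2.2.2.2.2.2
            root := fun hN => ?_ }, rfl, rfl, rfl, rfl, rfl, rfl, rfl, rfl, rfl⟩
  · rw [srcN_eq L ⟨i, hi⟩]; exact (L.src _).2
  · rw [dstN_eq L ⟨i, hi⟩]; exact (L.dst _).2
  · rw [srcN_eq L ⟨i, hi⟩, dstN_eq L ⟨i, hi⟩] at e
    exact src_ne_dst L _ (Fin.ext e)
  · rw [leafN_eq L ⟨i, hi⟩]; exact (D.leaf _ : Fin N).2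
  · obtain ⟨x, hx, hxB⟩ := h.last
    have hcur : 2 * N - 2 = cur x := by omega
    have hone : #{x | rep x = x} ≤ 1 := by have := h.card; omega
    rw [hcur, h.X_cur x hx]
    ext i
    rw [mem_edgesAt, mem_range]
    refine ⟨fun hi => hi.1, fun hi => ⟨hi, ?_⟩⟩
    exact card_le_one.1 hone _ (by simpa using h.peeling.idem _) _ (by simpa using hx)

end Peeled

variable {L : Listing G D}

theorem peeled_id {deg sum cur left right : ℕ → ℕ} (hN : 0 < N)
    (hd : ∀ x, deg x = ∑ j ∈ range L.k,
      ((if arrayOf (fun i => (L.treeSrc i : ℕ)) j = x then 1 else 0) +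
        if arrayOf (fun i => (L.treeDst i : ℕ)) j = x then 1 else 0))
    (hs : ∀ x, sum x = ∑ j ∈ range L.k,
      ((if arrayOf (fun i => (L.treeSrc i : ℕ)) j = x then
          arrayOf (fun i => (L.treeDst i : ℕ)) j else 0) +
        if arrayOf (fun i => (L.treeDst i : ℕ)) j = x then
          arrayOf (fun i => (L.treeSrc i : ℕ)) j else 0))
    (hc : ∀ t < N, cur t = t) :
    L.k + 1 = N ∧
    Peeled L id (fun b => {i ∈ range L.m | leafN L i = b}) (fun _ => 0) N deg sum cur left right := by
  classical
  have e₁ : ∀ j : Fin L.k, arrayOf (fun i => (L.treeSrc i : ℕ)) j = L.treeSrc j :=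
    fun j => arrayOf_of_lt _ j.2
  have e₂ : ∀ j : Fin L.k, arrayOf (fun i => (L.treeDst i : ℕ)) j = L.treeDst j :=
    fun j => arrayOf_of_lt _ j.2
  have hd' : ∀ x : Fin N, deg x = #(nbrs D.tree id x) := fun x => by
    rw [hd, sum_range, card_eq_sum_ones, sum_nbrs_id L]
    exact sum_congr rfl fun j _ => by rw [e₁, e₂]; simp only [Fin.val_inj]
  have hs' : ∀ x : Fin N, sum x = ∑ y ∈ nbrs D.tree id x, (y : ℕ) := fun x => by
    rw [hs, sum_range, sum_nbrs_id L fun y => (y : ℕ)]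
    exact sum_congr rfl fun j _ => by rw [e₁, e₂]; simp only [Fin.val_inj]
  have hcu : ∀ x : Fin N, cur x = x := fun x => hc x x.2
  have : Nonempty (Fin N) := ⟨⟨0, hN⟩⟩
  have hT : D.tree.IsTree := ⟨⟨D.preconnected⟩, D.acyclic⟩
  have hk := hT.card_edgeFinset
  rw [SimpleGraph.edgeFinset_card, ← Fintype.card_congr L.treeEdge, Fintype.card_fin,
    Fintype.card_fin] at hk
  have htot : ∑ x : Fin N, deg x = 2 * L.k := by
    rw [sum_congr rfl fun x _ => hd' x]
    have := D.tree.sum_degrees_eq_twice_card_edges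
    rw [SimpleGraph.edgeFinset_card, ← Fintype.card_congr L.treeEdge, Fintype.card_fin] at this
    rw [← this]
    refine sum_congr rfl fun x _ => ?_
    rw [← SimpleGraph.card_neighborFinset_eq_degree]
    congr 1
    ext y
    simp [mem_nbrs]
  refine ⟨hk, isPeeling_id _, fun x => ?_, fun x _ => hs' x, ?_, ?_, fun x _ => ?_,
    fun x y _ _ e => ?_, fun _ _ => rfl, fun _ _ => rfl, fun x _ => ?_, ?_, fun _ _ => rfl,
    fun b hb hb' => absurd hb' (not_lt.2 hb)⟩
  · rw [hd', id_eq, if_pos rfl]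
  · rw [htot]
    simp only [id_eq, filter_true, card_univ, Fintype.card_fin]
    omega
  · simp only [id_eq, filter_true, card_univ, Fintype.card_fin]
    omega
  · rw [hcu]; exact x.2
  · rw [hcu, hcu] at e
    exact Fin.ext e
  · rw [hcu]
    ext i
    simp only [mem_filter, mem_range, mem_edgesAt, id_eq]
    refine ⟨fun ⟨hi, e⟩ => ⟨hi, ?_⟩, fun ⟨hi, e⟩ => ⟨hi, ?_⟩⟩
    · rw [leafN_eq L ⟨i, hi⟩] at e
      exact Fin.ext e
    · rw [leafN_eq L ⟨i, hi⟩, e]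
  · exact ⟨⟨N - 1, by omega⟩, rfl, by rw [hcu]; exact Nat.sub_add_cancel hN⟩

theorem runs_peel {σ : Store} {X : ℕ → Finset ℕ} {par : ℕ → ℕ} (hN : 0 < N)
    (hv : σ.var vNodes = N) (h : Peeled L id X par N (σ.arr aTreeDeg) (σ.arr aTreeSum)
      (σ.arr aCur) (σ.arr aLeft) (σ.arr aRight)) :
    Runs peel σ (200 * (N + 1)) fun τ => τ.var vBlocks = 2 * N - 1 ∧
      ∃ P : Plan, P.src = srcN L ∧ P.dst = dstN L ∧ P.leaf = leafN L ∧ P.m = L.m ∧ P.n = n ∧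
        P.N = N ∧ P.h = D.width ∧ P.left = τ.arr aLeft ∧ P.right = τ.arr aRight := by
  refine ((Runs.of_result (p := vI ≔ .const 0) (Q := fun τ => τ.var vI = 0) rfl
    (by simp)).seq_frame fun τ₁ hτ₁ F₁ => (Runs.of_result (p := vNode ≔ .const 0)
    (Q := fun τ => τ.var vI = 0 ∧ τ.var vNode = 0) rfl (by simp [hτ₁])).seq_frame fun τ₂ hτ₂ F₂ =>
    (Runs.of_result (p := vBlocks ≔ .var vNodes)
    (Q := fun τ => τ.var vI = 0 ∧ τ.var vNode = 0 ∧ τ.var vBlocks = N) rfl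
    (by simp [hτ₂, F₂.var vNodes rfl, F₁.var vNodes rfl, hv])).seq_frame fun τ hτ F =>
    Runs.loop (T := 60)
    (I := fun k τ => ∃ rep X par B i t, Peeled L rep X par B (τ.arr aTreeDeg) (τ.arr aTreeSum)
      (τ.arr aCur) (τ.arr aLeft) (τ.arr aRight) ∧ τ.var vI = i ∧ τ.var vNode = t ∧
      τ.var vBlocks = B ∧ i ≤ N ∧ (i < N → t < N) ∧ (i = N → t = N) ∧
      (∀ x : Fin N, (x : ℕ) ≤ i → τ.arr aTreeDeg x = 1 → (x : ℕ) = t) ∧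
      k = (N - i) + (2 * N - B) ∧ τ.var vNodes = N) ?_ (2 * N) ?_).mono ?_ ?_
  · rintro k ρ ⟨rep, X, par, B, i, t, hP, hi, ht, hB, hiN, h₁, h₂, h₃, hk, hvN⟩ - he
    simp only [Expr.eval, hi, hvN] at he
    have hiN : i < N := by omega
    have htN := h₁ hiN
    by_cases hd : ρ.arr aTreeDeg t = 1
    · obtain ⟨p, hr, hn, hsum⟩ := hP.exists_nbrs_eq (t := ⟨t, htN⟩) hd
      have hm := hP.merge hr hn
      have hp : D.tree.Adj ⟨t, htN⟩ p ∧ rep p = p := mem_nbrs.1 (by simp [hn])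
      have htp : t ≠ p := fun e => hp.1.ne (Fin.ext e)
      have hcard := hm.card
      obtain ⟨x, hx, -⟩ := hm.last
      have hpos := card_pos.2 ⟨x, show x ∈ ({x | mergeRep rep ⟨t, htN⟩ p x = x} : Finset _) by
        simpa using hx⟩
      simp only at hsum
      refine ⟨(N - i) + (2 * N - (B + 1)), by omega,
        Runs.mono (Runs.of_result rfl ⟨mergeRep rep ⟨t, htN⟩ p, _, _, B + 1, i, p,
          hm.of_eq ?_ ?_ ?_ ?_ ?_, ?_, ?_, ?_, hiN.le, fun _ => p.2, fun e => absurd e hiN.ne, ?_, rfl, ?_⟩)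
          (by decide) fun _ h => h⟩
      iterate 5 · simp [peelStep, incr, ht, hB, hd, hsum, htp.symm]
      · simp [peelStep, incr, ht, hi, hd]
      · simp [peelStep, incr, ht, hsum, hd]
      · simp [peelStep, incr, ht, hB, hd]
      · intro x hx hx1
        by_contra hxp
        have hxt : (x : ℕ) ≠ t := fun e => by simp [peelStep, incr, ht, hd, hsum, e, htp] at hx1
        refine hxt (h₃ x hx ?_)
        simpa [peelStep, incr, ht, hd, hsum, hxp, hxt] using hx1
      · simp [peelStep, incr, ht, hd, hvN]
    · have hg : ¬ (ρ.arr aTreeDeg t - 1 = 0 ∧ 1 - ρ.arr aTreeDeg t = 0) := by omega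
      refine ⟨(N - (i + 1)) + (2 * N - B), by omega,
        Runs.mono (Runs.of_result rfl ⟨rep, X, par, B, i + 1, i + 1, hP.of_eq ?_ ?_ ?_ ?_ ?_, ?_, ?_, ?_,
          by omega, fun h => h, fun h => h, ?_, rfl, ?_⟩) (by decide) fun _ h => h⟩
      iterate 5 · simp only [Prog.result, Expr.eval, ht, Nat.add_eq_zero_iff, hg, if_false, incr,
          Store.setVar_arr]
      · simp [ht, hg, incr, hi]
      · simp [ht, hg, incr, hi]
      · simp [ht, hg, incr, hB]
      · intro x hx hx1
        have hx1 : ρ.arr aTreeDeg x = 1 := by simpa [ht, hg, incr] using hx1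
        rcases Nat.le_succ_iff.1 hx with hle | h
        · exact absurd (h₃ x hle hx1 ▸ hx1) hd
        · exact h
      · simp [ht, hg, incr, hvN]
  · refine ⟨id, X, par, N, 0, 0, ?_, hτ.1, hτ.2.1, hτ.2.2, Nat.zero_le _, fun h => h, fun h => h,
      fun x hx _ => by omega, by omega,
      ((F.var vNodes rfl).trans ((F₂.var vNodes rfl).trans (F₁.var vNodes rfl))).trans hv⟩
    have e : ∀ a, τ.arr a = σ.arr a := fun a =>
      (F.arr a rfl).trans ((F₂.arr a rfl).trans (F₁.arr a rfl))
    rw [e, e, e, e, e]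
    exact h
  · simp only [Prog.maxCost, Expr.cost]
    omega
  · rintro τ ⟨⟨k, rep, X, par, B, i, t, hP, hi, ht, hB, hiN, h₁, h₂, h₃, hk, hvN⟩, he⟩
    simp only [Expr.eval, hi, hvN] at he
    have hd : ∀ x : Fin N, τ.arr aTreeDeg x ≠ 1 := fun x hx => by
      have := h₃ x (by omega) hx
      have := h₂ (by omega)
      omega
    exact ⟨by have := hP.blocks_eq hd; omega, hP.exists_plan hd⟩

end Peel

end MaxTwoColor

namespace MaxTwoColor

open RAM SlotCode Slots Finset Peeling

theorem Plan.runs_finish (P : Plan) {σ : Store} (hsrc : σ.arr aSrc = P.src)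
    (hdst : σ.arr aDst = P.dst) (hleaf : σ.arr aLeaf = P.leaf) (hn : σ.var vN = P.n)
    (hm : σ.var vM = P.m) (hN : σ.var vNodes = P.N) (hrow : σ.var vRow = 0)
    (hnext : σ.var vNext = 0) (hB : σ.var vBlocks = 2 * P.N - 1)
    (hlr : ∀ b, P.N ≤ b → b < 2 * P.N - 1 →
      σ.arr aLeft b = P.left b ∧ σ.arr aRight b = P.right b)
    (h0 : ∀ a, a = aDeg ∨ a = aLen ∨ a = aList ∨ a = aWt ∨ a = aCnt ∨ a = aVal ∨ a = aSel ∨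
      a = aCol → σ.arr a = fun _ => 0) :
    Runs (degrees ⨟ initBlocks ⨟ initLeaves ⨟ computeTables ⨟ trace ⨟ output) σ
      (70 * (P.m + 1) + (60 * (P.N + 1) + (130 * (P.m + 1) +
        (2100 * (P.N + 1) * (P.h + 3) * (P.tripleBound + 1) + 20 * (P.m + 1))))) fun τ =>
      Valid P.src P.dst (range P.m) (τ.arr aOut) ∧ ∀ g, Valid P.src P.dst (range P.m) g →
        size (range P.m) g ≤ size (range P.m) (τ.arr aOut) := by
  refine (runs_degrees hm (fun i hi => by rw [hsrc, hdst]; exact P.ne i hi)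
    (by simp [h0])).seq_frame fun σ₁ h₁ F₁ => ?_
  refine (runs_initBlocks (n := P.n) (N := P.N) (by rw [F₁.var vN rfl, hn])
    (by rw [F₁.var vNodes rfl, hN]) (by rw [F₁.var vRow rfl, hrow])
    (by rw [F₁.var vNext rfl, hnext]) (by simp [F₁.arr aVal rfl, h0])).seq_frame
    fun σ₂ h₂ F₂ => ?_
  obtain ⟨hS, hR, hX, hbase, hval⟩ := h₂
  have z : ∀ a, a = aLen ∨ a = aList ∨ a = aWt ∨ a = aCnt → ∀ j, σ₂.arr a j = 0 := by
    rintro a (rfl | rfl | rfl | rfl) j <;> rw [F₂.arr _ rfl, F₁.arr _ rfl, h0 _ (by simp)]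
  have hL : P.Leaves 0 (fun _ => []) σ₂ := by
    refine ⟨fun t ht => ⟨by simp [z], by simp, by simp [z, wt], by simp [z], fun c hc => ?_⟩,
      by simp, fun _ _ => rfl, by simp [z], by simp [z], fun a ha => ?_⟩
    · rw [hval]
      by_cases hc0 : c = 0
      · rw [if_pos (by omega), if_pos hc0]
      · rw [if_neg (by omega), if_neg hc0]; simp
    · rw [hval, if_neg (by omega)]
  have i₁ : σ₂.arr aSrc = P.src := by rw [F₂.arr aSrc rfl, F₁.arr aSrc rfl, hsrc]
  have i₂ : σ₂.arr aDst = P.dst := by rw [F₂.arr aDst rfl, F₁.arr aDst rfl, hdst]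
  have i₃ : σ₂.arr aLeaf = P.leaf := by rw [F₂.arr aLeaf rfl, F₁.arr aLeaf rfl, hleaf]
  refine (Plan.runs_initLeaves (by rw [F₂.var vM rfl, F₁.var vM rfl, hm]) (by simp [i₁])
    (by simp [i₂]) (by simp [i₃]) hbase hL).seq_frame fun σ₃ ⟨L, hL⟩ F₃ => ?_
  refine Plan.runs_solve (hL.tables ?_ ?_ ?_ ?_ ?_ ?_ ?_) ?_ ?_ ?_ ?_ ?_ ?_
  · rw [F₃.arr aBase rfl, F₃.arr aRow rfl]; exact hbase
  · rw [F₃.var vStride rfl, hS]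
  · rw [F₃.var vRow rfl, hR]
  · rw [F₃.var vNext rfl, hX]
  · rw [F₃.arr aDeg rfl, F₂.arr aDeg rfl, ← hsrc, ← hdst]; exact h₁
  · rw [F₃.arr aLeft rfl, F₂.arr aLeft rfl, F₁.arr aLeft rfl]
    exact fun b hb hb' => (hlr b hb hb').1
  · rw [F₃.arr aRight rfl, F₂.arr aRight rfl, F₁.arr aRight rfl]
    exact fun b hb hb' => (hlr b hb hb').2
  · rw [F₃.var vNodes rfl, F₂.var vNodes rfl, F₁.var vNodes rfl, hN]
  · rw [F₃.var vM rfl, F₂.var vM rfl, F₁.var vM rfl, hm]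
  · rw [F₃.var vBlocks rfl, F₂.var vBlocks rfl, F₁.var vBlocks rfl, hB]
  · rw [F₃.arr aSel rfl, F₂.arr aSel rfl, F₁.arr aSel rfl, h0 _ (by simp)]; exact fun _ => rfl
  · rw [F₃.arr aCol rfl, F₂.arr aCol rfl, F₁.arr aCol rfl, h0 _ (by simp)]; exact fun _ => rfl
  · rw [F₃.arr aLeaf rfl, i₃]; exact fun _ _ => rfl

section Final

variable {n N : ℕ} {G : SimpleGraph (Fin n)} {D : BranchDecomposition G (Fin N)}

theorem runs_peel_zero {σ : Store} (hv : σ.var vNodes = 0) :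
    Runs peel σ 200 fun τ => τ.var vBlocks = 0 := by
  refine ((Runs.of_result (p := vI ≔ .const 0) (Q := fun τ => τ.var vNodes = 0) rfl
    (by simp [hv])).seq fun τ₁ hτ₁ => (Runs.of_result (p := vNode ≔ .const 0)
    (Q := fun τ => τ.var vNodes = 0) rfl (by simp [hτ₁])).seq fun τ₂ hτ₂ =>
    (Runs.of_result (p := vBlocks ≔ .var vNodes)
    (Q := fun τ => τ.var vNodes = 0 ∧ τ.var vBlocks = 0) rfl (by simp [hτ₂])).seq fun τ hτ =>
    Runs.loop (T := 0) (I := fun _ τ => τ.var vNodes = 0 ∧ τ.var vBlocks = 0)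
      (fun _ ρ hρ _ he => absurd (by simp [hρ.1]) he) 0 hτ).mono ?_ ?_
  · simp only [Prog.maxCost, Expr.cost]
    omega
  · exact fun _ h => h.1.elim fun _ h => h.2

variable (L : Listing G D)

theorem card_edges : L.m = G.edgeSet.ncard := by
  rw [← Nat.card_coe_set_eq, ← Nat.card_congr L.edge, Nat.card_fin]

theorem m_eq_zero (hN : N = 0) : L.m = 0 := by
  subst hN
  by_contra h
  exact (D.leaf (L.edge ⟨0, Nat.pos_of_ne_zero h⟩) : Fin 0).elim0

theorem k_eq_zero (hN : N = 0) : L.k = 0 := by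
  subst hN
  by_contra h
  exact (L.treeSrc ⟨0, Nat.pos_of_ne_zero h⟩).elim0

theorem runs_prepare {σ : Store} (hv : σ.var vNodes = N)
    (hd : ∀ x, σ.arr aTreeDeg x = ∑ j ∈ range L.k,
      ((if arrayOf (fun i => (L.treeSrc i : ℕ)) j = x then 1 else 0) +
        if arrayOf (fun i => (L.treeDst i : ℕ)) j = x then 1 else 0))
    (hs : ∀ x, σ.arr aTreeSum x = ∑ j ∈ range L.k,
      ((if arrayOf (fun i => (L.treeSrc i : ℕ)) j = x then
          arrayOf (fun i => (L.treeDst i : ℕ)) j else 0) +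
        if arrayOf (fun i => (L.treeDst i : ℕ)) j = x then
          arrayOf (fun i => (L.treeSrc i : ℕ)) j else 0))
    (hc : ∀ t < N, σ.arr aCur t = t) :
    Runs peel σ (200 * (N + 1)) fun τ => τ.var vBlocks = 2 * N - 1 ∧
      ∃ P : Plan, P.src = srcN L ∧ P.dst = dstN L ∧ P.leaf = leafN L ∧ P.m = L.m ∧ P.n = n ∧
        P.N = N ∧ P.h = D.width ∧ ∀ b, N ≤ b → b < 2 * N - 1 →
          τ.arr aLeft b = P.left b ∧ τ.arr aRight b = P.right b := by
  rcases Nat.eq_zero_or_pos N with hN | hN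
  · have hm := m_eq_zero L hN
    refine (runs_peel_zero (hv.trans hN)).mono (by omega) fun τ hτ => ⟨by omega,
      { src := srcN L, dst := dstN L, leaf := leafN L, left := id, right := id, par := id,
        m := L.m, n := n, N := N, h := D.width, X := fun _ => ∅
        src_lt := by omega
        dst_lt := by omega
        ne := by omega
        inj := by omega
        leaf_lt := by omega
        leaf_inj := by omega
        X_node := by omega
        left_lt := by omega
        right_lt := by omega
        X_merge := by omega
        disj := by omega
        border_le := by omega
        par_left := by omega
        par_right := by omega
        left_ne_right := by omega
        root := by omega }, rfl, rfl, rfl, rfl, rfl, rfl, rfl, by omega⟩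
  · refine (runs_peel hN hv (peeled_id hN hd hs hc).2).mono le_rfl ?_
    rintro τ ⟨h, P, h₁, h₂, h₃, h₄, h₅, h₆, h₇, h₈, h₉⟩
    exact ⟨h, P, h₁, h₂, h₃, h₄, h₅, h₆, h₇, fun b _ _ => by rw [h₈, h₉]; exact ⟨rfl, rfl⟩⟩

/-- A bound for the number of steps. -/
def steps (k N m h : ℕ) : ℕ :=
  60 * (k + 1) + (20 * (N + 1) + (200 * (N + 1) + (70 * (m + 1) + (60 * (N + 1) + (130 * (m + 1) +
    (2100 * (N + 1) * (h + 3) * (2 ^ (4 * h + 8) + 1) + 20 * (m + 1)))))))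

theorem runs_program : Runs program L.input (steps L.k N L.m D.width) fun τ =>
    Valid (srcN L) (dstN L) (range L.m) (τ.arr aOut) ∧
      (∀ g, Valid (srcN L) (dstN L) (range L.m) g →
        size (range L.m) g ≤ size (range L.m) (τ.arr aOut)) ∧
      (0 < N → L.m ≤ (4 * D.width + 9) * (2 * n)) := by
  refine (runs_treeDegrees (σ := L.input) (k := L.k) rfl (fun _ => rfl) fun _ => rfl).seq_frame
    fun σ₁ h₁ F₁ => (runs_initCur (N := N) (F₁.var vNodes rfl)).seq_frame fun σ₂ h₂ F₂ => ?_
  refine (runs_prepare L ((F₂.var vNodes rfl).trans (F₁.var vNodes rfl)) (fun x => ?_) (fun x => ?_)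
    h₂).seq_frame fun σ₃ ⟨hB, P, e₁, e₂, e₃, e₄, e₅, e₆, e₇, h₃⟩ F₃ => ?_
  · rw [F₂.arr aTreeDeg rfl]; exact (h₁ x).1
  · rw [F₂.arr aTreeSum rfl]; exact (h₁ x).2
  have hz : ∀ a, (treeDegrees ⨟ initCur ⨟ peel).setsArr a = false → σ₃.arr a = L.input.arr a := by
    intro a ha
    simp only [Prog.setsArr, Bool.or_eq_false_iff] at ha
    rw [F₃.arr a ha.2.2, F₂.arr a ha.2.1, F₁.arr a ha.1]
  have hw : ∀ x, (treeDegrees ⨟ initCur ⨟ peel).setsVar x = false → σ₃.var x = L.input.var x := by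
    intro a ha
    simp only [Prog.setsVar, Bool.or_eq_false_iff] at ha
    rw [F₃.var a ha.2.2, F₂.var a ha.2.1, F₁.var a ha.1]
  refine (P.runs_finish ((hz aSrc rfl).trans e₁.symm) ((hz aDst rfl).trans e₂.symm)
    ((hz aLeaf rfl).trans e₃.symm) ((hw vN rfl).trans e₅.symm) ((hw vM rfl).trans e₄.symm)
    ((hw vNodes rfl).trans e₆.symm) (hw vRow rfl) (hw vNext rfl) (by rw [hB, e₆])
    (by rw [e₆]; exact h₃) ?_).mono (by rw [Plan.tripleBound, e₄, e₆, e₇]) fun τ hτ => ?_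
  · rintro a (rfl | rfl | rfl | rfl | rfl | rfl | rfl | rfl) <;> exact hz _ rfl
  · rw [e₁, e₂, e₄] at hτ
    refine ⟨hτ.1, hτ.2, fun hN => ?_⟩
    have := P.m_le (by rwa [e₆])
    rwa [e₄, e₅, e₇] at this

end Final

end MaxTwoColor

namespace MaxTwoColor

open RAM SlotCode Slots Finset Peeling

/-! ### Colourings of the line graph -/

section Graph

variable {n N : ℕ} {G : SimpleGraph (Fin n)} {D : BranchDecomposition G (Fin N)} {L : Listing G D}
  {f : ℕ → ℕ}

theorem mem_slots_iff {i : Fin L.m} {c s : ℕ} : s ∈ slots (srcN L) (dstN L) i c ↔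
    c ≠ 0 ∧ ∃ v : Fin n, v ∈ (L.edge i : Sym2 (Fin n)) ∧ s = 2 * v + (c - 1) := by
  unfold slots
  split_ifs with hc
  · simp [hc]
  · rw [L.edge_eq, srcN_eq, dstN_eq]
    simp only [mem_insert, mem_singleton, Sym2.mem_iff, exists_eq_or_imp, exists_eq_left]
    exact ⟨fun h => ⟨hc, h⟩, fun h => h.2⟩

theorem valid_iff : Valid (srcN L) (dstN L) (range L.m) f ↔ (∀ i : Fin L.m, f i ≤ 2) ∧
    ∀ i j : Fin L.m, i ≠ j → f i ≠ 0 → f i = f j → ∀ v : Fin n,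
      v ∈ (L.edge i : Sym2 (Fin n)) → v ∉ (L.edge j : Sym2 (Fin n)) := by
  constructor
  · rintro ⟨h₁, h₂⟩
    refine ⟨fun i => h₁ i (mem_range.2 i.2), fun i j hij hi he v hvi hvj => ?_⟩
    refine disjoint_left.1 (h₂ i (mem_range.2 i.2) j (mem_range.2 j.2) fun e => hij (Fin.ext e))
      (mem_slots_iff.2 ⟨hi, v, hvi, rfl⟩) (mem_slots_iff.2 ⟨he ▸ hi, v, hvj, by rw [he]⟩)
  · rintro ⟨h₁, h₂⟩
    refine ⟨fun i hi => h₁ ⟨i, mem_range.1 hi⟩, fun i hi j hj hij => disjoint_left.2 ?_⟩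
    intro s hs hs'
    have a₁ := h₁ ⟨i, mem_range.1 hi⟩
    have a₂ := h₁ ⟨j, mem_range.1 hj⟩
    obtain ⟨hfi, v, hv, e⟩ := (mem_slots_iff (i := ⟨i, mem_range.1 hi⟩)).1 hs
    obtain ⟨hfj, w, hw, e'⟩ := (mem_slots_iff (i := ⟨j, mem_range.1 hj⟩)).1 hs'
    simp only at a₁ a₂
    obtain rfl : v = w := Fin.ext (by omega)
    exact h₂ ⟨i, mem_range.1 hi⟩ ⟨j, mem_range.1 hj⟩ (fun h => hij (congrArg Fin.val h)) hfi
      (by simp only; omega) v hv hw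

/-- The subgraph of the coloured edges. -/
def colored (L : Listing G D) (f : ℕ → ℕ) : SimpleGraph (Fin n) :=
  SimpleGraph.fromEdgeSet {e | ∃ i : Fin L.m, (L.edge i : Sym2 (Fin n)) = e ∧ f i ≠ 0}

theorem mem_edgeSet_colored {e : Sym2 (Fin n)} :
    e ∈ (colored L f).edgeSet ↔ ∃ i : Fin L.m, (L.edge i : Sym2 (Fin n)) = e ∧ f i ≠ 0 := by
  rw [colored, SimpleGraph.edgeSet_fromEdgeSet]
  refine ⟨fun h => h.1, fun h => ⟨h, ?_⟩⟩
  obtain ⟨i, rfl, -⟩ := h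
  exact G.not_isDiag_of_mem_edgeSet (L.edge i).2

theorem edge_mem_edgeSet_colored {i : Fin L.m} :
    (L.edge i : Sym2 (Fin n)) ∈ (colored L f).edgeSet ↔ f i ≠ 0 := by
  rw [mem_edgeSet_colored]
  refine ⟨?_, fun h => ⟨i, rfl, h⟩⟩
  rintro ⟨j, h, hj⟩
  rwa [← L.edge.injective (Subtype.ext h)]

theorem colored_le : colored L f ≤ G := by
  rw [← SimpleGraph.edgeSet_subset_edgeSet]
  intro e he
  obtain ⟨i, rfl, -⟩ := mem_edgeSet_colored.1 he
  exact (L.edge i).2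

/-- The number of edges of a subgraph. -/
theorem ncard_edgeSet {H : SimpleGraph (Fin n)} (hH : H ≤ G)
    (h : ∀ i : Fin L.m, (L.edge i : Sym2 (Fin n)) ∈ H.edgeSet ↔ f i ≠ 0) :
    H.edgeSet.ncard = size (range L.m) f := by
  have h₁ : size (range L.m) f = #{i : Fin L.m | f i ≠ 0} := by
    rw [size, ← card_map Fin.valEmbedding]
    congr 1
    ext i
    simp only [mem_filter, mem_range, mem_map, mem_univ, true_and, Fin.valEmbedding_apply]
    exact ⟨fun h => ⟨⟨i, h.1⟩, h.2, rfl⟩, fun ⟨j, hj, e⟩ => e ▸ ⟨j.2, hj⟩⟩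
  have h₂ : H.edgeSet = (fun i : Fin L.m => (L.edge i : Sym2 (Fin n))) ''
      ({i : Fin L.m | f i ≠ 0} : Finset (Fin L.m)) := by
    ext e
    simp only [Set.mem_image, coe_filter, mem_univ, true_and, Set.mem_ofPred_eq]
    constructor
    · intro he
      have heG : e ∈ G.edgeSet := SimpleGraph.edgeSet_subset_edgeSet.2 hH he
      refine ⟨L.edge.symm ⟨e, heG⟩, ?_, by rw [Equiv.apply_symm_apply]⟩
      rw [← h, Equiv.apply_symm_apply]
      exact he
    · rintro ⟨i, hi, rfl⟩
      exact (h i).2 hi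
  have hinj : Function.Injective fun i : Fin L.m => (L.edge i : Sym2 (Fin n)) :=
    Subtype.val_injective.comp L.edge.injective
  rw [h₁, h₂, Set.ncard_image_of_injective _ hinj, Set.ncard_coe_finset]

theorem exists_coloring (hf : Valid (srcN L) (dstN L) (range L.m) f) :
    ∃ c : (colored L f).lineGraph.Coloring (Fin 2), ∀ (i : Fin L.m)
      (h : (L.edge i : Sym2 (Fin n)) ∈ (colored L f).edgeSet), f i = (c ⟨L.edge i, h⟩ : ℕ) + 1 := by
  obtain ⟨h₁, h₂⟩ := valid_iff.1 hf
  have hG : ∀ e : (colored L f).edgeSet, (e : Sym2 (Fin n)) ∈ G.edgeSet := fun e =>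
    SimpleGraph.edgeSet_subset_edgeSet.2 colored_le e.2
  have hs : ∀ e : (colored L f).edgeSet, f (L.edge.symm ⟨e, hG e⟩) ≠ 0 := fun e => by
    rw [← edge_mem_edgeSet_colored, Equiv.apply_symm_apply]
    exact e.2
  refine ⟨SimpleGraph.Coloring.mk (fun e => ⟨f (L.edge.symm ⟨e, hG e⟩) - 1, ?_⟩) ?_, ?_⟩
  · have := h₁ (L.edge.symm ⟨e, hG e⟩)
    omega
  · intro e e' hadj heq
    rw [SimpleGraph.lineGraph_adj_iff_exists] at hadj
    obtain ⟨hne, v, hv, hv'⟩ := hadj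
    rw [Fin.mk.injEq] at heq
    have k₁ := hs e
    have k₂ := hs e'
    refine h₂ (L.edge.symm ⟨e, hG e⟩) (L.edge.symm ⟨e', hG e'⟩) ?_ k₁ (by omega) v (by rw [Equiv.apply_symm_apply]; exact hv)
      (by rw [Equiv.apply_symm_apply]; exact hv')
    intro h
    have := congrArg Subtype.val (L.edge.symm.injective h)
    exact hne (Subtype.ext this)
  · intro i h
    have := edge_mem_edgeSet_colored.1 h
    simp [SimpleGraph.Coloring.mk]
    omega

theorem exists_valid {H : SimpleGraph (Fin n)} (hc : H.lineGraph.Colorable 2) :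
    ∃ g, Valid (srcN L) (dstN L) (range L.m) g ∧
      ∀ i : Fin L.m, (L.edge i : Sym2 (Fin n)) ∈ H.edgeSet ↔ g i ≠ 0 := by
  classical
  obtain ⟨c⟩ := hc
  obtain ⟨g, hg⟩ : ∃ g : ℕ → ℕ, ∀ i : Fin L.m, g i =
      if h : (L.edge i : Sym2 (Fin n)) ∈ H.edgeSet then (c ⟨L.edge i, h⟩ : ℕ) + 1 else 0 :=
    ⟨arrayOf fun i : Fin L.m =>
      if h : (L.edge i : Sym2 (Fin n)) ∈ H.edgeSet then (c ⟨L.edge i, h⟩ : ℕ) + 1 else 0,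
      fun i => arrayOf_of_lt _ i.2⟩
  refine ⟨g, valid_iff.2 ⟨fun i => ?_, fun i j hij hi he v hv hv' => ?_⟩, fun i => ?_⟩
  · rw [hg]
    split_ifs with h
    · have := (c ⟨L.edge i, h⟩).2
      omega
    · omega
  · rw [hg, hg] at he
    rw [hg] at hi
    split_ifs at he hi with h h'
    · refine c.valid (v := ⟨L.edge i, h⟩) (w := ⟨L.edge j, h'⟩) ?_ (Fin.ext (by omega))
      rw [SimpleGraph.lineGraph_adj_iff_exists]
      exact ⟨fun e => hij (L.edge.injective (Subtype.ext (Subtype.mk.inj e))), v, hv, hv'⟩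
    all_goals omega
  · rw [hg]
    split_ifs with h <;> simp [h]

theorem exists_isMax (hf : Valid (srcN L) (dstN L) (range L.m) f)
    (hmax : ∀ g, Valid (srcN L) (dstN L) (range L.m) g →
      size (range L.m) g ≤ size (range L.m) f) :
    ∃ (H : SimpleGraph (Fin n)) (c : H.lineGraph.Coloring (Fin 2)),
      IsMaxEdgeColorableSubgraph G 2 H ∧ ∀ i : Fin L.m,
        ((L.edge i : Sym2 (Fin n)) ∉ H.edgeSet → f i = 0) ∧
        ∀ h : (L.edge i : Sym2 (Fin n)) ∈ H.edgeSet, f i = (c ⟨L.edge i, h⟩ : ℕ) + 1 := by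
  obtain ⟨c, hc⟩ := exists_coloring hf
  refine ⟨colored L f, c, ⟨colored_le, ⟨c⟩, fun H' hH' hc' => ?_⟩, fun i => ⟨fun h => ?_, hc i⟩⟩
  · obtain ⟨g, hg, hgH⟩ := exists_valid (L := L) hc'
    rw [ncard_edgeSet hH' hgH, ncard_edgeSet colored_le fun i => edge_mem_edgeSet_colored]
    exact hmax g hg
  · rwa [edge_mem_edgeSet_colored, not_not] at h

end Graph

/-! ### The number of steps -/

theorem add_three_mul_two_pow_le (h : ℕ) : (h + 3) * 2 ^ h ≤ 3 * 3 ^ h := by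
  induction h with
  | zero => norm_num
  | succ h ih =>
    rw [pow_succ, pow_succ]
    nlinarith [Nat.zero_le (2 ^ h), Nat.zero_le (h * 2 ^ h)]

theorem add_three_sq_mul_le (h : ℕ) : (h + 3) ^ 2 * 16 ^ h ≤ 9 * 6 ^ (2 * h) := by
  have h₁ := Nat.pow_le_pow_left (add_three_mul_two_pow_le h) 2
  calc (h + 3) ^ 2 * 16 ^ h = ((h + 3) * 2 ^ h) ^ 2 * 4 ^ h := by
        rw [mul_pow, mul_assoc, ← pow_mul, mul_comm h 2, pow_mul 2, ← mul_pow]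
        norm_num
    _ ≤ (3 * 3 ^ h) ^ 2 * 4 ^ h := Nat.mul_le_mul_right _ h₁
    _ = 9 * 6 ^ (2 * h) := by
        rw [mul_pow, mul_assoc, ← pow_mul, mul_comm h 2, pow_mul 3, ← mul_pow, pow_mul 6]
        norm_num

theorem steps_le {k N m h n : ℕ} (hn : 0 < n) (hk : k ≤ N) (hN : N ≤ 3 * m)
    (hm : m ≤ (4 * h + 9) * (2 * n)) :
    steps k N m h ≤ 316800000 * (6 ^ (2 * h) * (2 * n - 1)) := by
  obtain ⟨M, hM⟩ : ∃ M, M = (4 * h + 9) * (2 * n) := ⟨_, rfl⟩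
  have hM1 : 1 ≤ M := by rw [hM]; exact Nat.mul_pos (by omega) (by omega)
  have hE : 2 ^ (4 * h + 8) + 1 ≤ 512 * 16 ^ h := by
    have := Nat.one_le_pow h 16 (by norm_num)
    rw [pow_add, pow_mul]
    norm_num
    omega
  have h₁ : 2100 * (N + 1) * (h + 3) * (2 ^ (4 * h + 8) + 1) ≤
      2100 * (4 * M) * (h + 3) * (512 * 16 ^ h) :=
    Nat.mul_le_mul (Nat.mul_le_mul_right _ (Nat.mul_le_mul_left _ (by omega))) hE
  have h₂ : 1 ≤ (h + 3) * 16 ^ h := Nat.mul_pos (by omega) (by positivity)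
  have h₃ : steps k N m h ≤ 4400000 * (M * ((h + 3) * 16 ^ h)) := by
    have h₄ : M ≤ M * ((h + 3) * 16 ^ h) := Nat.le_mul_of_pos_right _ h₂
    have h₅ : 2100 * (4 * M) * (h + 3) * (512 * 16 ^ h) = 4300800 * (M * ((h + 3) * 16 ^ h)) := by
      ring
    unfold steps
    omega
  calc steps k N m h ≤ 4400000 * (M * ((h + 3) * 16 ^ h)) := h₃
    _ ≤ 4400000 * ((4 * (h + 3) * (2 * n)) * ((h + 3) * 16 ^ h)) := by
        rw [hM]
        exact Nat.mul_le_mul_left _ (Nat.mul_le_mul_right _ (Nat.mul_le_mul_right _ (by omega)))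
    _ = 35200000 * n * ((h + 3) ^ 2 * 16 ^ h) := by ring
    _ ≤ 35200000 * (2 * n - 1) * (9 * 6 ^ (2 * h)) :=
        Nat.mul_le_mul (Nat.mul_le_mul_left _ (by omega)) (add_three_sq_mul_le h)
    _ = 316800000 * (6 ^ (2 * h) * (2 * n - 1)) := by ring

theorem k_le {n N : ℕ} {G : SimpleGraph (Fin n)} {D : BranchDecomposition G (Fin N)}
    (L : Listing G D) : L.k ≤ N := by
  classical
  rcases Nat.eq_zero_or_pos N with hN | hN
  · rw [k_eq_zero L hN]; exact Nat.zero_le _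
  · have : Nonempty (Fin N) := ⟨⟨0, hN⟩⟩
    have hT : D.tree.IsTree := ⟨⟨D.preconnected⟩, D.acyclic⟩
    have hk := hT.card_edgeFinset
    rw [SimpleGraph.edgeFinset_card, ← Fintype.card_congr L.treeEdge, Fintype.card_fin,
      Fintype.card_fin] at hk
    omega

theorem nodes_le {n N : ℕ} {G : SimpleGraph (Fin n)} {D : BranchDecomposition G (Fin N)}
    (L : Listing G D) : N ≤ 3 * L.m := by
  rcases Nat.eq_zero_or_pos N with hN | hN
  · omega
  · have : Nonempty (Fin N) := ⟨⟨0, hN⟩⟩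
    have := (card_nodes_le D).1
    rwa [Fintype.card_fin, ← card_edges L] at this

end MaxTwoColor

/-- One program solves the maximum 2-edge-colourable subgraph problem on every nonempty graph `G`
that is given with a branch decomposition, of width `h` say, in `O(6 ^ (2 h) (2 |V| - 1))` steps. -/
theorem mainTheorem5 :
    ∃ (P : RAM.Prog) (C : ℕ),
      ∀ (n : ℕ), 0 < n → ∀ (G : SimpleGraph (Fin n)) (N : ℕ) (D : BranchDecomposition G (Fin N))
        (L : Listing G D),
        ∃ (t : ℕ) (τ : RAM.Store),
          RAM.Exec P L.input t τ ∧
          t ≤ C * (6 ^ (2 * D.width) * (2 * n - 1)) ∧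
          ∃ (H : SimpleGraph (Fin n)) (c : H.lineGraph.Coloring (Fin 2)),
            IsMaxEdgeColorableSubgraph G 2 H ∧ L.Outputs τ H c := by
  refine ⟨MaxTwoColor.program, 316800000, fun n hn G N D L => ?_⟩
  obtain ⟨t, τ, he, ht, hv, hmax, hm⟩ := MaxTwoColor.runs_program L
  refine ⟨t, τ, he, ht.trans (MaxTwoColor.steps_le hn (MaxTwoColor.k_le L)
    (MaxTwoColor.nodes_le L) ?_), MaxTwoColor.exists_isMax hv hmax⟩
  rcases Nat.eq_zero_or_pos N with hN | hN
  · rw [MaxTwoColor.m_eq_zero L hN]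
    exact Nat.zero_le _
  · exact hm hN
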